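/- **Setting.** There are $n$ workers, at most $f<n/2$ of them malicious; $\mathcal H\subseteq[n]$, $|\mathcal H|=n-f$, are the honest ones. Worker $i$ holds $m$ data points $\mathcal D_i$. With a differentiable loss $\ell(\cdot;x):\mathbb R^d\to\mathbb R$ put $\mathcal L_i(\theta)=\frac1m\sum_{x\in\mathcal D_i}\ell(\theta;x)$, $\mathcal L_{\mathcal H}=\frac1{n-f}\sum_{i\in\mathcal H}\mathcal L_i$, $\mathcal L_\star=\inf\mathcal L_{\mathcal H}$, $\mathcal L_0=\mathcal L_{\mathcal H}(\theta_0)-\mathcal L_\star$. Assume for all $\theta$: $\frac1{n-f}\sum_{i\in\mathcal H}\langle v,\nabla\mathcal L_i(\theta)-\nabla\mathcal L_{\mathcal H}(\theta)\rangle^2\le G_{\rm cov}^2$ for all $\|v\|\le1$; $\frac1m\sum_{x\in\mathcal D_i}\|\nabla\ell(\theta;x)-\nabla\mathcal L_i(\theta)\|^2\le\sigma^2$ for $i\in\mathcal H$; and $\|\nabla\ell(\theta;x)\|\le C$ for $x\in\mathcal D_i$, $i\in\mathcal H$, where $C\in[0,\infty]$ is the clipping threshold ($C=\infty$: no clipping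 and no condition). Assume that $\nabla\mathcal L_{\mathcal H}$ is $L$-Lipschitz, $L>0$ ("$L$-smooth"). **CAF.** On input $x_1,\dots,x_n$, start with weights $c_i=1$. While $\sum_i c_i\ge n-2f$: let $\hat\mu_c$ be the weighted mean, $\hat\sigma_c^2$ the largest eigenvalue of the weighted covariance matrix, $\hat v_c$ a corresponding unit eigenvector, $\tau_i=\langle\hat v_c,x_i-\hat\mu_c\rangle^2$, $\tau_{\max}=\max_{c_i>0}\tau_i$, and replace $c_i$ by $c_i(1-\tau_i/\tau_{\max})$ (weights that give $\tau_{\max}=0$ are kept, and then nothing changes any more). The output is the $\hat\mu_c$ with the smallest $\hat\sigma_c^2$ met in the loop. A number $\kappa\ge0$ is a *robustness coefficient* of CAF if $\|\mathrm{CAF}(x_1,\dots,x_n)-\bar x_S\|^2\le\kappa\,\lambda_{\max}\big(\frac1{|S|}\sum_{i\in S}(x_i-\bar x_S)(x_i-\bar x_S)^\top\big)$ for all inputs $x_1,\dots,x_n\in\mathbb R^d$ and all $S$ with $|S|=n-f$, $\bar x_S$ being the average over $S$. **CafCor.** Given $\theta_0$, set $m^{(i)}_0=0$ for $i\in\mathcal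 H$. At step $t=0,\dots,T-1$, worker $i\in\mathcal H$ sends $m^{(i)}_t$, where for $t\ge1$ $$m_t^{(i)}=\beta_{t-1}m_{t-1}^{(i)}+(1-\beta_{t-1})\Big(g_t^{(i)}+\sum_{j\ne i}v_t^{(ij)}+\bar v_t^{(i)}\Big);$$ here $g_t^{(i)}$ is the average of the gradients $\nabla\ell(\theta_t;x)$, clipped at $C$, over a mini-batch of $b$ points ($1\le b\le m$) drawn uniformly without replacement from $\mathcal D_i$, $v_t^{(ij)}=-v_t^{(ji)}\sim\mathcal N(0,\sigma_{\rm cor}^2I_d)$, $\bar v^{(i)}_t\sim\mathcal N(0,\sigma_{\rm ind}^2I_d)$, and the mini-batches and noises (one correlated noise per pair) of a step are mutually independent and independent of the history of the previous steps. Malicious workers send arbitrary vectors that may depend on everything that has happened up to and including the current step. The server computes $R_t=\mathrm{CAF}(m_t^{(1)},\dots,m_t^{(n)})$ and $\theta_{t+1}=\theta_t-\gamma_tR_t$. Put $a_1=240$, $a_2=480$, $a_3=5760$, $a_4=270$, $\sigma_b^2=2(1-\frac bm)\frac{\sigma^2}b$ and $$\bar\sigma^2=\frac{\sigma_b^2+d(f\sigma_{\rm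 cor}^2+\sigma_{\rm ind}^2)}{n-f}+4\kappa\Big(\sigma_b^2+108\,(n\sigma_{\rm cor}^2+\sigma_{\rm ind}^2)\big(1+\tfrac d{n-f}\big)\Big).$$ **Theorem.** CAF has robustness coefficients; for instance, $\frac{2f}{n-2f}\big(1+\frac{6(n-f)}{n-2f}\big)$ is one. For every robustness coefficient $\kappa$ of CAF and every $T\ge1$: 1. (Strongly convex case.) If $\mathcal L_{\mathcal H}$ is $\mu$-strongly convex, $\mu>0$, then with $\gamma_t=\frac{10}{\mu(t+a_1L/\mu)}$ and $\beta_t=1-24L\gamma_t$ the random variable $\mathcal L_{\mathcal H}(\theta_T)$ is integrable and $$\mathbb E[\mathcal L_{\mathcal H}(\theta_T)-\mathcal L_\star]\le\frac{4a_1}{\mu}\kappa G_{\rm cov}^2+\frac{2a_1^2L\bar\sigma^2}{\mu^2T}+\frac{2a_1^2L^2\mathcal L_0}{\mu^2T^2}.$$ 2. (Non-convex case.) If $\mathcal L_{\mathcal H}$ is bounded below, then with the constants $\gamma_t=\gamma=\min\Big\{\frac1{24L},\frac{\sqrt{a_4\mathcal L_0}}{2\bar\sigma\sqrt{a_3LT}}\Big\}$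 (that is, $\gamma=\frac1{24L}$ if $\bar\sigma=0$) and $\beta_t=1-24L\gamma$, and with $\hat\theta$ drawn uniformly from $\{\theta_0,\dots,\theta_{T-1}\}$, independently of the run, $\|\nabla\mathcal L_{\mathcal H}(\hat\theta)\|^2$ is integrable and $$\mathbb E\|\nabla\mathcal L_{\mathcal H}(\hat\theta)\|^2\le a_2\kappa G_{\rm cov}^2+\frac{\sqrt{a_3a_4L\mathcal L_0}\,\bar\sigma}{\sqrt T}+\frac{a_4L\mathcal L_0}{T}.$$ -/

import Mathlib

open MeasureTheory ProbabilityTheory Finset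
open scoped Gradient ENNReal NNReal

namespace CafCor

/-- The parameter space `ℝ^d` with its Euclidean norm. -/
abbrev E (d : ℕ) : Type := EuclideanSpace ℝ (Fin d)

/-! ### The aggregation rule CAF (covariance-bound-agnostic filter) -/

section CAF

variable {d n : ℕ}

/-- Mean of `x₁, …, xₙ` with respect to the weights `c`. -/
noncomputable def weightedMean (c : Fin n → ℝ) (x : Fin n → E d) : E d :=
  (∑ i, c i)⁻¹ • ∑ i, c i • x i

/-- Covariance matrix of `x₁, …, xₙ` with respect to the weights `c`. -/
noncomputable def weightedCov (c : Fin n → ℝ) (x : Fin n → E d) : Matrix (Fin d) (Fin d) ℝ :=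
  (∑ i, c i)⁻¹ • ∑ i, c i •
    Matrix.vecMulVec (x i - weightedMean c x).ofLp (x i - weightedMean c x).ofLp

/-- The largest (real) eigenvalue of a matrix; it is applied to covariance matrices only. -/
noncomputable def lambdaMax (M : Matrix (Fin d) (Fin d) ℝ) : ℝ :=
  sSup {l : ℝ | Module.End.HasEigenvalue (Matrix.toEuclideanLin M) l}

/-- `v` is a unit eigenvector of `M` for its largest eigenvalue. -/
def IsTopEigenvector (M : Matrix (Fin d) (Fin d) ℝ) (v : E d) : Prop :=
  ‖v‖ = 1 ∧ Matrix.toEuclideanLin M v = lambdaMax M • v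

/-- Squared deviation of `xᵢ` from the weighted mean in direction `v`. -/
noncomputable def score (c : Fin n → ℝ) (x : Fin n → E d) (v : E d) (i : Fin n) : ℝ :=
  (inner ℝ v (x i - weightedMean c x)) ^ 2

/-- Largest score among the points that still have positive weight. -/
noncomputable def maxScore (c : Fin n → ℝ) (x : Fin n → E d) (v : E d) : ℝ :=
  ⨆ i : {i : Fin n // 0 < c i}, score c x v i

/-- One reweighting step of the filter, `cᵢ ← cᵢ (1 - τᵢ / τ_max)`.
(If `τ_max = 0`, all the remaining points coincide in direction `v`, and the weights are kept.) -/
noncomputable def reweight (c : Fin n → ℝ) (x : Fin n → E d) (v : E d) : Fin n → ℝ :=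
  fun i => c i * (1 - score c x v i / maxScore c x v)

/-- `y` is an output of CAF on the inputs `x₁, …, xₙ` with the bound `f` on the number of corrupted
inputs. Starting from unit weights, the weights are repeatedly updated with a top eigenvector
`v k` of the current weighted covariance (any choice is allowed) as long as their sum is at least
`n - 2f`; the output is the weighted mean at an iteration `k₀` at which the largest eigenvalue of
the weighted covariance is smallest among the iterations of the loop. Once the sum of the
weights has dropped below `n - 2f` it stays below, and the further terms are not used. -/
def IsCAFOutput (f : ℕ) (x : Fin n → E d) (y : E d) : Prop :=
  ∃ (c : ℕ → Fin n → ℝ) (v : ℕ → E d) (k₀ : ℕ),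
    (∀ i, c 0 i = 1) ∧
    (∀ k, IsTopEigenvector (weightedCov (c k) x) (v k)) ∧
    (∀ k, c (k + 1) = reweight (c k) x (v k)) ∧
    (n : ℝ) - 2 * f ≤ ∑ i, c k₀ i ∧
    (∀ k, (n : ℝ) - 2 * f ≤ ∑ i, c k i →
      lambdaMax (weightedCov (c k₀) x) ≤ lambdaMax (weightedCov (c k) x)) ∧
    y = weightedMean (c k₀) x

/-- Unit weights on the members of `S`, so that `weightedMean (unitWeights S) x` is the average and
`weightedCov (unitWeights S) x` the empirical covariance of `(xᵢ)_{i ∈ S}`. -/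
noncomputable def unitWeights (S : Finset (Fin n)) : Fin n → ℝ := fun i => if i ∈ S then 1 else 0

/-- `κ` is a robustness coefficient of CAF in dimension `d`, with `n` inputs of which `f` may be
corrupted: `‖CAF(x₁, …, xₙ) - x̄_S‖² ≤ κ λ_max(Cov_S(x))` for all inputs and all sets `S` of
`n - f` inputs. -/
def IsRobustnessCoefficient (d n f : ℕ) (κ : ℝ) : Prop :=
  0 ≤ κ ∧ ∀ (x : Fin n → E d) (y : E d), IsCAFOutput f x y →
    ∀ S : Finset (Fin n), S.card = n - f →
      ‖y - weightedMean (unitWeights S) x‖ ^ 2 ≤ κ * lambdaMax (weightedCov (unitWeights S) x)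

end CAF

/-! ### The learning problem -/

section Losses

variable {X : Type*} {d n m : ℕ}

/-- Empirical loss of worker `i`, whose dataset is `D i 0, …, D i (m-1)`. -/
noncomputable def localLoss (ℓ : E d → X → ℝ) (D : Fin n → Fin m → X) (i : Fin n) (θ : E d) : ℝ :=
  (m : ℝ)⁻¹ * ∑ k, ℓ θ (D i k)

/-- The honest loss `L_H`. -/
noncomputable def honestLoss (ℓ : E d → X → ℝ) (D : Fin n → Fin m → X) (H : Finset (Fin n))
    (θ : E d) : ℝ :=
  (H.card : ℝ)⁻¹ * ∑ i ∈ H, localLoss ℓ D i θ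

/-- Gradient of the loss at a data point. -/
noncomputable def gradAt (ℓ : E d → X → ℝ) (θ : E d) (x : X) : E d := ∇ (fun η => ℓ η x) θ

/-- Heterogeneity bounded by `G²` in every direction. -/
def BoundedHeterogeneity (ℓ : E d → X → ℝ) (D : Fin n → Fin m → X) (H : Finset (Fin n))
    (G : ℝ) : Prop :=
  ∀ θ v : E d, ‖v‖ ≤ 1 →
    (H.card : ℝ)⁻¹ * ∑ i ∈ H,
      (inner ℝ v (∇ (localLoss ℓ D i) θ - ∇ (honestLoss ℓ D H) θ)) ^ 2 ≤ G ^ 2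

/-- Variance of the gradients at a uniform data point of each honest worker bounded by `σ²`. -/
def BoundedVariance (ℓ : E d → X → ℝ) (D : Fin n → Fin m → X) (H : Finset (Fin n))
    (σ : ℝ) : Prop :=
  ∀ i ∈ H, ∀ θ : E d,
    (m : ℝ)⁻¹ * ∑ k, ‖gradAt ℓ θ (D i k) - ∇ (localLoss ℓ D i) θ‖ ^ 2 ≤ σ ^ 2

/-- Gradients at the honest data points bounded by `C ∈ [0, ∞]`; no condition for `C = ∞`. -/
def BoundedGradients (ℓ : E d → X → ℝ) (D : Fin n → Fin m → X) (H : Finset (Fin n))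
    (C : ℝ≥0∞) : Prop :=
  ∀ θ : E d, ∀ i ∈ H, ∀ k, ‖gradAt ℓ θ (D i k)‖ₑ ≤ C

/-- `F` is `L`-smooth: its gradient is `L`-Lipschitz. -/
def IsSmooth (L : ℝ) (F : E d → ℝ) : Prop :=
  ∀ θ θ' : E d, ‖∇ F θ' - ∇ F θ‖ ≤ L * ‖θ' - θ‖

/-- `F` is `μ`-strongly convex (first-order form). -/
def IsStronglyConvex (μ : ℝ) (F : E d → ℝ) : Prop :=
  ∀ θ θ' : E d, μ / 2 * ‖θ' - θ‖ ^ 2 ≤ F θ' - F θ - inner ℝ (∇ F θ) (θ' - θ)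

/-- Clipping at the threshold `C ∈ [0, ∞]`. -/
noncomputable def clip (C : ℝ≥0∞) (g : E d) : E d :=
  open Classical in if ‖g‖ₑ ≤ C then g else (C.toReal / ‖g‖) • g

/-- Average of the clipped gradients over the mini-batch `B` of worker `i`. -/
noncomputable def batchGrad (ℓ : E d → X → ℝ) (D : Fin n → Fin m → X) (C : ℝ≥0∞) (i : Fin n)
    (θ : E d) (B : Finset (Fin m)) : E d :=
  (B.card : ℝ)⁻¹ • ∑ k ∈ B, clip C (gradAt ℓ θ (D i k))

end Losses

/-! ### The algorithm CafCor -/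

/-- The random sources used at one step: the mini-batch of each worker, the correlated noise of each
pair of workers, the independent noise of each worker. -/
abbrev Source (n : ℕ) : Type := Fin n ⊕ {p : Fin n × Fin n // p.1 < p.2} ⊕ Fin n

/-- The centered Gaussian law `N(0, s² I_d)`. -/
noncomputable def gaussianNoise (d : ℕ) (s : ℝ) : Measure (E d) :=
  multivariateGaussian 0 (s ^ 2 • (1 : Matrix (Fin d) (Fin d) ℝ))

/-- An execution of `T` steps of CafCor on the probability space `(Ω, P)`, for the losses `ℓ`, the
datasets `D`, the honest workers `H`, at most `f` malicious workers, batch size `b`, clipping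
threshold `C`, standard deviations `sCor`, `sInd` of the correlated and the independent noise, step
sizes `γ`, momentum coefficients `β` and initial point `θ₀`.

`ℱ t` holds everything known up to and including step `t`. The malicious workers are omniscient:
their step-`t` messages are arbitrary `ℱ t`-measurable vectors. The fresh randomness of the
next step is independent of `ℱ t`. -/
structure Execution {X : Type*} {d n m : ℕ} (ℓ : E d → X → ℝ) (D : Fin n → Fin m → X)
    (H : Finset (Fin n)) (f b : ℕ) (C : ℝ≥0∞) (sCor sInd : ℝ) (γ β : ℕ → ℝ) (θ₀ : E d) (T : ℕ)
    {Ω : Type*} [mΩ : MeasurableSpace Ω] (P : Measure Ω) where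
  /-- history up to and including each step -/
  ℱ : Filtration ℕ mΩ
  /-- mini-batch `batch t i` of worker `i` at step `t` -/
  batch : ℕ → Fin n → Ω → Finset (Fin m)
  /-- correlated noise `corNoise t i j` that worker `i` adds because of worker `j` -/
  corNoise : ℕ → Fin n → Fin n → Ω → E d
  /-- independent noise of each worker -/
  indNoise : ℕ → Fin n → Ω → E d
  /-- `msg t i` is the vector sent by worker `i` at step `t`: the momentum if `i` is honest -/
  msg : ℕ → Fin n → Ω → E d
  /-- aggregate computed by the server -/
  agg : ℕ → Ω → E d
  /-- model parameters -/
  θ : ℕ → Ω → E d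
  -- randomness of step `t + 1`
  batch_measurable : ∀ t, t + 1 < T → ∀ i, Measurable[ℱ (t + 1)] (batch (t + 1) i)
  corNoise_measurable : ∀ t, t + 1 < T → ∀ i j, Measurable[ℱ (t + 1)] (corNoise (t + 1) i j)
  indNoise_measurable : ∀ t, t + 1 < T → ∀ i, Measurable[ℱ (t + 1)] (indNoise (t + 1) i)
  batch_law : ∀ t, t + 1 < T → ∀ i,
    P.map (batch (t + 1) i) = uniformOn {B : Finset (Fin m) | B.card = b}
  corNoise_law : ∀ t, t + 1 < T → ∀ i j, i < j →
    P.map (corNoise (t + 1) i j) = gaussianNoise d sCor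
  corNoise_antisymm : ∀ t, t + 1 < T → ∀ i j ω, corNoise (t + 1) j i ω = -corNoise (t + 1) i j ω
  indNoise_law : ∀ t, t + 1 < T → ∀ i, P.map (indNoise (t + 1) i) = gaussianNoise d sInd
  -- the history `ℱ t` and all the sources of step `t + 1` are mutually independent
  fresh : ∀ t, t + 1 < T → iIndep (fun s : Option (Source n) => match s with
    | none => ℱ t
    | some (.inl i) => MeasurableSpace.comap (batch (t + 1) i) inferInstance
    | some (.inr (.inl p)) => MeasurableSpace.comap (corNoise (t + 1) p.1.1 p.1.2) inferInstance
    | some (.inr (.inr i)) => MeasurableSpace.comap (indNoise (t + 1) i) inferInstance) P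
  -- messages
  msg_zero : ∀ i ∈ H, ∀ ω, msg 0 i ω = 0
  msg_succ : ∀ t, t + 1 < T → ∀ i ∈ H, ∀ ω,
    msg (t + 1) i ω = β t • msg t i ω + (1 - β t) •
      (batchGrad ℓ D C i (θ (t + 1) ω) (batch (t + 1) i ω)
        + ∑ j ∈ univ.erase i, corNoise (t + 1) i j ω + indNoise (t + 1) i ω)
  msg_malicious : ∀ t, t < T → ∀ i, i ∉ H → Measurable[ℱ t] (msg t i)
  -- server
  agg_measurable : ∀ t, t < T → Measurable[ℱ t] (agg t)
  agg_spec : ∀ t, t < T → ∀ ω, IsCAFOutput f (fun i => msg t i ω) (agg t ω)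
  θ_zero : ∀ ω, θ 0 ω = θ₀
  θ_succ : ∀ t, t < T → ∀ ω, θ (t + 1) ω = θ t ω - γ t • agg t ω

/-! ### Quantities in the bounds -/

/-- `σ_b² = 2 (1 - b/m) σ²/b`. -/
noncomputable def batchVariance (m b : ℕ) (σ : ℝ) : ℝ := 2 * (1 - (b : ℝ) / m) * (σ ^ 2 / b)

/-- `σ̄² = (σ_b² + d (f σ_cor² + σ_ind²)) / (n - f)
    + 4 κ (σ_b² + 108 (n σ_cor² + σ_ind²) (1 + d / (n - f)))`. -/
noncomputable def totalVariance (d n m f b : ℕ) (κ σ sCor sInd : ℝ) : ℝ :=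
  (batchVariance m b σ + d * (f * sCor ^ 2 + sInd ^ 2)) / ((n : ℝ) - f)
    + 4 * κ * (batchVariance m b σ
      + 108 * (n * sCor ^ 2 + sInd ^ 2) * (1 + d / ((n : ℝ) - f)))

/-- The constant step size `min {1/(24 L), √(a₄ L₀) / (2 σ̄ √(a₃ L T))}` with `a₃ = 5760` and
`a₄ = 270`; the second term is `+∞` when `σ̄ = 0`. -/
noncomputable def constantStep (L L₀ σbar : ℝ) (T : ℕ) : ℝ :=
  open Classical in
  if σbar = 0 then 1 / (24 * L)
  else min (1 / (24 * L)) (√(270 * L₀) / (2 * σbar * √(5760 * L * T)))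

end CafCor

/-!
As long as the honest points carry less than half of the weighted scores, a step of the filter
removes no more weight from honest points than from the others. Hence some iterate met before the
exit of the loop has lost at most as much honest as foreign weight and has a covariance comparable
to that of the honest points, and two weighted means are close whenever one weight dominates the
other and the covariance of the larger weight is small. This gives a robustness coefficient.

For the descent, an honest message is the momentum of the gradients at the iterates, perturbed by
heterogeneity, mini-batch errors and injected noise. The momentum of the injected noises is jointly
sub-Gaussian, because the coefficients of a pair of correlated noises depend on the two workers
only through a difference; comparing a quadratic form on the unit ball with an average of its
exponential bounds the expectation of its largest value, uniformly in the direction and hence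
against omniscient malicious workers. So the error of the aggregate is at most `κ` times an
explicit variance. In the mean of the honest messages the correlated noises of two honest workers
cancel.

With `β = 1 - 24 L γ`, the expected excess loss plus the squared error of the mean message divided
by `8 L` decreases by a multiple of `γ ‖∇ F‖²`, up to heterogeneity and noise terms. Strong
convexity turns this into a contraction, solved for the step sizes `10 / (μ (t + K))`; otherwise
the inequalities are summed over `t`.
-/

namespace CafCor

/-! ### Covariance matrices and weighted means -/

section WeightedSums

variable {ι : Type*}

lemma add_sq_le_add_mul_add {p q s t a b : ℝ} (hs : 0 ≤ s) (ht : 0 ≤ t) (ha : 0 ≤ a) (hb : 0 ≤ b)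
    (hp : p ^ 2 ≤ s * a) (hq : q ^ 2 ≤ t * b) : (p + q) ^ 2 ≤ (s + t) * (a + b) := by
  have h := Finset.sum_sq_le_sum_mul_sum_of_sq_le_mul (Finset.univ : Finset Bool)
    (r := fun i => cond i p q) (f := fun i => cond i s t) (g := fun i => cond i a b)
    (by simp [hs, ht]) (by simp [ha, hb]) (by simp [hp, hq])
  simpa using h

lemma sq_sum_mul_le_sum_mul_sum_mul_sq (s : Finset ι) {c : ι → ℝ} (hc : ∀ i ∈ s, 0 ≤ c i)
    (y : ι → ℝ) : (∑ i ∈ s, c i * y i) ^ 2 ≤ (∑ i ∈ s, c i) * ∑ i ∈ s, c i * y i ^ 2 :=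
  Finset.sum_sq_le_sum_mul_sum_of_sq_le_mul _ hc (fun i hi => mul_nonneg (hc i hi) (sq_nonneg _))
    fun i _ => le_of_eq (by ring)

lemma sum_mul_sq_sum_mul_le_of_sum_mul_eq_zero (s : Finset ι) {c c' y : ι → ℝ}
    (hc' : ∀ i ∈ s, 0 ≤ c' i) (hle : ∀ i ∈ s, c' i ≤ c i) (hy : ∑ i ∈ s, c i * y i = 0) :
    (∑ i ∈ s, c i) * (∑ i ∈ s, c' i * y i) ^ 2 ≤
      (∑ i ∈ s, c' i) * (∑ i ∈ s, c i - ∑ i ∈ s, c' i) * ∑ i ∈ s, c i * y i ^ 2 := by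
  have kept := sq_sum_mul_le_sum_mul_sum_mul_sq s hc' y
  have removed := sq_sum_mul_le_sum_mul_sum_mul_sq s (c := fun i => c i - c' i)
    (fun i hi => sub_nonneg.2 (hle i hi)) y
  simp only [sub_mul, Finset.sum_sub_distrib, hy, zero_sub, neg_sq] at removed
  have hW' : 0 ≤ ∑ i ∈ s, c' i := Finset.sum_nonneg hc'
  have hWW' : 0 ≤ ∑ i ∈ s, c i - ∑ i ∈ s, c' i := sub_nonneg.2 (Finset.sum_le_sum hle)
  linarith [mul_le_mul_of_nonneg_left kept hWW', mul_le_mul_of_nonneg_left removed hW']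

end WeightedSums

section LargestEigenvalue

variable {d : ℕ} {M : Matrix (Fin d) (Fin d) ℝ}

lemma inner_toEuclideanLin_le_lambdaMax (hM : M.IsHermitian) (u : E d) :
    inner ℝ (Matrix.toEuclideanLin M u) u ≤ lambdaMax M * ‖u‖ ^ 2 := by
  rcases eq_or_ne u 0 with rfl | hu
  · simp
  have : Nontrivial (E d) := ⟨u, 0, hu⟩
  have hbdd : BddAbove (Set.range fun y : {y : E d // y ≠ 0} =>
      RCLike.re (inner ℝ (Matrix.toEuclideanLin M y) (y : E d)) / ‖(y : E d)‖ ^ 2) := by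
    obtain ⟨B, hB⟩ :=
      (LinearMap.toContinuousLinearMap (Matrix.toEuclideanLin M)).bddAbove_rayleighQuotient
    exact ⟨B, Set.forall_mem_range.2 fun y => (le_abs_self _).trans (hB ⟨y, rfl⟩)⟩
  have heig := (Matrix.isSymmetric_toEuclideanLin_iff.2 hM).hasEigenvalue_iSup_of_finiteDimensional
  have h := (le_ciSup hbdd ⟨u, hu⟩).trans
    (le_csSup (Module.End.finite_hasEigenvalue _).bddAbove heig)
  rwa [RCLike.re_to_real, div_le_iff₀ (by positivity)] at h

lemma lambdaMax_le_of_inner_toEuclideanLin_le {B : ℝ} (hB : 0 ≤ B)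
    (h : ∀ u : E d, ‖u‖ = 1 → inner ℝ (Matrix.toEuclideanLin M u) u ≤ B) : lambdaMax M ≤ B := by
  refine Real.sSup_le (fun l hl => ?_) hB
  obtain ⟨v, hv⟩ := hl.exists_hasEigenvector
  have hunit : ‖(‖v‖⁻¹ • v)‖ = 1 := by
    rw [norm_smul, norm_inv, norm_norm, inv_mul_cancel₀ (norm_ne_zero_iff.2 hv.2)]
  have hB := h _ hunit
  rw [map_smul, hv.apply_eq_smul, smul_comm, real_inner_smul_left, real_inner_self_eq_norm_sq,
    hunit] at hB
  simpa using hB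

lemma lambdaMax_nonneg_of_posSemidef (hM : M.PosSemidef) : 0 ≤ lambdaMax M := by
  refine Real.sSup_nonneg fun l hl => ?_
  obtain ⟨v, hv⟩ := hl.exists_hasEigenvector
  have h := (Matrix.isPositive_toEuclideanLin_iff.2 hM).inner_nonneg_left v
  rw [hv.apply_eq_smul, real_inner_smul_left, real_inner_self_eq_norm_sq] at h
  exact nonneg_of_mul_nonneg_left h (by have := norm_pos_iff.2 hv.2; positivity)

end LargestEigenvalue

section WeightedMean

variable {d n : ℕ} {c c' : Fin n → ℝ} {x : Fin n → E d}

/-- The variance of the points `x` with respect to the weights `c` in direction `u`, that is, the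
quadratic form of `weightedCov c x`. The vector `u` need not have norm one. -/
noncomputable def directionalVariance (c : Fin n → ℝ) (x : Fin n → E d) (u : E d) : ℝ :=
  (∑ i, c i)⁻¹ * ∑ i, c i * inner ℝ u (x i - weightedMean c x) ^ 2

lemma sum_mul_directionalVariance (hc : ∑ i, c i ≠ 0) (x : Fin n → E d) (u : E d) :
    (∑ i, c i) * directionalVariance c x u =
      ∑ i, c i * inner ℝ u (x i - weightedMean c x) ^ 2 := by
  rw [directionalVariance, mul_inv_cancel_left₀ hc]

lemma sum_mul_score (hc : ∑ i, c i ≠ 0) (x : Fin n → E d) (v : E d) :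
    ∑ i, c i * score c x v i = (∑ i, c i) * directionalVariance c x v :=
  (sum_mul_directionalVariance hc x v).symm

lemma toEuclideanLin_weightedCov (c : Fin n → ℝ) (x : Fin n → E d) (u : E d) :
    Matrix.toEuclideanLin (weightedCov c x) u =
      (∑ i, c i)⁻¹ • ∑ i, c i •
        (inner ℝ u (x i - weightedMean c x) • (x i - weightedMean c x)) := by
  ext k
  simp only [weightedCov, map_smul, map_sum, LinearMap.smul_apply, LinearMap.sum_apply,
    PiLp.smul_apply, WithLp.ofLp_sum, Finset.sum_apply, smul_eq_mul]
  congr 1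
  refine Finset.sum_congr rfl fun i _ => ?_
  congr 1
  simp [Matrix.toLpLin_apply, Matrix.vecMulVec_mulVec, PiLp.inner_apply, dotProduct, mul_comm]

lemma inner_toEuclideanLin_weightedCov (c : Fin n → ℝ) (x : Fin n → E d) (u : E d) :
    inner ℝ (Matrix.toEuclideanLin (weightedCov c x) u) u = directionalVariance c x u := by
  rw [real_inner_comm]
  simp only [toEuclideanLin_weightedCov, directionalVariance, real_inner_smul_right, inner_sum, sq]

lemma isHermitian_weightedCov (c : Fin n → ℝ) (x : Fin n → E d) :
    (weightedCov c x).IsHermitian := by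
  refine Matrix.IsHermitian.ext fun k l => ?_
  simp only [weightedCov, Matrix.smul_apply, Matrix.sum_apply, Matrix.vecMulVec_apply, star_trivial,
    smul_eq_mul, mul_comm ((x _ - weightedMean c x).ofLp l)]

lemma posSemidef_weightedCov (hc : ∀ i, 0 ≤ c i) (x : Fin n → E d) :
    (weightedCov c x).PosSemidef :=
  (Matrix.posSemidef_sum _ fun i _ =>
    (Matrix.posSemidef_vecMulVec_self_star _).smul (hc i)).smul
    (inv_nonneg.2 (Finset.sum_nonneg fun i _ => hc i))

lemma lambdaMax_weightedCov_nonneg (hc : ∀ i, 0 ≤ c i) (x : Fin n → E d) :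
    0 ≤ lambdaMax (weightedCov c x) :=
  lambdaMax_nonneg_of_posSemidef (posSemidef_weightedCov hc x)

lemma directionalVariance_le_lambdaMax (c : Fin n → ℝ) (x : Fin n → E d) (u : E d) :
    directionalVariance c x u ≤ lambdaMax (weightedCov c x) * ‖u‖ ^ 2 := by
  rw [← inner_toEuclideanLin_weightedCov]
  exact inner_toEuclideanLin_le_lambdaMax (isHermitian_weightedCov c x) u

lemma IsTopEigenvector.directionalVariance_eq {v : E d}
    (hv : IsTopEigenvector (weightedCov c x) v) :
    directionalVariance c x v = lambdaMax (weightedCov c x) := by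
  rw [← inner_toEuclideanLin_weightedCov, hv.2, real_inner_smul_left, real_inner_self_eq_norm_sq,
    hv.1, one_pow, mul_one]

lemma sum_smul_weightedMean (hc : ∑ i, c i ≠ 0) (x : Fin n → E d) :
    (∑ i, c i) • weightedMean c x = ∑ i, c i • x i := by
  rw [weightedMean, smul_inv_smul₀ hc]

lemma sum_mul_inner_sub (hc : ∑ i, c i ≠ 0) (x : Fin n → E d) (u z : E d) :
    ∑ i, c i * inner ℝ u (x i - z) = (∑ i, c i) * inner ℝ u (weightedMean c x - z) := by
  simp only [← real_inner_smul_right, ← inner_sum, smul_sub, Finset.sum_sub_distrib,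
    sum_smul_weightedMean hc, ← Finset.sum_smul]

lemma sum_mul_inner_sub_sq (hc : ∑ i, c i ≠ 0) (x : Fin n → E d) (u z : E d) :
    ∑ i, c i * inner ℝ u (x i - z) ^ 2 =
      (∑ i, c i) * (directionalVariance c x u + inner ℝ u (weightedMean c x - z) ^ 2) := by
  have hsplit : ∀ i, c i * inner ℝ u (x i - z) ^ 2 =
      c i * inner ℝ u (x i - weightedMean c x) ^ 2
        + 2 * inner ℝ u (weightedMean c x - z) * (c i * inner ℝ u (x i - weightedMean c x))
        + c i * inner ℝ u (weightedMean c x - z) ^ 2 := fun i => by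
    rw [← sub_add_sub_cancel (x i) (weightedMean c x) z, inner_add_right]
    ring
  simp only [hsplit, Finset.sum_add_distrib, ← Finset.mul_sum, ← Finset.sum_mul,
    sum_mul_inner_sub hc, sub_self, inner_zero_right, mul_zero, add_zero, mul_add,
    sum_mul_directionalVariance hc]

lemma sum_mul_directionalVariance_mono (hle : ∀ i, c' i ≤ c i) (hc' : 0 < ∑ i, c' i)
    (x : Fin n → E d) (u : E d) :
    (∑ i, c' i) * directionalVariance c' x u ≤ (∑ i, c i) * directionalVariance c x u := by
  have hc : 0 < ∑ i, c i := hc'.trans_le (Finset.sum_le_sum fun i _ => hle i)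
  calc (∑ i, c' i) * directionalVariance c' x u
      ≤ (∑ i, c' i) * (directionalVariance c' x u
          + inner ℝ u (weightedMean c' x - weightedMean c x) ^ 2) := by
        gcongr
        exact le_add_of_nonneg_right (sq_nonneg _)
    _ = ∑ i, c' i * inner ℝ u (x i - weightedMean c x) ^ 2 :=
        (sum_mul_inner_sub_sq hc'.ne' x u _).symm
    _ ≤ ∑ i, c i * inner ℝ u (x i - weightedMean c x) ^ 2 := by gcongr with i; exact hle i
    _ = (∑ i, c i) * directionalVariance c x u := (sum_mul_directionalVariance hc.ne' x u).symm

lemma sum_mul_sq_norm_weightedMean_sub_le (hc' : ∀ i, 0 ≤ c' i) (hle : ∀ i, c' i ≤ c i)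
    (x : Fin n → E d) :
    (∑ i, c' i) * ‖weightedMean c' x - weightedMean c x‖ ^ 2 ≤
      (∑ i, c i - ∑ i, c' i) * lambdaMax (weightedCov c x) := by
  have hlam := lambdaMax_weightedCov_nonneg (fun i => (hc' i).trans (hle i)) x
  have hWW' : 0 ≤ ∑ i, c i - ∑ i, c' i := sub_nonneg.2 (Finset.sum_le_sum fun i _ => hle i)
  rcases (Finset.sum_nonneg fun i _ => hc' i : 0 ≤ ∑ i, c' i).eq_or_lt with h0 | hW'
  · rw [← h0, zero_mul]
    exact mul_nonneg (h0 ▸ hWW') hlam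
  have hW : 0 < ∑ i, c i := by linarith
  set w := weightedMean c' x - weightedMean c x with hw
  rcases eq_or_ne w 0 with hw0 | hw0
  · simpa [hw0] using mul_nonneg hWW' hlam
  -- in direction `w` itself, the points of weight `c'` have mean deviation `‖w‖ ^ 2`
  have h := sum_mul_sq_sum_mul_le_of_sum_mul_eq_zero univ
    (y := fun i => inner ℝ w (x i - weightedMean c x)) (fun i _ => hc' i) (fun i _ => hle i)
    (by simp only [sum_mul_inner_sub hW.ne', sub_self, inner_zero_right, mul_zero])
  rw [sum_mul_inner_sub hW'.ne', ← hw, real_inner_self_eq_norm_sq,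
    ← sum_mul_directionalVariance hW.ne'] at h
  have hvar := directionalVariance_le_lambdaMax c x w
  refine le_of_mul_le_mul_left (a := (∑ i, c i) * (∑ i, c' i) * ‖w‖ ^ 2) ?_ (by positivity)
  calc _ = (∑ i, c i) * ((∑ i, c' i) * ‖w‖ ^ 2) ^ 2 := by ring
    _ ≤ _ := h
    _ ≤ (∑ i, c' i) * (∑ i, c i - ∑ i, c' i)
          * ((∑ i, c i) * (lambdaMax (weightedCov c x) * ‖w‖ ^ 2)) := by gcongr
    _ = _ := by ring

end WeightedMean

/-! ### The filter -/

section Reweight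

variable {d n : ℕ} {c : Fin n → ℝ} {x : Fin n → E d} {v : E d} {i : Fin n}

lemma score_nonneg (c : Fin n → ℝ) (x : Fin n → E d) (v : E d) (i : Fin n) :
    0 ≤ score c x v i := sq_nonneg _

lemma score_le_maxScore (x : Fin n → E d) (v : E d) (hi : 0 < c i) :
    score c x v i ≤ maxScore c x v :=
  le_ciSup (f := fun i : {i : Fin n // 0 < c i} => score c x v i) (Set.finite_range _).bddAbove
    ⟨i, hi⟩

lemma maxScore_nonneg (c : Fin n → ℝ) (x : Fin n → E d) (v : E d) : 0 ≤ maxScore c x v :=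
  Real.iSup_nonneg fun _ => score_nonneg _ _ _ _

lemma reweight_nonneg (hi : 0 ≤ c i) (x : Fin n → E d) (v : E d) : 0 ≤ reweight c x v i := by
  rcases hi.eq_or_lt with h | h
  · simp [reweight, ← h]
  · exact mul_nonneg h.le (sub_nonneg.2
      (div_le_one_of_le₀ (score_le_maxScore x v h) (maxScore_nonneg c x v)))

lemma reweight_le (hi : 0 ≤ c i) (x : Fin n → E d) (v : E d) : reweight c x v i ≤ c i :=
  mul_le_of_le_one_right hi
    (sub_le_self _ (div_nonneg (score_nonneg _ _ _ _) (maxScore_nonneg _ _ _)))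

lemma sum_reweight (c : Fin n → ℝ) (x : Fin n → E d) (v : E d) (S : Finset (Fin n)) :
    ∑ i ∈ S, reweight c x v i =
      ∑ i ∈ S, c i - (∑ i ∈ S, c i * score c x v i) / maxScore c x v := by
  simp only [reweight, mul_sub, mul_one, Finset.sum_sub_distrib, Finset.sum_div, mul_div_assoc]

lemma exists_reweight_eq_zero (hi : 0 < c i) (hs : 0 < score c x v i) :
    ∃ j, 0 < c j ∧ reweight c x v j = 0 := by
  have : Nonempty {i : Fin n // 0 < c i} := ⟨⟨i, hi⟩⟩
  obtain ⟨j, hj⟩ : ∃ j : {i : Fin n // 0 < c i}, score c x v j = maxScore c x v :=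
    exists_eq_ciSup_of_finite
  have hmax : 0 < maxScore c x v := hs.trans_le (score_le_maxScore x v hi)
  exact ⟨j, j.2, by rw [reweight, hj, div_self hmax.ne', sub_self, mul_zero]⟩

lemma card_pos_reweight_lt (hc : ∀ j, 0 ≤ c j) (hi : 0 < c i) (hs : 0 < score c x v i) :
    #{j | 0 < reweight c x v j} < #{j | 0 < c j} := by
  obtain ⟨j, hj, hj0⟩ := exists_reweight_eq_zero hi hs
  refine Finset.card_lt_card (Finset.ssubset_iff_of_subset ?_ |>.2 ⟨j, ?_, ?_⟩)
  · exact Finset.monotone_filter_right _ fun k _ hk => hk.trans_le (reweight_le (hc k) x v)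
  · simpa using hj
  · simp [hj0]

end Reweight

section Run

variable {d n f : ℕ} {S : Finset (Fin n)} {x : Fin n → E d}

/-- `c` and `v` are the weights and the directions of an unstopped run of the filter on the inputs
`x`: the loop of `IsCAFOutput` without its exit condition. -/
structure IsFilterRun (x : Fin n → E d) (c : ℕ → Fin n → ℝ) (v : ℕ → E d) : Prop where
  zero : ∀ i, c 0 i = 1
  isTopEigenvector : ∀ k, IsTopEigenvector (weightedCov (c k) x) (v k)
  succ : ∀ k, c (k + 1) = reweight (c k) x (v k)

/-- The invariant of the filter: if `S` consists of `n - f` of the `n` points, then the weights `c`,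
obtained from unit weights, have lost at most as much mass inside `S` as outside. -/
def IsBalanced (f : ℕ) (S : Finset (Fin n)) (c : Fin n → ℝ) : Prop :=
  (n : ℝ) - 2 * f + ∑ i ∈ Sᶜ, c i ≤ ∑ i ∈ S, c i

lemma isBalanced_one (hfn : f ≤ n) (hS : S.card = n - f) : IsBalanced f S fun _ => 1 := by
  have hSc : Sᶜ.card = f := by rw [Finset.card_compl, hS, Fintype.card_fin]; omega
  simp only [IsBalanced, Finset.sum_const, hSc, hS, nsmul_eq_mul, mul_one, Nat.cast_sub hfn]
  linarith

lemma IsBalanced.reweight {c : Fin n → ℝ} {v : E d} (h : IsBalanced f S c)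
    (hscore : ∑ i ∈ S, c i * score c x v i ≤ ∑ i ∈ Sᶜ, c i * score c x v i) :
    IsBalanced f S (reweight c x v) := by
  have hloss := div_le_div_of_nonneg_right hscore (maxScore_nonneg c x v)
  rw [IsBalanced] at h ⊢
  rw [sum_reweight, sum_reweight]
  linarith

namespace IsFilterRun

variable {c : ℕ → Fin n → ℝ} {v : ℕ → E d}

lemma nonneg (h : IsFilterRun x c v) (k : ℕ) (i : Fin n) : 0 ≤ c k i := by
  induction k with
  | zero => rw [h.zero]; exact zero_le_one
  | succ k ih => rw [h.succ]; exact reweight_nonneg ih x (v k)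

lemma antitone (h : IsFilterRun x c v) (i : Fin n) : Antitone fun k => c k i :=
  antitone_nat_of_succ_le fun k => by rw [h.succ]; exact reweight_le (h.nonneg k i) x (v k)

lemma le_one (h : IsFilterRun x c v) (k : ℕ) (i : Fin n) : c k i ≤ 1 :=
  h.zero i ▸ h.antitone i (Nat.zero_le k)

lemma isBalanced (h : IsFilterRun x c v) (hfn : f ≤ n) (hS : S.card = n - f) (k : ℕ)
    (hscore : ∀ j < k, ∑ i ∈ S, c j i * score (c j) x (v j) i ≤
      ∑ i ∈ Sᶜ, c j i * score (c j) x (v j) i) : IsBalanced f S (c k) := by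
  induction k with
  | zero => simpa only [← funext h.zero] using isBalanced_one hfn hS
  | succ k ih =>
    rw [h.succ]
    exact (ih fun j hj => hscore j (hj.trans k.lt_succ_self)).reweight (hscore k k.lt_succ_self)

lemma exists_sum_compl_le_sum (h : IsFilterRun x c v) (S : Finset (Fin n)) :
    ∃ k, ∑ i ∈ Sᶜ, c k i * score (c k) x (v k) i ≤ ∑ i ∈ S, c k i * score (c k) x (v k) i := by
  by_contra! hcon
  have hlt : ∀ k, #{j | 0 < c (k + 1) j} < #{j | 0 < c k j} := fun k => by
    have hpos : 0 < ∑ i ∈ Sᶜ, c k i * score (c k) x (v k) i :=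
      (Finset.sum_nonneg fun i _ => mul_nonneg (h.nonneg k i) (score_nonneg _ _ _ _)).trans_lt
        (hcon k)
    obtain ⟨i, -, hi⟩ := Finset.exists_lt_of_sum_lt (s := Sᶜ) (f := fun _ => (0 : ℝ))
      (by simpa using hpos)
    have hci : 0 < c k i := pos_of_mul_pos_left hi (score_nonneg _ _ _ _)
    rw [h.succ]
    exact card_pos_reweight_lt (h.nonneg k) hci (pos_of_mul_pos_right hi hci.le)
  exact not_strictAnti_of_wellFoundedLT (fun k => #{j | 0 < c k j}) (strictAnti_nat_of_succ_lt hlt)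

/-- `k` is the first iterate at which `S` carries half of the total score: every step before
removes at least as much mass outside `S` as inside. -/
lemma exists_isBalanced (h : IsFilterRun x c v) (hfn : f ≤ n) (hS : S.card = n - f) :
    ∃ k, (∀ j ≤ k, IsBalanced f S (c j)) ∧
      ∑ i ∈ Sᶜ, c k i * score (c k) x (v k) i ≤ ∑ i ∈ S, c k i * score (c k) x (v k) i := by
  classical
  refine ⟨Nat.find (h.exists_sum_compl_le_sum S), fun j hj => ?_,
    Nat.find_spec (h.exists_sum_compl_le_sum S)⟩
  exact h.isBalanced hfn hS j fun i hi =>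
    (not_le.1 (Nat.find_min (h.exists_sum_compl_le_sum S) (hi.trans_le hj))).le

end IsFilterRun

end Run

section Robustness

variable {d n f : ℕ} {S : Finset (Fin n)} {c c' : Fin n → ℝ} {x : Fin n → E d}

lemma sum_indicator_mul (S : Finset (Fin n)) (c y : Fin n → ℝ) :
    ∑ i, (S : Set (Fin n)).indicator c i * y i = ∑ i ∈ S, c i * y i := by
  simp only [← Set.indicator_mul_left, Finset.sum_indicator_subset _ S.subset_univ]

lemma sum_unitWeights (S : Finset (Fin n)) : ∑ i, unitWeights S i = S.card := by
  simp [unitWeights]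

lemma unitWeights_nonneg (S : Finset (Fin n)) (i : Fin n) : 0 ≤ unitWeights S i := by
  unfold unitWeights; positivity

lemma indicator_le_unitWeights (hc : ∀ i, c i ≤ 1) (i : Fin n) :
    (S : Set (Fin n)).indicator c i ≤ unitWeights S i := by
  by_cases hi : i ∈ S <;> simp [unitWeights, hi, hc i]

lemma sum_mul_sq_norm_weightedMean_indicator_sub_le (hc : ∀ i, 0 ≤ c i) (S : Finset (Fin n))
    (x : Fin n → E d) :
    (∑ i ∈ S, c i) *
        ‖weightedMean ((S : Set (Fin n)).indicator c) x - weightedMean c x‖ ^ 2 ≤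
      (∑ i ∈ Sᶜ, c i) * lambdaMax (weightedCov c x) := by
  have h := sum_mul_sq_norm_weightedMean_sub_le (c' := (S : Set (Fin n)).indicator c) (c := c)
    (Set.indicator_nonneg fun i _ => hc i) (Set.indicator_le_self' fun i _ => hc i) x
  rwa [Finset.sum_indicator_subset _ S.subset_univ, ← Finset.sum_add_sum_compl S c,
    add_sub_cancel_left] at h

lemma sum_mul_sq_norm_weightedMean_indicator_sub_unitWeights_le (hc : ∀ i, 0 ≤ c i)
    (hc1 : ∀ i, c i ≤ 1) (S : Finset (Fin n)) (x : Fin n → E d) :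
    (∑ i ∈ S, c i) *
        ‖weightedMean ((S : Set (Fin n)).indicator c) x - weightedMean (unitWeights S) x‖ ^ 2 ≤
      (S.card - ∑ i ∈ S, c i) * lambdaMax (weightedCov (unitWeights S) x) := by
  have h := sum_mul_sq_norm_weightedMean_sub_le (c' := (S : Set (Fin n)).indicator c)
    (c := unitWeights S) (Set.indicator_nonneg fun i _ => hc i) (indicator_le_unitWeights hc1) x
  rwa [Finset.sum_indicator_subset _ S.subset_univ, sum_unitWeights] at h

lemma sum_mul_score_le_of_norm_eq_one (hc : ∀ i, 0 ≤ c i) (hc1 : ∀ i, c i ≤ 1)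
    (hS : 0 < ∑ i ∈ S, c i) (x : Fin n → E d) {v : E d} (hv : ‖v‖ = 1) :
    ∑ i ∈ S, c i * score c x v i ≤
      S.card * lambdaMax (weightedCov (unitWeights S) x)
        + (∑ i ∈ Sᶜ, c i) * lambdaMax (weightedCov c x) := by
  set cS := (S : Set (Fin n)).indicator c with hcS
  have hsum : ∑ i, cS i = ∑ i ∈ S, c i := Finset.sum_indicator_subset _ S.subset_univ
  have hvar : (∑ i ∈ S, c i) * directionalVariance cS x v ≤
      S.card * lambdaMax (weightedCov (unitWeights S) x) := by
    have h := sum_mul_directionalVariance_mono (indicator_le_unitWeights hc1) (by rwa [hsum]) x v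
    rw [sum_unitWeights, hsum] at h
    have hle := directionalVariance_le_lambdaMax (unitWeights S) x v
    rw [hv, one_pow, mul_one] at hle
    exact h.trans (by gcongr)
  have hbias : (∑ i ∈ S, c i) * inner ℝ v (weightedMean cS x - weightedMean c x) ^ 2 ≤
      (∑ i ∈ Sᶜ, c i) * lambdaMax (weightedCov c x) := by
    refine le_trans ?_ (sum_mul_sq_norm_weightedMean_indicator_sub_le hc S x)
    refine mul_le_mul_of_nonneg_left ?_ hS.le
    simpa [hv, sq_abs] using pow_le_pow_left₀ (abs_nonneg _)
      (abs_real_inner_le_norm v (weightedMean cS x - weightedMean c x)) 2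
  calc ∑ i ∈ S, c i * score c x v i
      = ∑ i, cS i * inner ℝ v (x i - weightedMean c x) ^ 2 := (sum_indicator_mul S c _).symm
    _ = (∑ i ∈ S, c i) * directionalVariance cS x v
          + (∑ i ∈ S, c i) * inner ℝ v (weightedMean cS x - weightedMean c x) ^ 2 := by
        rw [sum_mul_inner_sub_sq (by rw [hsum]; exact hS.ne'), hsum, mul_add]
    _ ≤ _ := add_le_add hvar hbias

lemma IsTopEigenvector.sub_mul_lambdaMax_le {v : E d} (hv : IsTopEigenvector (weightedCov c x) v)
    (hc : ∀ i, 0 ≤ c i) (hc1 : ∀ i, c i ≤ 1) (hS : 0 < ∑ i ∈ S, c i)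
    (hhalf : ∑ i ∈ Sᶜ, c i * score c x v i ≤ ∑ i ∈ S, c i * score c x v i) :
    (∑ i ∈ S, c i - ∑ i ∈ Sᶜ, c i) * lambdaMax (weightedCov c x) ≤
      2 * S.card * lambdaMax (weightedCov (unitWeights S) x) := by
  have hSc : 0 ≤ ∑ i ∈ Sᶜ, c i := Finset.sum_nonneg fun i _ => hc i
  have hW := Finset.sum_add_sum_compl S c
  have hscore := sum_mul_score (by linarith : ∑ i, c i ≠ 0) x v
  rw [hv.directionalVariance_eq, ← hW, ← Finset.sum_add_sum_compl S] at hscore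
  linarith [sum_mul_score_le_of_norm_eq_one hc hc1 hS x hv.1]

lemma IsBalanced.sub_le_sum (h : IsBalanced f S c) (hc : ∀ i, 0 ≤ c i) :
    (n : ℝ) - 2 * f ≤ ∑ i ∈ S, c i :=
  (le_add_of_nonneg_right (Finset.sum_nonneg fun i _ => hc i)).trans h

lemma IsBalanced.lambdaMax_le {v : E d} (h : IsBalanced f S c) (hfn : 2 * f < n)
    (hS : S.card = n - f) (hv : IsTopEigenvector (weightedCov c x) v) (hc : ∀ i, 0 ≤ c i)
    (hc1 : ∀ i, c i ≤ 1)
    (hhalf : ∑ i ∈ Sᶜ, c i * score c x v i ≤ ∑ i ∈ S, c i * score c x v i) :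
    lambdaMax (weightedCov c x) ≤
      2 * ((n : ℝ) - f) / (n - 2 * f) * lambdaMax (weightedCov (unitWeights S) x) := by
  have hN : 0 < (n : ℝ) - 2 * f := sub_pos.2 (by exact_mod_cast hfn)
  have hcard : (S.card : ℝ) = n - f := by rw [hS, Nat.cast_sub (by omega)]
  have htop := hv.sub_mul_lambdaMax_le hc hc1 (hN.trans_le (h.sub_le_sum hc)) hhalf
  rw [hcard] at htop
  rw [div_mul_eq_mul_div, le_div_iff₀' hN]
  refine le_trans (mul_le_mul_of_nonneg_right ?_ (lambdaMax_weightedCov_nonneg hc x)) htop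
  exact le_sub_iff_add_le.2 h

/-- The squared distances between `y`, the mean with weights `c`, its restriction to `S`, and the
mean of `S` are controlled by masses that compete for the same budget `f`. -/
lemma IsBalanced.sq_norm_sub_weightedMean_unitWeights_le (h : IsBalanced f S c) (hfn : 2 * f < n)
    (hS : S.card = n - f) (hc : ∀ i, 0 ≤ c i) (hc1 : ∀ i, c i ≤ 1) {r : ℝ} (hr : 0 ≤ r)
    (hlam : lambdaMax (weightedCov c x) ≤ r * lambdaMax (weightedCov (unitWeights S) x)) {y : E d}
    (hy : (n - 2 * f) * ‖y - weightedMean c x‖ ^ 2 ≤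
      2 * (∑ i ∈ S, c i - (n - 2 * f)) * (r * lambdaMax (weightedCov (unitWeights S) x))) :
    ‖y - weightedMean (unitWeights S) x‖ ^ 2 ≤
      (6 * r + 1) * (f / (n - 2 * f)) * lambdaMax (weightedCov (unitWeights S) x) := by
  set N : ℝ := n - 2 * f
  set lamS := lambdaMax (weightedCov (unitWeights S) x)
  set a := ∑ i ∈ S, c i - N with ha
  set z := weightedMean ((S : Set (Fin n)).indicator c) x
  have hN : 0 < N := sub_pos.2 (by exact_mod_cast hfn)
  have hNS : N ≤ ∑ i ∈ S, c i := h.sub_le_sum hc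
  have ha0 : 0 ≤ a := sub_nonneg.2 hNS
  have hlamS : 0 ≤ lamS := lambdaMax_weightedCov_nonneg (unitWeights_nonneg S) x
  have hcard : (S.card : ℝ) = N + f := by rw [hS, Nat.cast_sub (by omega)]; ring
  have haf : a ≤ f := by
    have := Finset.sum_le_card_nsmul S c 1 fun i _ => hc1 i
    rw [nsmul_one, hcard] at this
    linarith
  have hy' : ‖y - weightedMean c x‖ ^ 2 ≤ 2 * (a * (r * lamS) / N) := by
    rw [← mul_div_assoc, le_div_iff₀' hN, ← mul_assoc]
    exact hy
  have hcz : ‖weightedMean c x - z‖ ^ 2 ≤ 1 * (a * (r * lamS) / N) := by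
    rw [one_mul, le_div_iff₀' hN, norm_sub_rev]
    calc N * ‖z - weightedMean c x‖ ^ 2 ≤ (∑ i ∈ S, c i) * ‖z - weightedMean c x‖ ^ 2 := by gcongr
      _ ≤ (∑ i ∈ Sᶜ, c i) * lambdaMax (weightedCov c x) :=
          sum_mul_sq_norm_weightedMean_indicator_sub_le hc S x
      _ ≤ a * (r * lamS) := mul_le_mul (le_sub_iff_add_le'.2 h) hlam
          (lambdaMax_weightedCov_nonneg hc x) ha0
  have hzS : ‖z - weightedMean (unitWeights S) x‖ ^ 2 ≤ 1 * ((f - a) * lamS / N) := by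
    rw [one_mul, le_div_iff₀' hN]
    calc _ ≤ (∑ i ∈ S, c i) * ‖z - weightedMean (unitWeights S) x‖ ^ 2 := by gcongr
      _ ≤ _ := sum_mul_sq_norm_weightedMean_indicator_sub_unitWeights_le hc hc1 S x
      _ = _ := by rw [hcard, ha]; ring
  have hyz : (‖y - weightedMean c x‖ + ‖weightedMean c x - z‖) ^ 2 ≤ 6 * r * (a * lamS / N) :=
    (add_sq_le_add_mul_add zero_le_two zero_le_one (by positivity) (by positivity) hy' hcz).trans_eq
      (by ring)
  calc ‖y - weightedMean (unitWeights S) x‖ ^ 2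
      ≤ ((‖y - weightedMean c x‖ + ‖weightedMean c x - z‖)
          + ‖z - weightedMean (unitWeights S) x‖) ^ 2 := by
        gcongr
        exact (norm_sub_le_norm_sub_add_norm_sub _ z _).trans
          (by gcongr; exact norm_sub_le_norm_sub_add_norm_sub _ _ _)
    _ ≤ (6 * r + 1) * (a * lamS / N + (f - a) * lamS / N) :=
        add_sq_le_add_mul_add (by positivity) zero_le_one (by positivity)
          (div_nonneg (mul_nonneg (sub_nonneg.2 haf) hlamS) hN.le) hyz hzS
    _ = _ := by ring

/-- Either the output precedes the first iterate at which `S` carries half of the score, and is then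
balanced itself, or it is obtained from that iterate by removing further weight. -/
lemma IsFilterRun.exists_isBalanced_near {c : ℕ → Fin n → ℝ} {v : ℕ → E d} {k₀ : ℕ}
    (h : IsFilterRun x c v) (hfn : 2 * f < n) (hS : S.card = n - f)
    (hk₀ : (n : ℝ) - 2 * f ≤ ∑ i, c k₀ i)
    (hmin : ∀ k, (n : ℝ) - 2 * f ≤ ∑ i, c k i →
      lambdaMax (weightedCov (c k₀) x) ≤ lambdaMax (weightedCov (c k) x)) :
    ∃ j, IsBalanced f S (c j) ∧ lambdaMax (weightedCov (c j) x) ≤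
        2 * ((n : ℝ) - f) / (n - 2 * f) * lambdaMax (weightedCov (unitWeights S) x) ∧
      (n - 2 * f) * ‖weightedMean (c k₀) x - weightedMean (c j) x‖ ^ 2 ≤
        2 * (∑ i ∈ S, c j i - (n - 2 * f)) * lambdaMax (weightedCov (c j) x) := by
  obtain ⟨k, hbal, hhalf⟩ := h.exists_isBalanced (by omega : f ≤ n) hS
  have hbalk := hbal k le_rfl
  have hlamk := hbalk.lambdaMax_le hfn hS (h.isTopEigenvector k) (h.nonneg k) (h.le_one k) hhalf
  have hcompl : 0 ≤ ∑ i ∈ Sᶜ, c k i := Finset.sum_nonneg fun i _ => h.nonneg k i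
  have hW : ∑ i, c k i = ∑ i ∈ S, c k i + ∑ i ∈ Sᶜ, c k i := (Finset.sum_add_sum_compl S _).symm
  rcases le_total k₀ k with hk | hk
  · refine ⟨k₀, hbal k₀ hk, (hmin k ?_).trans hlamk, ?_⟩
    · linarith [hbalk.sub_le_sum (h.nonneg k)]
    · rw [sub_self, norm_zero, zero_pow two_ne_zero, mul_zero]
      have := (hbal k₀ hk).sub_le_sum (h.nonneg k₀)
      exact mul_nonneg (by linarith) (lambdaMax_weightedCov_nonneg (h.nonneg k₀) x)
  · refine ⟨k, hbalk, hlamk, ?_⟩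
    have hlam := lambdaMax_weightedCov_nonneg (h.nonneg k) x
    calc _ ≤ (∑ i, c k₀ i) * ‖weightedMean (c k₀) x - weightedMean (c k) x‖ ^ 2 := by gcongr
      _ ≤ (∑ i, c k i - ∑ i, c k₀ i) * lambdaMax (weightedCov (c k) x) :=
          sum_mul_sq_norm_weightedMean_sub_le (h.nonneg k₀) (fun i => h.antitone i hk) x
      _ ≤ _ := by
          gcongr
          rw [IsBalanced] at hbalk
          linarith

theorem isRobustnessCoefficient_caf (d : ℕ) (hfn : 2 * f < n) :
    IsRobustnessCoefficient d n f
      (2 * f / ((n : ℝ) - 2 * f) * (1 + 6 * ((n : ℝ) - f) / ((n : ℝ) - 2 * f))) := by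
  have hN : 0 < (n : ℝ) - 2 * f := sub_pos.2 (by exact_mod_cast hfn)
  have hnf : 0 ≤ (n : ℝ) - f := by linarith [(Nat.cast_nonneg f : (0 : ℝ) ≤ f)]
  refine ⟨by positivity, ?_⟩
  rintro x y ⟨c, v, k₀, hzero, htop, hsucc, hk₀, hmin, rfl⟩ S hS
  have hrun : IsFilterRun x c v := ⟨hzero, htop, hsucc⟩
  obtain ⟨j, hbal, hlam, hdist⟩ := hrun.exists_isBalanced_near hfn hS hk₀ hmin
  have hmass : 0 ≤ 2 * (∑ i ∈ S, c j i - ((n : ℝ) - 2 * f)) :=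
    mul_nonneg zero_le_two (sub_nonneg.2 (hbal.sub_le_sum (hrun.nonneg j)))
  have hlamS := lambdaMax_weightedCov_nonneg (unitWeights_nonneg S) x
  refine (hbal.sq_norm_sub_weightedMean_unitWeights_le hfn hS (hrun.nonneg j) (hrun.le_one j)
    (by positivity) hlam (hdist.trans (mul_le_mul_of_nonneg_left hlam hmass))).trans ?_
  refine mul_le_mul_of_nonneg_right ?_ hlamS
  rw [← sub_nonneg]
  calc (0 : ℝ) ≤ f / (n - 2 * f) := by positivity
    _ = _ := by ring

end Robustness

/-! ### Sampling without replacement -/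

section Sampling

variable {ι V : Type*} [Fintype ι] {b : ℕ}

lemma card_filter_mem_powersetCard [DecidableEq ι] (hb : 1 ≤ b) (k : ι) :
    #{B ∈ powersetCard b (univ : Finset ι) | k ∈ B} =
      (Fintype.card ι - 1).choose (b - 1) := by
  simpa using card_filter_powersetCard_subset {k} univ b (by simp) (by simpa)

lemma card_filter_mem_mem_powersetCard [DecidableEq ι] (hb : 2 ≤ b) {k l : ι} (hkl : k ≠ l) :
    #{B ∈ powersetCard b (univ : Finset ι) | k ∈ B ∧ l ∈ B} =
      (Fintype.card ι - 2).choose (b - 2) := by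
  simpa [Finset.insert_subset_iff, Finset.card_pair hkl] using
    card_filter_powersetCard_subset {k, l} univ b (by simp) (Finset.card_le_two.trans hb)

lemma sum_powersetCard_sum [AddCommMonoid V] (hb : 1 ≤ b) (u : ι → V) :
    ∑ B ∈ powersetCard b (univ : Finset ι), ∑ k ∈ B, u k =
      (Fintype.card ι - 1).choose (b - 1) • ∑ k, u k := by
  classical
  rw [Finset.sum_comm' (t' := univ) (s' := fun k => {B ∈ powersetCard b univ | k ∈ B})
    (by simp), Finset.smul_sum]
  simp only [Finset.sum_const, card_filter_mem_powersetCard hb]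

variable [NormedAddCommGroup V] [InnerProductSpace ℝ V]

omit [Fintype ι] in
lemma sq_norm_sum_eq_sum_sum_inner (u : ι → V) (B : Finset ι) :
    ‖∑ k ∈ B, u k‖ ^ 2 = ∑ k ∈ B, ∑ l ∈ B, inner ℝ (u k) (u l) := by
  rw [← real_inner_self_eq_norm_sq, sum_inner]
  simp only [inner_sum]

lemma sum_powersetCard_sq_norm_sum (hb : 2 ≤ b) {u : ι → V} (hu : ∑ k, u k = 0) :
    ∑ B ∈ powersetCard b (univ : Finset ι), ‖∑ k ∈ B, u k‖ ^ 2 =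
      (((Fintype.card ι - 1).choose (b - 1) : ℝ) - (Fintype.card ι - 2).choose (b - 2)) *
        ∑ k, ‖u k‖ ^ 2 := by
  classical
  set p : ℝ := (((Fintype.card ι - 1).choose (b - 1) : ℕ) : ℝ)
  set q : ℝ := (((Fintype.card ι - 2).choose (b - 2) : ℕ) : ℝ)
  have hcount (k l : ι) :
      (#{B ∈ powersetCard b univ | k ∈ B ∧ l ∈ B} : ℝ) = (if k = l then p - q else 0) + q := by
    split_ifs with hkl
    · subst hkl
      simp only [and_self, card_filter_mem_powersetCard (by omega : 1 ≤ b), sub_add_cancel, p]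
    · rw [card_filter_mem_mem_powersetCard hb hkl, zero_add]
  calc ∑ B ∈ powersetCard b univ, ‖∑ k ∈ B, u k‖ ^ 2
      = ∑ B ∈ powersetCard b univ, ∑ k, ∑ l, if k ∈ B ∧ l ∈ B then inner ℝ (u k) (u l) else 0 := by
        simp only [sq_norm_sum_eq_sum_sum_inner, ite_and, Finset.sum_ite_mem, Finset.univ_inter,
          Finset.sum_ite_irrel, Finset.sum_const_zero]
    _ = ∑ k, ∑ l, #{B ∈ powersetCard b univ | k ∈ B ∧ l ∈ B} * inner ℝ (u k) (u l) := by
        rw [Finset.sum_comm]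
        refine Finset.sum_congr rfl fun k _ => ?_
        rw [Finset.sum_comm]
        simp only [← Finset.sum_filter, Finset.sum_const, nsmul_eq_mul]
    _ = (p - q) * ∑ k, ‖u k‖ ^ 2 := by
        simp only [hcount, add_mul, ite_mul, zero_mul, Finset.sum_add_distrib, Finset.sum_ite_eq,
          Finset.mem_univ, if_true, ← Finset.mul_sum, ← inner_sum, hu, inner_zero_right, mul_zero,
          add_zero, real_inner_self_eq_norm_sq]

lemma mul_sum_powersetCard_sq_norm_sum (hb : 1 ≤ b) (hbm : b ≤ Fintype.card ι) {u : ι → V}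
    (hu : ∑ k, u k = 0) :
    Fintype.card ι * (Fintype.card ι - 1) *
        ∑ B ∈ powersetCard b (univ : Finset ι), ‖∑ k ∈ B, u k‖ ^ 2 =
      (Fintype.card ι).choose b * (b * (Fintype.card ι - b)) * ∑ k, ‖u k‖ ^ 2 := by
  rcases hb.eq_or_lt with rfl | hb2
  · simp only [Finset.powersetCard_one, Finset.sum_map, Function.Embedding.coeFn_mk,
      Finset.sum_singleton, Nat.choose_one_right, Nat.cast_one, one_mul]
  · rw [sum_powersetCard_sq_norm_sum hb2 hu]
    obtain ⟨b', rfl⟩ := Nat.exists_eq_add_of_le' hb2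
    obtain ⟨m', hm'⟩ := Nat.exists_eq_add_of_le' (le_trans hb2 hbm)
    simp only [hm']
    have hchoose : ((m' + 2 : ℕ) : ℝ) * (m' + 1).choose (b' + 1)
        = (m' + 2).choose (b' + 2) * (b' + 2 : ℕ) := by
      exact_mod_cast Nat.add_one_mul_choose_eq (m' + 1) (b' + 1)
    have hchoose' : ((m' + 1 : ℕ) : ℝ) * m'.choose b'
        = (m' + 1).choose (b' + 1) * (b' + 1 : ℕ) := by
      exact_mod_cast Nat.add_one_mul_choose_eq m' b'
    simp only [show m' + 2 - 1 = m' + 1 by omega, show b' + 2 - 1 = b' + 1 by omega,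
      show m' + 2 - 2 = m' by omega, show b' + 2 - 2 = b' by omega]
    push_cast at hchoose hchoose' ⊢
    linear_combination (∑ k, ‖u k‖ ^ 2) * ((m' - b' : ℝ) * hchoose - (m' + 2 : ℝ) * hchoose')

lemma batchVariance_nonneg {m : ℕ} (hbm : b ≤ m) (s : ℝ) : 0 ≤ batchVariance m b s := by
  have : (b : ℝ) / m ≤ 1 := div_le_one_of_le₀ (by exact_mod_cast hbm) m.cast_nonneg
  have : 0 ≤ 1 - (b : ℝ) / m := sub_nonneg.2 this
  unfold batchVariance
  positivity

lemma sum_powersetCard_sq_norm_mean_le {m : ℕ} (hb : 1 ≤ b) (hbm : b ≤ m) {u : Fin m → V}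
    (hu : ∑ k, u k = 0) {s : ℝ} (hs : (m : ℝ)⁻¹ * ∑ k, ‖u k‖ ^ 2 ≤ s ^ 2) :
    (m.choose b : ℝ)⁻¹ * ∑ B ∈ powersetCard b (univ : Finset (Fin m)),
      ‖(b : ℝ)⁻¹ • ∑ k ∈ B, u k‖ ^ 2 ≤ batchVariance m b s := by
  rcases (hb.trans hbm).eq_or_lt with rfl | hm2
  · obtain rfl : b = 1 := le_antisymm hbm hb
    rw [Fin.sum_univ_one] at hu
    simp only [Finset.powersetCard_one, Finset.sum_map, Function.Embedding.coeFn_mk,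
      Finset.sum_singleton, Fin.sum_univ_one, hu, smul_zero, norm_zero, zero_pow two_ne_zero,
      mul_zero, batchVariance_nonneg le_rfl s]
  have : (0 : ℝ) < b := by exact_mod_cast hb
  have hbm0 : (0 : ℝ) ≤ m - b := sub_nonneg.2 (by exact_mod_cast hbm)
  have hm0 : (2 : ℝ) ≤ m := by exact_mod_cast hm2
  have hchoose : (0 : ℝ) < m.choose b := by exact_mod_cast Nat.choose_pos hbm
  simp only [norm_smul, mul_pow, ← Finset.mul_sum, norm_inv, Real.norm_natCast]
  have hmoment := mul_sum_powersetCard_sq_norm_sum hb (by simpa) hu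
  rw [Fintype.card_fin] at hmoment
  set Q := ∑ B ∈ powersetCard b (univ : Finset (Fin m)), ‖∑ k ∈ B, u k‖ ^ 2
  have hm1 : (m : ℝ) - 1 ≠ 0 := by linarith
  calc (m.choose b : ℝ)⁻¹ * ((b : ℝ)⁻¹ ^ 2 * Q)
      = (m - b) / (b * (m - 1)) * ((m : ℝ)⁻¹ * ∑ k, ‖u k‖ ^ 2) := by
        field_simp
        linear_combination hmoment
    _ ≤ (m - b) / (b * (m / 2)) * s ^ 2 := by
        gcongr
        linarith
    _ = batchVariance m b s := by
        rw [batchVariance]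
        field_simp

end Sampling

/-! ### Smooth functions -/

section Smooth

variable {d : ℕ} {F : E d → ℝ} {L μ : ℝ}

lemma hasDerivAt_along_line (hF : Differentiable ℝ F) (θ w : E d) (s : ℝ) :
    HasDerivAt (fun s : ℝ => F (θ + s • w)) (inner ℝ (∇ F (θ + s • w)) w) s := by
  have hline : HasDerivAt (fun s : ℝ => θ + s • w) w s := by
    simpa using ((hasDerivAt_id s).smul_const w).const_add θ
  have := ((hF (θ + s • w)).hasFDerivAt).comp_hasDerivAt s hline
  rwa [← inner_gradient_left] at this

lemma IsSmooth.inner_gradient_sub_le (h : IsSmooth L F) (θ w : E d) {s : ℝ} (hs : 0 ≤ s) :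
    inner ℝ (∇ F (θ + s • w) - ∇ F θ) w ≤ L * s * ‖w‖ ^ 2 := by
  have hlip := h θ (θ + s • w)
  rw [add_sub_cancel_left, norm_smul, Real.norm_of_nonneg hs] at hlip
  calc inner ℝ (∇ F (θ + s • w) - ∇ F θ) w ≤ ‖∇ F (θ + s • w) - ∇ F θ‖ * ‖w‖ :=
        real_inner_le_norm _ _
    _ ≤ L * (s * ‖w‖) * ‖w‖ := mul_le_mul_of_nonneg_right hlip (norm_nonneg _)
    _ = L * s * ‖w‖ ^ 2 := by ring

lemma IsSmooth.descent (hF : Differentiable ℝ F) (h : IsSmooth L F) (θ η : E d) :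
    F η ≤ F θ + inner ℝ (∇ F θ) (η - θ) + L / 2 * ‖η - θ‖ ^ 2 := by
  obtain ⟨w, rfl⟩ : ∃ w, η = θ + w := ⟨η - θ, (add_sub_cancel θ η).symm⟩
  let φ : ℝ → ℝ := fun s => F (θ + s • w) - (s * inner ℝ (∇ F θ) w + L / 2 * s ^ 2 * ‖w‖ ^ 2)
  have hφ (s : ℝ) : HasDerivAt φ
      (inner ℝ (∇ F (θ + s • w) - ∇ F θ) w - L * s * ‖w‖ ^ 2) s := by
    have hquad := ((hasDerivAt_id s).mul_const (inner ℝ (∇ F θ) w)).add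
      ((((hasDerivAt_id s).pow 2).const_mul (L / 2)).mul_const (‖w‖ ^ 2))
    convert! (hasDerivAt_along_line hF θ w s).sub hquad using 1
    rw [inner_sub_left]
    simp only [id_eq, Nat.reduceSub, pow_one, Nat.cast_ofNat]
    ring
  have hanti : AntitoneOn φ (Set.Icc 0 1) := by
    refine antitoneOn_of_deriv_nonpos (convex_Icc 0 1)
      (fun s _ => (hφ s).continuousAt.continuousWithinAt)
      (fun s _ => (hφ s).differentiableAt.differentiableWithinAt) fun s hs => ?_
    rw [interior_Icc] at hs
    rw [(hφ s).deriv, sub_nonpos]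
    exact h.inner_gradient_sub_le θ w hs.1.le
  have hle := hanti (by simp) (by simp) zero_le_one
  simp only [φ, zero_smul, add_zero, one_smul] at hle
  rw [add_sub_cancel_left]
  linarith

lemma IsSmooth.sq_norm_gradient_le (hL : 0 < L) (hF : Differentiable ℝ F) (h : IsSmooth L F)
    (hbdd : BddBelow (Set.range F)) (θ : E d) : ‖∇ F θ‖ ^ 2 ≤ 2 * L * (F θ - ⨅ η, F η) := by
  have hstep := h.descent hF θ (θ - L⁻¹ • ∇ F θ)
  rw [sub_sub_cancel_left, inner_neg_right, real_inner_smul_right, real_inner_self_eq_norm_sq,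
    norm_neg, norm_smul, norm_inv, Real.norm_of_nonneg hL.le,
    show L / 2 * (L⁻¹ * ‖∇ F θ‖) ^ 2 = L⁻¹ * ‖∇ F θ‖ ^ 2 / 2 by field_simp] at hstep
  have hdecrease : L⁻¹ * ‖∇ F θ‖ ^ 2 ≤ 2 * (F θ - ⨅ η, F η) := by
    linarith [ciInf_le hbdd (θ - L⁻¹ • ∇ F θ)]
  rw [inv_mul_le_iff₀ hL] at hdecrease
  linarith

lemma IsStronglyConvex.sub_le (hμ : 0 < μ) (h : IsStronglyConvex μ F) (θ η : E d) :
    F θ - ‖∇ F θ‖ ^ 2 / (2 * μ) ≤ F η := by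
  have hinner : -(‖∇ F θ‖ * ‖η - θ‖) ≤ inner ℝ (∇ F θ) (η - θ) :=
    (abs_le.1 (abs_real_inner_le_norm _ _)).1
  have hgap : F θ - F η ≤ ‖∇ F θ‖ ^ 2 / (2 * μ) := by
    rw [le_div_iff₀ (by positivity)]
    nlinarith [h θ η, sq_nonneg (μ * ‖η - θ‖ - ‖∇ F θ‖)]
  linarith

lemma IsStronglyConvex.bddBelow (hμ : 0 < μ) (h : IsStronglyConvex μ F) :
    BddBelow (Set.range F) :=
  ⟨F 0 - ‖∇ F 0‖ ^ 2 / (2 * μ), by rintro _ ⟨η, rfl⟩; exact h.sub_le hμ 0 η⟩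

lemma IsStronglyConvex.le_sq_norm_gradient (hμ : 0 < μ) (h : IsStronglyConvex μ F) (θ : E d) :
    2 * μ * (F θ - ⨅ η, F η) ≤ ‖∇ F θ‖ ^ 2 := by
  have hgap : F θ - (⨅ η, F η) ≤ ‖∇ F θ‖ ^ 2 / (2 * μ) := by
    linarith [le_ciInf fun η => h.sub_le hμ θ η]
  rwa [le_div_iff₀ (by positivity), mul_comm] at hgap

lemma IsStronglyConvex.le_of_isSmooth [Nontrivial (E d)] (hF : Differentiable ℝ F)
    (h : IsStronglyConvex μ F) (hs : IsSmooth L F) : μ ≤ L := by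
  obtain ⟨w, hw⟩ := exists_ne (0 : E d)
  have hlower := h 0 w
  have hupper := hs.descent hF 0 w
  rw [sub_zero] at hlower hupper
  exact le_of_mul_le_mul_right (by linarith : μ * ‖w‖ ^ 2 ≤ L * ‖w‖ ^ 2) (by positivity)

end Smooth

/-! ### Gradients of the losses -/

section Losses

variable {X : Type*} {d n m : ℕ} {ℓ : E d → X → ℝ} {D : Fin n → Fin m → X} {H : Finset (Fin n)}

lemma hasGradientAt_const_mul_sum {ι : Type*} {s : Finset ι} {F : ι → E d → ℝ} {g : ι → E d}
    {θ : E d} (a : ℝ) (h : ∀ i ∈ s, HasGradientAt (F i) (g i) θ) :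
    HasGradientAt (fun η => a * ∑ i ∈ s, F i η) (a • ∑ i ∈ s, g i) θ := by
  rw [hasGradientAt_iff_hasFDerivAt, map_smul, map_sum]
  exact (HasFDerivAt.fun_sum fun i hi => (h i hi).hasFDerivAt).const_mul a

lemma hasGradientAt_localLoss (hℓ : ∀ x, Differentiable ℝ fun θ => ℓ θ x) (i : Fin n) (θ : E d) :
    HasGradientAt (localLoss ℓ D i) ((m : ℝ)⁻¹ • ∑ k, gradAt ℓ θ (D i k)) θ :=
  hasGradientAt_const_mul_sum _ fun k _ => (hℓ (D i k) θ).hasGradientAt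

lemma hasGradientAt_honestLoss (hℓ : ∀ x, Differentiable ℝ fun θ => ℓ θ x) (θ : E d) :
    HasGradientAt (honestLoss ℓ D H) ((H.card : ℝ)⁻¹ • ∑ i ∈ H, ∇ (localLoss ℓ D i) θ) θ :=
  hasGradientAt_const_mul_sum _ fun i _ =>
    (hasGradientAt_localLoss hℓ i θ).differentiableAt.hasGradientAt

lemma differentiable_honestLoss (hℓ : ∀ x, Differentiable ℝ fun θ => ℓ θ x) :
    Differentiable ℝ (honestLoss ℓ D H) := fun θ =>
  (hasGradientAt_honestLoss hℓ θ).differentiableAt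

lemma measurable_gradient (F : E d → ℝ) : Measurable (∇ F) :=
  ((InnerProductSpace.toDual ℝ (E d)).symm.continuous.measurable).comp (measurable_fderiv ℝ F)

lemma sum_sub_inv_card_smul_sum {ι V : Type*} [AddCommGroup V] [Module ℝ V] {s : Finset ι}
    (hs : s.card ≠ 0) (u : ι → V) : ∑ i ∈ s, (u i - (s.card : ℝ)⁻¹ • ∑ j ∈ s, u j) = 0 := by
  rw [Finset.sum_sub_distrib, Finset.sum_const, ← Nat.cast_smul_eq_nsmul ℝ, smul_smul,
    mul_inv_cancel₀ (by exact_mod_cast hs), one_smul, sub_self]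

lemma sum_gradAt_sub (hm : m ≠ 0) (hℓ : ∀ x, Differentiable ℝ fun θ => ℓ θ x) (i : Fin n)
    (θ : E d) : ∑ k, (gradAt ℓ θ (D i k) - ∇ (localLoss ℓ D i) θ) = 0 := by
  simpa [(hasGradientAt_localLoss hℓ i θ).gradient] using
    sum_sub_inv_card_smul_sum (s := univ) (by simpa) fun k => gradAt ℓ θ (D i k)

lemma sum_gradient_sub (hH : H.card ≠ 0) (hℓ : ∀ x, Differentiable ℝ fun θ => ℓ θ x) (θ : E d) :
    ∑ i ∈ H, (∇ (localLoss ℓ D i) θ - ∇ (honestLoss ℓ D H) θ) = 0 := by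
  rw [(hasGradientAt_honestLoss hℓ θ).gradient]
  exact sum_sub_inv_card_smul_sum hH _

/-- Deviation of the mini-batch gradient from the local gradient. -/
noncomputable def batchError (ℓ : E d → X → ℝ) (D : Fin n → Fin m → X) (C : ℝ≥0∞) (i : Fin n)
    (θ : E d) (B : Finset (Fin m)) : E d :=
  batchGrad ℓ D C i θ B - ∇ (localLoss ℓ D i) θ

variable {C : ℝ≥0∞} {i : Fin n} {b : ℕ} {σ : ℝ}

lemma batchGrad_eq (hC : BoundedGradients ℓ D H C) (hi : i ∈ H) (θ : E d) (B : Finset (Fin m)) :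
    batchGrad ℓ D C i θ B = (B.card : ℝ)⁻¹ • ∑ k ∈ B, gradAt ℓ θ (D i k) := by
  simp only [batchGrad, clip, hC θ i hi, if_true]

lemma batchError_eq (hC : BoundedGradients ℓ D H C) (hi : i ∈ H) (θ : E d)
    {B : Finset (Fin m)} (hB : B.card ≠ 0) :
    batchError ℓ D C i θ B =
      (B.card : ℝ)⁻¹ • ∑ k ∈ B, (gradAt ℓ θ (D i k) - ∇ (localLoss ℓ D i) θ) := by
  rw [Finset.sum_sub_distrib, Finset.sum_const, ← Nat.cast_smul_eq_nsmul ℝ, smul_sub, smul_smul,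
    inv_mul_cancel₀ (by exact_mod_cast hB), one_smul, batchError, batchGrad_eq hC hi]

lemma batchError_eq_of_mem_powersetCard (hC : BoundedGradients ℓ D H C) (hi : i ∈ H) (hb : 1 ≤ b)
    (θ : E d) {B : Finset (Fin m)} (hB : B ∈ powersetCard b univ) :
    batchError ℓ D C i θ B =
      (b : ℝ)⁻¹ • ∑ k ∈ B, (gradAt ℓ θ (D i k) - ∇ (localLoss ℓ D i) θ) := by
  have hcard := (Finset.mem_powersetCard.1 hB).2
  rw [batchError_eq hC hi θ (by omega), hcard]

lemma measurable_batchError (hC : BoundedGradients ℓ D H C) (hi : i ∈ H)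
    (B : Finset (Fin m)) : Measurable fun θ => batchError ℓ D C i θ B := by
  simp only [batchError, batchGrad_eq hC hi]
  have hsum : Measurable fun θ => ∑ k ∈ B, gradAt ℓ θ (D i k) :=
    Finset.measurable_fun_sum _ fun k _ => measurable_gradient fun η => ℓ η (D i k)
  exact (hsum.const_smul (B.card : ℝ)⁻¹).sub (measurable_gradient _)

lemma sum_batchError_eq_zero (hC : BoundedGradients ℓ D H C) (hi : i ∈ H)
    (hℓ : ∀ x, Differentiable ℝ fun θ => ℓ θ x) (hb : 1 ≤ b) (hbm : b ≤ m) (θ : E d) :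
    ∑ B ∈ powersetCard b (univ : Finset (Fin m)), batchError ℓ D C i θ B = 0 := by
  rw [Finset.sum_congr rfl fun B hB => batchError_eq_of_mem_powersetCard hC hi hb θ hB,
    ← Finset.smul_sum, sum_powersetCard_sum hb, sum_gradAt_sub (by omega) hℓ i θ, smul_zero,
    smul_zero]

lemma sum_sq_norm_batchError_le (hC : BoundedGradients ℓ D H C) (hσ : BoundedVariance ℓ D H σ)
    (hi : i ∈ H) (hℓ : ∀ x, Differentiable ℝ fun θ => ℓ θ x) (hb : 1 ≤ b) (hbm : b ≤ m)
    (θ : E d) :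
    (m.choose b : ℝ)⁻¹ * ∑ B ∈ powersetCard b (univ : Finset (Fin m)),
      ‖batchError ℓ D C i θ B‖ ^ 2 ≤ batchVariance m b σ := by
  rw [Finset.sum_congr rfl fun B hB => by rw [batchError_eq_of_mem_powersetCard hC hi hb θ hB]]
  exact sum_powersetCard_sq_norm_mean_le hb hbm (sum_gradAt_sub (by omega) hℓ i θ) (hσ i hi θ)

lemma sq_norm_batchError_le (hC : BoundedGradients ℓ D H C) (hσ : BoundedVariance ℓ D H σ)
    (hi : i ∈ H) (hℓ : ∀ x, Differentiable ℝ fun θ => ℓ θ x) (hb : 1 ≤ b) (hbm : b ≤ m)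
    (θ : E d) {B : Finset (Fin m)} (hB : B.card = b) :
    ‖batchError ℓ D C i θ B‖ ^ 2 ≤ m.choose b * batchVariance m b σ := by
  have hmean := sum_sq_norm_batchError_le hC hσ hi hℓ hb hbm θ
  rw [inv_mul_le_iff₀ (by exact_mod_cast Nat.choose_pos hbm)] at hmean
  exact (Finset.single_le_sum (f := fun B => ‖batchError ℓ D C i θ B‖ ^ 2)
    (fun _ _ => sq_nonneg _) (Finset.mem_powersetCard.2 ⟨B.subset_univ, hB⟩)).trans hmean

end Losses

/-! ### Quadratic forms in jointly sub-Gaussian vectors -/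

section OperatorNorm

lemma two_mul_exp_half_add_le (a b : ℝ) :
    2 * Real.exp ((a + b) / 2) ≤ Real.exp a + Real.exp b := by
  have hsq (x : ℝ) : Real.exp x = Real.exp (x / 2) ^ 2 := by
    rw [← Real.exp_nat_mul, Nat.cast_ofNat, mul_div_cancel₀ _ two_ne_zero]
  rw [hsq a, hsq b, add_div, Real.exp_add, ← mul_assoc]
  exact two_mul_le_add_sq _ _

lemma le_log_sub_one_add_div {a x q : ℝ} (hq : 0 < q) (h : Real.exp a ≤ x) :
    a ≤ Real.log q - 1 + x / q := by
  have hlin := Real.add_one_le_exp (a - Real.log q)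
  rw [Real.exp_sub, Real.exp_log hq] at hlin
  linarith [div_le_div_of_nonneg_right h hq.le]

lemma integral_exp_sq_gaussianReal :
    ∫ x, Real.exp (x ^ 2 / 4) ∂(gaussianReal 0 1) = √2 := by
  have hdensity (x : ℝ) : gaussianPDFReal 0 1 x • Real.exp (x ^ 2 / 4) =
      (√(2 * Real.pi))⁻¹ * Real.exp (-(1 / 4) * x ^ 2) := by
    rw [gaussianPDFReal, smul_eq_mul, mul_assoc, ← Real.exp_add]
    simp only [NNReal.coe_one, mul_one, sub_zero]
    ring_nf
  simp only [integral_gaussianReal_eq_integral_smul one_ne_zero, hdensity]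
  rw [integral_const_mul, integral_gaussian, ← Real.sqrt_inv, ← Real.sqrt_mul (by positivity)]
  congr 1
  field_simp
  norm_num

section Gaussian

variable {ι : Type*} [Fintype ι]

lemma lintegral_pi_prod_ofReal {μ : Measure ℝ} [IsProbabilityMeasure μ]
    {f : ι → ℝ → ℝ} (hf : ∀ i, Integrable (f i) μ) (hf0 : ∀ i x, 0 ≤ f i x) :
    ∫⁻ g, ENNReal.ofReal (∏ i, f i (g i)) ∂(Measure.pi fun _ : ι => μ) =
      ENNReal.ofReal (∏ i, ∫ x, f i x ∂μ) := by
  rw [← integral_fintype_prod_eq_prod (μ := fun _ => μ), ofReal_integral_eq_lintegral_ofReal]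
  · exact Integrable.fintype_prod hf
  · exact Filter.Eventually.of_forall fun g => Finset.prod_nonneg fun i _ => hf0 i _

lemma lintegral_pi_gaussianReal_exp_sum_mul (a : ι → ℝ) :
    ∫⁻ g, ENNReal.ofReal (Real.exp (∑ i, a i * g i)) ∂(Measure.pi fun _ : ι => gaussianReal 0 1) =
      ENNReal.ofReal (Real.exp (∑ i, a i ^ 2 / 2)) := by
  have hmgf (i : ι) : ∫ x, Real.exp (a i * x) ∂(gaussianReal 0 1) = Real.exp (a i ^ 2 / 2) := by
    simpa [mgf] using congrFun (mgf_fun_id_gaussianReal (μ := 0) (v := 1)) (a i)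
  simp only [Real.exp_sum]
  rw [lintegral_pi_prod_ofReal (f := fun i x => Real.exp (a i * x))
    (fun i => integrable_exp_mul_gaussianReal _) (fun i x => (Real.exp_pos _).le)]
  simp only [hmgf]

lemma lintegral_pi_gaussianReal_exp_sum_sq :
    ∫⁻ g, ENNReal.ofReal (Real.exp (∑ i, g i ^ 2 / 4))
      ∂(Measure.pi fun _ : ι => gaussianReal 0 1) = ENNReal.ofReal (√2 ^ Fintype.card ι) := by
  simp only [Real.exp_sum]
  rw [lintegral_pi_prod_ofReal (f := fun _ x => Real.exp (x ^ 2 / 4))]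
  · simp [integral_exp_sq_gaussianReal]
  · refine fun _ => Integrable.of_integral_ne_zero ?_
    rw [integral_exp_sq_gaussianReal]
    positivity
  · exact fun _ _ => (Real.exp_pos _).le

end Gaussian

section Ball

variable {V : Type*} [NormedAddCommGroup V] [MeasurableSpace V] [BorelSpace V]

lemma setLIntegral_ball_zero_add_left (μ : Measure V) [μ.IsAddLeftInvariant] (c : V) (r : ℝ)
    {e : V → ℝ≥0∞} (he : Measurable e) :
    ∫⁻ w in Metric.ball 0 r, e (c + w) ∂μ = ∫⁻ v in Metric.ball c r, e v ∂μ := by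
  have hpre : (c + ·) ⁻¹' Metric.ball c r = Metric.ball 0 r := by
    ext w
    simp
  rw [← hpre]
  exact (measurePreserving_add_left μ c).setLIntegral_comp_preimage measurableSet_ball he

lemma setLIntegral_ball_zero_sub_left (μ : Measure V) [μ.IsAddLeftInvariant] [μ.IsNegInvariant]
    (c : V) (r : ℝ) {e : V → ℝ≥0∞} (he : Measurable e) :
    ∫⁻ w in Metric.ball 0 r, e (c - w) ∂μ = ∫⁻ v in Metric.ball c r, e v ∂μ := by
  have hpre : Neg.neg ⁻¹' Metric.ball (0 : V) r = Metric.ball 0 r := by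
    ext w
    simp
  have hneg := (Measure.measurePreserving_neg μ).setLIntegral_comp_preimage
    (measurableSet_ball (x := 0) (ε := r)) (he.comp (measurable_const_add c))
  rw [hpre] at hneg
  simpa only [setLIntegral_ball_zero_add_left μ c r he, Function.comp_apply, sub_eq_add_neg]
    using hneg

lemma mul_measure_ball_zero_le_setLIntegral (μ : Measure V) [μ.IsAddLeftInvariant]
    [μ.IsNegInvariant] {c : V} (r : ℝ) {e : V → ℝ≥0∞} (he : Measurable e) {M : ℝ≥0∞}
    (hM : ∀ w, 2 * M ≤ e (c + w) + e (c - w)) :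
    M * μ (Metric.ball 0 r) ≤ ∫⁻ v in Metric.ball c r, e v ∂μ := by
  refine (ENNReal.mul_le_mul_iff_right two_ne_zero ENNReal.ofNat_ne_top).1 ?_
  calc 2 * (M * μ (Metric.ball 0 r)) = ∫⁻ _ in Metric.ball (0 : V) r, 2 * M ∂μ := by
        rw [setLIntegral_const, mul_assoc]
    _ ≤ ∫⁻ w in Metric.ball 0 r, (e (c + w) + e (c - w)) ∂μ := lintegral_mono hM
    _ = 2 * ∫⁻ v in Metric.ball c r, e v ∂μ := by
        have hadd : Measurable fun w => e (c + w) := he.comp (measurable_const_add c)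
        rw [lintegral_add_left hadd, setLIntegral_ball_zero_add_left μ c r he,
          setLIntegral_ball_zero_sub_left μ c r he, two_mul]

end Ball

variable {ι V : Type*} [Fintype ι] [NormedAddCommGroup V] [InnerProductSpace ℝ V]

lemma ofReal_exp_sum_sq_inner_midpoint_le {t : ℝ} (ht : 0 ≤ t) (y : ι → V) (u w : V) :
    2 * ENNReal.ofReal (Real.exp (t / 4 * ∑ i, inner ℝ u (y i) ^ 2)) ≤
      ENNReal.ofReal (Real.exp (t * ∑ i, inner ℝ ((1 / 2 : ℝ) • u + w) (y i) ^ 2)) +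
        ENNReal.ofReal (Real.exp (t * ∑ i, inner ℝ ((1 / 2 : ℝ) • u - w) (y i) ^ 2)) := by
  rw [← ENNReal.ofReal_add (Real.exp_pos _).le (Real.exp_pos _).le,
    ← ENNReal.ofReal_ofNat, ← ENNReal.ofReal_mul zero_le_two]
  refine ENNReal.ofReal_le_ofReal (le_trans ?_ (two_mul_exp_half_add_le _ _))
  refine mul_le_mul_of_nonneg_left (Real.exp_le_exp.2 ?_) zero_le_two
  rw [← mul_add, ← Finset.sum_add_distrib, Finset.mul_sum, Finset.mul_sum, Finset.sum_div]
  refine Finset.sum_le_sum fun i _ => ?_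
  rw [inner_add_left, inner_sub_left, real_inner_smul_left]
  nlinarith [mul_nonneg ht (sq_nonneg (inner ℝ w (y i)))]

variable [FiniteDimensional ℝ V] [MeasurableSpace V] [BorelSpace V]

/-- The mean of `v ↦ exp (t ∑ᵢ ⟨v, yᵢ⟩²)` over the unit ball. Up to a factor exponential in the
dimension, it dominates the exponential of a quarter of the quadratic form on the unit ball. -/
noncomputable def expQuadMean (t : ℝ) (y : ι → V) : ℝ≥0∞ :=
  ⨍⁻ v in Metric.ball (0 : V) 1, ENNReal.ofReal (Real.exp (t * ∑ i, inner ℝ v (y i) ^ 2)) ∂volume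

lemma ofReal_exp_le_expQuadMean {t : ℝ} (ht : 0 ≤ t) (y : ι → V) {u : V} (hu : ‖u‖ ≤ 1) :
    ENNReal.ofReal (Real.exp (t / 4 * ∑ i, inner ℝ u (y i) ^ 2)) ≤
      2 ^ Module.finrank ℝ V * expQuadMean t y := by
  set e : V → ℝ≥0∞ := fun v => ENNReal.ofReal (Real.exp (t * ∑ i, inner ℝ v (y i) ^ 2))
  have he : Measurable e := by fun_prop
  have hball : Metric.ball ((1 / 2 : ℝ) • u) (1 / 2) ⊆ Metric.ball 0 1 := by
    refine Metric.ball_subset_ball' ?_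
    rw [dist_zero_right, norm_smul, Real.norm_of_nonneg (by norm_num)]
    linarith
  have hle := (mul_measure_ball_zero_le_setLIntegral volume (1 / 2) he
    (ofReal_exp_sum_sq_inner_midpoint_le ht y u)).trans (lintegral_mono_set hball)
  have hhalf : volume (Metric.ball (0 : V) (1 / 2)) =
      (2 ^ Module.finrank ℝ V)⁻¹ * volume (Metric.ball (0 : V) 1) := by
    rw [Measure.addHaar_ball_of_pos _ _ (by norm_num), one_div, inv_pow,
      ENNReal.ofReal_inv_of_pos (by positivity), ENNReal.ofReal_pow zero_le_two,
      ENNReal.ofReal_ofNat]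
  rw [hhalf, ← mul_assoc, ← ENNReal.le_div_iff_mul_le
    (Or.inl (Metric.measure_ball_pos _ _ one_pos).ne') (Or.inl measure_ball_lt_top.ne),
    ← setLAverage_eq, ← div_eq_mul_inv] at hle
  rwa [ENNReal.div_le_iff' (by positivity) (by finiteness)] at hle

lemma expQuadMean_lt_top {t : ℝ} (ht : 0 ≤ t) (y : ι → V) : expQuadMean t y < ∞ := by
  refine lt_of_le_of_lt (b := ENNReal.ofReal (Real.exp (t * ∑ i, ‖y i‖ ^ 2))) ?_
    ENNReal.ofReal_lt_top
  rw [expQuadMean, setLAverage_eq]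
  refine ENNReal.div_le_of_le_mul ((setLIntegral_mono' measurableSet_ball fun v hv => ?_).trans_eq
    (setLIntegral_const _ _))
  refine ENNReal.ofReal_le_ofReal (Real.exp_le_exp.2
    (mul_le_mul_of_nonneg_left (Finset.sum_le_sum fun i _ => ?_) ht))
  rw [sq_le_sq, abs_norm]
  exact (abs_real_inner_le_norm _ _).trans
    (mul_le_of_le_one_left (norm_nonneg _) (mem_ball_zero_iff.1 hv).le)

variable {Ω : Type*} [MeasurableSpace Ω] {P : Measure Ω} {N : ι → Ω → V} {s : ℝ}

/-- Joint sub-Gaussianity of the vectors `N i` with variance proxy `s`, in terms of the moment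
generating function. -/
def JointlySubGaussian (N : ι → Ω → V) (s : ℝ) (P : Measure Ω) : Prop :=
  ∀ a : ι → V, ∫⁻ ω, ENNReal.ofReal (Real.exp (∑ i, inner ℝ (a i) (N i ω))) ∂P ≤
    ENNReal.ofReal (Real.exp (s / 2 * ∑ i, ‖a i‖ ^ 2))

/-- The square is linearized by an independent standard Gaussian `g`, as
`exp (a² / 2) = 𝔼 exp (a g)`. -/
lemma JointlySubGaussian.lintegral_exp_sum_sq_le [SFinite P] (h : JointlySubGaussian N s P)
    (hN : ∀ i, Measurable (N i)) (hs : 0 < s) {v : V} (hv : ‖v‖ ≤ 1) :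
    ∫⁻ ω, ENNReal.ofReal (Real.exp (1 / (4 * s) * ∑ i, inner ℝ v (N i ω) ^ 2)) ∂P ≤
      ENNReal.ofReal (√2 ^ Fintype.card ι) := by
  set r : ℝ := √(1 / (2 * s))
  have hr : r ^ 2 = 1 / (2 * s) := Real.sq_sqrt (by positivity)
  have hlinearize (ω : Ω) : 1 / (4 * s) * ∑ i, inner ℝ v (N i ω) ^ 2 =
      ∑ i, inner ℝ (r • v) (N i ω) ^ 2 / 2 := by
    rw [Finset.mul_sum]
    refine Finset.sum_congr rfl fun i _ => ?_
    rw [real_inner_smul_left, mul_pow, hr]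
    ring
  have hproxy (g : ι → ℝ) : s / 2 * ∑ i, ‖g i • r • v‖ ^ 2 ≤ ∑ i, g i ^ 2 / 4 := by
    rw [Finset.mul_sum]
    refine Finset.sum_le_sum fun i _ => ?_
    rw [norm_smul, norm_smul, mul_pow, mul_pow, Real.norm_eq_abs, Real.norm_eq_abs, sq_abs, sq_abs,
      hr]
    calc s / 2 * (g i ^ 2 * (1 / (2 * s) * ‖v‖ ^ 2)) = g i ^ 2 / 4 * ‖v‖ ^ 2 := by
          field_simp; ring
      _ ≤ g i ^ 2 / 4 := mul_le_of_le_one_right (by positivity) (pow_le_one₀ (norm_nonneg v) hv)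
  have hmeas : Measurable fun p : Ω × (ι → ℝ) =>
      ENNReal.ofReal (Real.exp (∑ i, inner ℝ (p.2 i • r • v) (N i p.1))) := by fun_prop
  simp only [hlinearize, ← lintegral_pi_gaussianReal_exp_sum_mul, mul_comm (inner ℝ (r • v) _),
    ← real_inner_smul_left _ (N _ _)]
  rw [lintegral_lintegral_swap hmeas.aemeasurable, ← lintegral_pi_gaussianReal_exp_sum_sq]
  exact lintegral_mono fun g =>
    (h _).trans (ENNReal.ofReal_le_ofReal (Real.exp_le_exp.2 (hproxy g)))

lemma measurable_ofReal_exp_sum_sq_inner (t : ℝ) (hN : ∀ i, Measurable (N i)) :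
    Measurable fun p : Ω × V =>
      ENNReal.ofReal (Real.exp (t * ∑ i, inner ℝ p.2 (N i p.1) ^ 2)) := by
  fun_prop

lemma measurable_expQuadMean (t : ℝ) (hN : ∀ i, Measurable (N i)) :
    Measurable fun ω => expQuadMean t fun i => N i ω := by
  simp only [expQuadMean, setLAverage_eq]
  exact (measurable_ofReal_exp_sum_sq_inner t hN).lintegral_prod_right'.div_const _

lemma JointlySubGaussian.lintegral_expQuadMean_le [SFinite P] (h : JointlySubGaussian N s P)
    (hN : ∀ i, Measurable (N i)) (hs : 0 < s) :
    ∫⁻ ω, expQuadMean (1 / (4 * s)) (fun i => N i ω) ∂P ≤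
      ENNReal.ofReal (√2 ^ Fintype.card ι) := by
  have hmeas := measurable_ofReal_exp_sum_sq_inner (1 / (4 * s)) hN
  simp only [expQuadMean, setLAverage_eq, div_eq_mul_inv _ (volume _)]
  rw [lintegral_mul_const _ hmeas.lintegral_prod_right',
    lintegral_lintegral_swap hmeas.aemeasurable, ← div_eq_mul_inv]
  refine ENNReal.div_le_of_le_mul ?_
  rw [← setLIntegral_const]
  exact setLIntegral_mono' measurableSet_ball fun v hv =>
    h.lintegral_exp_sum_sq_le hN hs (mem_ball_zero_iff.1 hv).le

/-- The constant comes from `log (2 ^ finrank * √2 ^ card) ≤ 3 / 4 * (card + finrank)`. -/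
theorem JointlySubGaussian.exists_uniform_bound [IsProbabilityMeasure P]
    (h : JointlySubGaussian N s P) (hN : ∀ i, Measurable (N i)) (hs : 0 < s) :
    ∃ Φ : Ω → ℝ, Integrable Φ P ∧
      ∫ ω, Φ ω ∂P ≤ 12 * s * (Fintype.card ι + Module.finrank ℝ V) ∧
      ∀ ω u, ‖u‖ ≤ 1 → ∑ i, inner ℝ u (N i ω) ^ 2 ≤ Φ ω := by
  set D := Module.finrank ℝ V
  set q : ℝ := √2 ^ Fintype.card ι with hq
  set Z : Ω → ℝ := fun ω => (expQuadMean (1 / (4 * s)) fun i => N i ω).toReal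
  have ht : 0 ≤ 1 / (4 * s) := by positivity
  have hq0 : 0 < q := by positivity
  have hmeas := measurable_expQuadMean (1 / (4 * s)) hN
  have hmean := h.lintegral_expQuadMean_le hN hs
  have hZint : Integrable Z P :=
    integrable_toReal_of_lintegral_ne_top hmeas.aemeasurable
      (hmean.trans_lt ENNReal.ofReal_lt_top).ne
  have hZmean : ∫ ω, Z ω ∂P ≤ q := by
    rw [integral_toReal hmeas.aemeasurable
      (Filter.Eventually.of_forall fun ω => expQuadMean_lt_top ht _)]
    exact ENNReal.toReal_le_of_le_ofReal hq0.le hmean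
  have hlog : Real.log (2 ^ D * q) ≤ 3 / 4 * (Fintype.card ι + D) := by
    rw [Real.log_mul (by positivity) (by positivity), hq, Real.log_pow, Real.log_pow,
      Real.log_sqrt zero_le_two]
    nlinarith [Real.log_two_lt_d9, (Nat.cast_nonneg _ : (0 : ℝ) ≤ Fintype.card ι),
      (Nat.cast_nonneg _ : (0 : ℝ) ≤ D)]
  refine ⟨fun ω => 16 * s * (Real.log (2 ^ D * q) - 1 + Z ω / q),
    ((integrable_const _).add (hZint.div_const _)).const_mul _, ?_, fun ω u hu => ?_⟩
  · rw [integral_const_mul, integral_add (integrable_const _) (hZint.div_const _), integral_div]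
    simp only [integral_const, probReal_univ, one_smul]
    calc _ ≤ 16 * s * (3 / 4 * (Fintype.card ι + D) - 1 + 1) := by
          gcongr
          exact div_le_one_of_le₀ hZmean hq0.le
      _ = _ := by ring
  · have hexp : Real.exp (1 / (4 * s) / 4 * ∑ i, inner ℝ u (N i ω) ^ 2) ≤ 2 ^ D * Z ω := by
      have hle := ENNReal.toReal_mono
        (ENNReal.mul_ne_top (by finiteness) (expQuadMean_lt_top ht _).ne)
        (ofReal_exp_le_expQuadMean ht (fun i => N i ω) hu)
      rwa [ENNReal.toReal_mul, ENNReal.toReal_pow, ENNReal.toReal_ofNat,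
        ENNReal.toReal_ofReal (Real.exp_pos _).le] at hle
    have hbound := le_log_sub_one_add_div (by positivity : 0 < 2 ^ D * q) hexp
    rw [mul_div_mul_left _ _ (by positivity)] at hbound
    calc ∑ i, inner ℝ u (N i ω) ^ 2
        = 16 * s * (1 / (4 * s) / 4 * ∑ i, inner ℝ u (N i ω) ^ 2) := by field_simp; norm_num
      _ ≤ _ := mul_le_mul_of_nonneg_left hbound (by positivity)

end OperatorNorm

/-! ### Gaussian vectors -/

section Gaussian

variable {Ω : Type*} {mΩ : MeasurableSpace Ω} {P : Measure Ω} {d : ℕ} {s : ℝ} {Y : Ω → E d}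

lemma posSemidef_sq_smul_one (d : ℕ) (s : ℝ) :
    (s ^ 2 • (1 : Matrix (Fin d) (Fin d) ℝ)).PosSemidef :=
  Matrix.PosSemidef.one.smul (sq_nonneg s)

instance (d : ℕ) (s : ℝ) : IsGaussian (gaussianNoise d s) := by
  unfold gaussianNoise
  infer_instance

lemma integral_id_gaussianNoise (d : ℕ) (s : ℝ) : ∫ y, y ∂(gaussianNoise d s) = 0 :=
  integral_id_multivariateGaussian

lemma variance_inner_gaussianNoise (d : ℕ) (s : ℝ) (a : E d) :
    Var[fun y => inner ℝ a y; gaussianNoise d s] = s ^ 2 * ‖a‖ ^ 2 := by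
  rw [← covarianceBilin_self IsGaussian.memLp_two_id, gaussianNoise,
    covarianceBilin_multivariateGaussian (posSemidef_sq_smul_one d s), Matrix.smul_mulVec,
    Matrix.one_mulVec, dotProduct_smul, smul_eq_mul, EuclideanSpace.norm_sq_eq]
  simp [dotProduct, sq]

lemma map_inner_gaussianNoise (d : ℕ) (s : ℝ) (a : E d) :
    (gaussianNoise d s).map (fun y => inner ℝ a y) =
      gaussianReal 0 (s ^ 2 * ‖a‖ ^ 2).toNNReal := by
  have hmean : ∫ y, innerSL ℝ a y ∂(gaussianNoise d s) = 0 := by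
    rw [ContinuousLinearMap.integral_comp_comm _ IsGaussian.integrable_fun_id,
      integral_id_gaussianNoise, map_zero]
  rw [← variance_inner_gaussianNoise, ← hmean]
  exact IsGaussian.map_eq_gaussianReal (innerSL ℝ a)

lemma aemeasurable_of_map_gaussianNoise (h : P.map Y = gaussianNoise d s) : AEMeasurable Y P :=
  aemeasurable_of_map_neZero (by rw [h]; infer_instance)

lemma memLp_two_of_map_gaussianNoise (h : P.map Y = gaussianNoise d s) : MemLp Y 2 P :=
  (memLp_map_measure_iff (g := id) (by fun_prop) (aemeasurable_of_map_gaussianNoise h)).1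
    (by rw [h]; exact IsGaussian.memLp_two_id)

lemma integral_of_map_gaussianNoise (h : P.map Y = gaussianNoise d s) : ∫ ω, Y ω ∂P = 0 := by
  rw [← integral_id_gaussianNoise d s, ← h,
    integral_map (aemeasurable_of_map_gaussianNoise h) (by fun_prop)]

lemma lintegral_exp_inner_of_map_gaussianNoise (h : P.map Y = gaussianNoise d s) (a : E d) :
    ∫⁻ ω, ENNReal.ofReal (Real.exp (inner ℝ a (Y ω))) ∂P =
      ENNReal.ofReal (Real.exp (s ^ 2 / 2 * ‖a‖ ^ 2)) := by
  have hlaw : P.map (fun ω => inner ℝ a (Y ω)) = gaussianReal 0 (s ^ 2 * ‖a‖ ^ 2).toNNReal := by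
    rw [← map_inner_gaussianNoise, ← h,
      AEMeasurable.map_map_of_aemeasurable (by fun_prop) (aemeasurable_of_map_gaussianNoise h)]
    rfl
  have hmgf : ∫ ω, Real.exp (inner ℝ a (Y ω)) ∂P = Real.exp (s ^ 2 / 2 * ‖a‖ ^ 2) := by
    simpa [mgf, Real.coe_toNNReal _ (by positivity : 0 ≤ s ^ 2 * ‖a‖ ^ 2), div_mul_eq_mul_div]
      using mgf_gaussianReal hlaw 1
  rw [← hmgf, ofReal_integral_eq_lintegral_ofReal
    (.of_integral_ne_zero (hmgf ▸ (Real.exp_pos _).ne'))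
    (Filter.Eventually.of_forall fun _ => (Real.exp_pos _).le)]

lemma integral_sq_coord_gaussianNoise (d : ℕ) (s : ℝ) (k : Fin d) :
    ∫ y, y k ^ 2 ∂(gaussianNoise d s) = s ^ 2 := by
  have hmean : ∫ y, y k ∂(gaussianNoise d s) = 0 := by
    simpa [integral_id_gaussianNoise] using (EuclideanSpace.proj (𝕜 := ℝ) k).integral_comp_comm
      (IsGaussian.integrable_fun_id (μ := gaussianNoise d s))
  rw [← variance_of_integral_eq_zero (by fun_prop) hmean, gaussianNoise,
    variance_eval_multivariateGaussian (posSemidef_sq_smul_one d s)]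
  simp

lemma integral_sq_norm_of_map_gaussianNoise (h : P.map Y = gaussianNoise d s) :
    ∫ ω, ‖Y ω‖ ^ 2 ∂P = d * s ^ 2 := by
  have hcoord (k : Fin d) : MemLp (fun y : E d => y k) 2 (gaussianNoise d s) :=
    (EuclideanSpace.proj (𝕜 := ℝ) k).comp_memLp' IsGaussian.memLp_two_id
  calc ∫ ω, ‖Y ω‖ ^ 2 ∂P = ∫ y, ∑ k, y k ^ 2 ∂(gaussianNoise d s) := by
        rw [← h, integral_map (aemeasurable_of_map_gaussianNoise h) (by fun_prop)]
        simp only [EuclideanSpace.norm_sq_eq, Real.norm_eq_abs, sq_abs]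
    _ = d * s ^ 2 := by
        rw [integral_finsetSum _ fun k _ => (hcoord k).integrable_sq]
        simp [integral_sq_coord_gaussianNoise]

end Gaussian

/-! ### Uniform mixtures and orthogonality in `L²` -/

section Mixture

variable {Ω ι : Type*} {𝒢 mΩ : MeasurableSpace Ω} {P : Measure Ω} [IsProbabilityMeasure P]
  [MeasurableSpace ι] [MeasurableSingletonClass ι] {Z : Ω → ι} {s : Finset ι}

lemma ae_mem_of_map_eq_uniformOn (hZ : Measurable Z) (hs : s.Nonempty)
    (hlaw : P.map Z = uniformOn (s : Set ι)) : ∀ᵐ ω ∂P, Z ω ∈ s := by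
  refine (prob_compl_eq_zero_iff (hZ s.measurableSet)).2 ?_
  rw [← Measure.map_apply hZ s.measurableSet, hlaw]
  exact uniformOn_self s.finite_toSet hs

omit [IsProbabilityMeasure P] in
lemma measureReal_preimage_singleton_of_map_eq_uniformOn (hZ : Measurable Z)
    (hlaw : P.map Z = uniformOn (s : Set ι)) {z : ι} (hz : z ∈ s) :
    P.real (Z ⁻¹' {z}) = (#s : ℝ)⁻¹ := by
  classical
  rw [measureReal_def, ← Measure.map_apply hZ (measurableSet_singleton z), hlaw,
    ← Finset.coe_singleton, uniformOn_apply_finset, Finset.inter_singleton_of_mem hz]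
  simp

omit [MeasurableSpace ι] [MeasurableSingletonClass ι] in
lemma sum_indicator_preimage_singleton (ψ : ι → Ω → ℝ) {ω : Ω} (hω : Z ω ∈ s) :
    ∑ z ∈ s, (Z ⁻¹' {z}).indicator (ψ z) ω = ψ (Z ω) ω := by
  have hzero : ∀ z ∈ s, z ≠ Z ω → (Z ⁻¹' {z}).indicator (ψ z) ω = 0 := fun z _ hz =>
    Set.indicator_of_notMem (fun h : ω ∈ Z ⁻¹' {z} => hz (Set.mem_singleton_iff.1 h).symm) _
  rw [Finset.sum_eq_single_of_mem (Z ω) hω hzero]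
  exact Set.indicator_of_mem (s := Z ⁻¹' {Z ω}) (Set.mem_singleton (Z ω)) _

lemma integrable_and_integral_uniform_mixture (hZ : Measurable Z) (hs : s.Nonempty)
    (hlaw : P.map Z = uniformOn (s : Set ι)) {ψ : ι → Ω → ℝ}
    (hψ : ∀ z ∈ s, Integrable (ψ z) P) (hind : ∀ z ∈ s, IndepFun Z (ψ z) P) :
    Integrable (fun ω => ψ (Z ω) ω) P ∧
      ∫ ω, ψ (Z ω) ω ∂P = (#s : ℝ)⁻¹ * ∑ z ∈ s, ∫ ω, ψ z ω ∂P := by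
  have hae : (fun ω => ψ (Z ω) ω) =ᵐ[P] fun ω => ∑ z ∈ s, (Z ⁻¹' {z}).indicator (ψ z) ω := by
    filter_upwards [ae_mem_of_map_eq_uniformOn hZ hs hlaw] with ω hω
    exact (sum_indicator_preimage_singleton ψ hω).symm
  have hms (z : ι) : MeasurableSet (Z ⁻¹' {z}) := hZ (measurableSet_singleton z)
  have hint : ∀ z ∈ s, Integrable ((Z ⁻¹' {z}).indicator (ψ z)) P := fun z hz =>
    (hψ z hz).indicator (hms z)
  refine ⟨(integrable_congr hae).2 (integrable_finsetSum _ hint), ?_⟩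
  rw [integral_congr_ae hae, integral_finsetSum _ hint, Finset.mul_sum]
  refine Finset.sum_congr rfl fun z hz => ?_
  rw [integral_indicator (hms z), ← measureReal_preimage_singleton_of_map_eq_uniformOn hZ hlaw hz]
  exact Indep.setIntegral_eq_mul (f := id) hZ.comap_le (hind z hz) (hψ z hz).aemeasurable
    ⟨{z}, measurableSet_singleton z, rfl⟩ aestronglyMeasurable_id

end Mixture

section Centered

variable {Ω V κ : Type*} {𝒢 𝒢' mΩ : MeasurableSpace Ω} {P : Measure Ω}
  [NormedAddCommGroup V] [InnerProductSpace ℝ V] {U Y : Ω → V}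

lemma integrable_inner_of_memLp_two (hU : MemLp U 2 P) (hY : MemLp Y 2 P) :
    Integrable (fun ω => inner ℝ (U ω) (Y ω)) P :=
  memLp_one_iff_integrable.1 ((innerSL ℝ).memLp_of_bilin 1 hU hY)

omit [InnerProductSpace ℝ V] in
lemma integrable_sq_norm_of_memLp_two (hU : MemLp U 2 P) : Integrable (fun ω => ‖U ω‖ ^ 2) P :=
  (memLp_two_iff_integrable_sq_norm hU.1).1 hU

lemma integral_sq_norm_sum (s : Finset κ) {U : κ → Ω → V} (hU : ∀ k ∈ s, MemLp (U k) 2 P)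
    (horth : ∀ k ∈ s, ∀ l ∈ s, k ≠ l → ∫ ω, inner ℝ (U k ω) (U l ω) ∂P = 0) :
    ∫ ω, ‖∑ k ∈ s, U k ω‖ ^ 2 ∂P = ∑ k ∈ s, ∫ ω, ‖U k ω‖ ^ 2 ∂P := by
  have hint : ∀ k ∈ s, ∀ l ∈ s, Integrable (fun ω => inner ℝ (U k ω) (U l ω)) P :=
    fun k hk l hl => integrable_inner_of_memLp_two (hU k hk) (hU l hl)
  simp only [sq_norm_sum_eq_sum_sum_inner]
  rw [integral_finsetSum _ fun k hk => integrable_finsetSum _ (hint k hk)]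
  refine Finset.sum_congr rfl fun k hk => ?_
  rw [integral_finsetSum _ (hint k hk),
    Finset.sum_eq_single_of_mem k hk fun l hl hlk => horth k hk l hl hlk.symm]
  simp only [real_inner_self_eq_norm_sq]

variable [MeasurableSpace V]

/-- `U` is square-integrable and orthogonal in `L²` to all the square-integrable `𝒢`-measurable
vectors. On a probability space this says that the conditional expectation of `U` given `𝒢`
vanishes; orthogonality is the form in which the argument uses it. -/
def IsCentered (𝒢 : MeasurableSpace Ω) {_ : MeasurableSpace Ω} (U : Ω → V)
    (P : Measure Ω) : Prop :=
  MemLp U 2 P ∧ ∀ Y : Ω → V, Measurable[𝒢] Y → MemLp Y 2 P → ∫ ω, inner ℝ (Y ω) (U ω) ∂P = 0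

lemma IsCentered.smul (h : IsCentered 𝒢 U P) (c : ℝ) : IsCentered 𝒢 (fun ω => c • U ω) P := by
  refine ⟨h.1.const_smul c, fun Y hY hY2 => ?_⟩
  simp only [real_inner_smul_right, integral_const_mul, h.2 Y hY hY2, mul_zero]

lemma IsCentered.mono (h : IsCentered 𝒢 U P) (hle : 𝒢' ≤ 𝒢) : IsCentered 𝒢' U P :=
  ⟨h.1, fun Y hY hY2 => h.2 Y (hY.mono hle le_rfl) hY2⟩

lemma isCentered_zero : IsCentered 𝒢 (fun _ => (0 : V)) P :=
  ⟨MemLp.zero, fun _ _ _ => by simp only [inner_zero_right, integral_zero]⟩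

lemma isCentered_sum (s : Finset κ) {U : κ → Ω → V} (hU : ∀ k ∈ s, IsCentered 𝒢 (U k) P) :
    IsCentered 𝒢 (fun ω => ∑ k ∈ s, U k ω) P := by
  refine ⟨memLp_finsetSum _ fun k hk => (hU k hk).1, fun Y hY hY2 => ?_⟩
  simp only [inner_sum]
  rw [integral_finsetSum _ fun k hk => integrable_inner_of_memLp_two hY2 (hU k hk).1]
  exact Finset.sum_eq_zero fun k hk => (hU k hk).2 Y hY hY2

lemma IsCentered.integral_sq_norm_add (hU : IsCentered 𝒢 U P) (hY : Measurable[𝒢] Y)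
    (hY2 : MemLp Y 2 P) :
    ∫ ω, ‖Y ω + U ω‖ ^ 2 ∂P = ∫ ω, ‖Y ω‖ ^ 2 ∂P + ∫ ω, ‖U ω‖ ^ 2 ∂P := by
  have hYint := integrable_sq_norm_of_memLp_two hY2
  have hcross := (integrable_inner_of_memLp_two hY2 hU.1).const_mul 2
  have hYcross : Integrable (fun ω => ‖Y ω‖ ^ 2 + 2 * inner ℝ (Y ω) (U ω)) P := hYint.add hcross
  simp only [norm_add_sq_real]
  rw [integral_add hYcross (integrable_sq_norm_of_memLp_two hU.1),
    integral_add hYint hcross, integral_const_mul, hU.2 Y hY hY2, mul_zero, add_zero]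

variable [IsProbabilityMeasure P] [BorelSpace V] [SecondCountableTopology V]

omit [SecondCountableTopology V] in
lemma isCentered_of_indep [CompleteSpace V] (hU : MemLp U 2 P) (hmean : ∫ ω, U ω ∂P = 0)
    (hind : Indep (MeasurableSpace.comap U inferInstance) 𝒢 P) : IsCentered 𝒢 U P := by
  refine ⟨hU, fun Y hY hY2 => ?_⟩
  have hYU : IndepFun Y U P :=
    (indep_of_indep_of_le_right hind (measurable_iff_comap_le.1 hY)).symm
  have h := hYU.integral_bilin (hY2.integrable one_le_two) (hU.integrable one_le_two) (innerSL ℝ)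
  rwa [hmean, map_zero] at h

lemma isCentered_uniform_mixture {ι : Type*} [MeasurableSpace ι]
    [MeasurableSingletonClass ι] {Z : Ω → ι} (hZ : Measurable Z)
    {s : Finset ι} (hs : s.Nonempty) (hlaw : P.map Z = uniformOn (s : Set ι))
    (hind : Indep (MeasurableSpace.comap Z inferInstance) 𝒢 P)
    {φ : ι → Ω → V} (hφ : ∀ z, Measurable[𝒢] (φ z)) (hφ2 : ∀ z ∈ s, MemLp (φ z) 2 P)
    (hsum : ∀ ω, ∑ z ∈ s, φ z ω = 0) (hm : AEStronglyMeasurable (fun ω => φ (Z ω) ω) P) :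
    IsCentered 𝒢 (fun ω => φ (Z ω) ω) P ∧
      ∫ ω, ‖φ (Z ω) ω‖ ^ 2 ∂P = (#s : ℝ)⁻¹ * ∑ z ∈ s, ∫ ω, ‖φ z ω‖ ^ 2 ∂P := by
  have hZψ {ψ : Ω → ℝ} (hψ : Measurable[𝒢] ψ) : IndepFun Z ψ P :=
    indep_of_indep_of_le_right hind (measurable_iff_comap_le.1 hψ)
  obtain ⟨hsq_int, hsq⟩ :=
    integrable_and_integral_uniform_mixture hZ hs hlaw (ψ := fun z ω => ‖φ z ω‖ ^ 2)
      (fun z hz => integrable_sq_norm_of_memLp_two (hφ2 z hz))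
      fun z _ => hZψ ((measurable_norm.pow_const 2).comp (hφ z))
  refine ⟨⟨(memLp_two_iff_integrable_sq_norm hm).2 hsq_int, fun Y hY hY2 => ?_⟩, hsq⟩
  have hint : ∀ z ∈ s, Integrable (fun ω => inner ℝ (Y ω) (φ z ω)) P := fun z hz =>
    integrable_inner_of_memLp_two hY2 (hφ2 z hz)
  rw [(integrable_and_integral_uniform_mixture hZ hs hlaw hint
    fun z _ => hZψ (hY.inner (hφ z))).2, ← integral_finsetSum _ hint]
  simp only [← inner_sum, hsum, inner_zero_right, integral_zero, mul_zero]

end Centered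

/-! ### Sums over pairs -/

section Pairs

variable {ι M V : Type*} [Fintype ι] [LinearOrder ι]

lemma sum_pairs_eq_sum_sum_ite [AddCommMonoid M] (F : ι → ι → M) :
    ∑ p : {p : ι × ι // p.1 < p.2}, F p.1.1 p.1.2 = ∑ i, ∑ j, if i < j then F i j else 0 := by
  rw [← Fintype.sum_prod_type' (f := fun i j => if i < j then F i j else 0),
    ← Finset.sum_filter (fun p : ι × ι => p.1 < p.2) fun p => F p.1 p.2]
  exact (Finset.sum_subtype _ (by simp) fun p : ι × ι => F p.1 p.2).symm

lemma sum_sum_erase_eq_sum_pairs [AddCommMonoid M] (F : ι → ι → M) :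
    ∑ i, ∑ j ∈ univ.erase i, F i j =
      ∑ p : {p : ι × ι // p.1 < p.2}, (F p.1.1 p.1.2 + F p.1.2 p.1.1) := by
  rw [Finset.sum_add_distrib, sum_pairs_eq_sum_sum_ite F, sum_pairs_eq_sum_sum_ite fun i j => F j i,
    Finset.sum_comm (f := fun i j => if i < j then F j i else 0), ← Finset.sum_add_distrib]
  refine Finset.sum_congr rfl fun i _ => ?_
  rw [← Finset.sum_add_distrib, ← Finset.filter_ne', Finset.sum_filter]
  refine Finset.sum_congr rfl fun j _ => ?_
  rcases lt_trichotomy i j with h | h | h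
  · simp [h, h.ne', h.not_gt]
  · simp [h]
  · simp [h, h.ne, h.not_gt]

lemma sum_pairs_sq_norm_sub [NormedAddCommGroup V] [InnerProductSpace ℝ V] (a : ι → V) :
    ∑ p : {p : ι × ι // p.1 < p.2}, ‖a p.1.1 - a p.1.2‖ ^ 2 =
      Fintype.card ι * ∑ i, ‖a i‖ ^ 2 - ‖∑ i, a i‖ ^ 2 := by
  calc ∑ p : {p : ι × ι // p.1 < p.2}, ‖a p.1.1 - a p.1.2‖ ^ 2
      = ∑ p : {p : ι × ι // p.1 < p.2}, (‖a p.1.1‖ ^ 2 - inner ℝ (a p.1.1) (a p.1.2)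
          + (‖a p.1.2‖ ^ 2 - inner ℝ (a p.1.2) (a p.1.1))) := by
        refine Finset.sum_congr rfl fun p _ => ?_
        rw [norm_sub_sq_real, real_inner_comm (a p.1.1) (a p.1.2)]
        ring
    _ = ∑ i, ∑ j ∈ univ.erase i, (‖a i‖ ^ 2 - inner ℝ (a i) (a j)) :=
        (sum_sum_erase_eq_sum_pairs fun i j => ‖a i‖ ^ 2 - inner ℝ (a i) (a j)).symm
    _ = ∑ i, ∑ j, (‖a i‖ ^ 2 - inner ℝ (a i) (a j)) :=
        Finset.sum_congr rfl fun i _ =>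
          Finset.sum_erase _ (by rw [real_inner_self_eq_norm_sq, sub_self])
    _ = Fintype.card ι * ∑ i, ‖a i‖ ^ 2 - ‖∑ i, a i‖ ^ 2 := by
        rw [sq_norm_sum_eq_sum_sum_inner]
        simp only [Finset.sum_sub_distrib, Finset.sum_const, Finset.card_univ, nsmul_eq_mul,
          ← Finset.mul_sum]

end Pairs

/-! ### Momentum -/

section Momentum

variable {Ω V : Type*}

/-- Exponential averages of a sequence of random vectors, started at zero: the filter that an
honest worker applies to the stochastic gradients `u 1, u 2, …`. -/
def momentum [AddCommGroup V] [Module ℝ V] (β : ℕ → ℝ) (u : ℕ → Ω → V) : ℕ → Ω → V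
  | 0 => fun _ => 0
  | t + 1 => fun ω => β t • momentum β u t ω + (1 - β t) • u (t + 1) ω

/-- Sum of the squared weights of `u 1, …, u t` in `momentum β u t`. -/
def momentumVariance (β : ℕ → ℝ) : ℕ → ℝ
  | 0 => 0
  | t + 1 => β t ^ 2 * momentumVariance β t + (1 - β t) ^ 2

lemma momentumVariance_nonneg (β : ℕ → ℝ) (t : ℕ) : 0 ≤ momentumVariance β t := by
  induction t with
  | zero => exact le_rfl
  | succ t ih => rw [momentumVariance]; positivity

lemma sq_convex_combination_le {w : ℝ} (hw : w ∈ Set.Icc (0 : ℝ) 1) (x y : ℝ) :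
    (w * x + (1 - w) * y) ^ 2 ≤ w * x ^ 2 + (1 - w) * y ^ 2 := by
  nlinarith [mul_nonneg (mul_nonneg hw.1 (sub_nonneg.2 hw.2)) (sq_nonneg (x - y))]

variable {mΩ : MeasurableSpace Ω} {P : Measure Ω} {T : ℕ} {β : ℕ → ℝ} {u : ℕ → Ω → V}
  {ℱ : Filtration ℕ mΩ} [NormedAddCommGroup V]

lemma memLp_momentum [NormedSpace ℝ V] (hu : ∀ t, t + 1 < T → MemLp (u (t + 1)) 2 P) {t : ℕ}
    (ht : t < T) : MemLp (momentum β u t) 2 P := by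
  induction t with
  | zero => exact MemLp.zero
  | succ t ih => exact ((ih (by omega)).const_smul (β t)).add ((hu t ht).const_smul (1 - β t))

variable [MeasurableSpace V] [BorelSpace V] [SecondCountableTopology V]

lemma measurable_momentum [NormedSpace ℝ V]
    (hu : ∀ t, t + 1 < T → Measurable[ℱ (t + 1)] (u (t + 1))) {t : ℕ} (ht : t < T) :
    Measurable[ℱ t] (momentum β u t) := by
  induction t with
  | zero => exact measurable_const
  | succ t ih =>
    have hpast := (ih (by omega)).mono (ℱ.mono (Nat.le_succ t)) le_rfl
    exact (hpast.const_smul (β t)).add ((hu t ht).const_smul (1 - β t))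

lemma integral_sq_norm_momentum_le [InnerProductSpace ℝ V] {B : ℝ}
    (hu : ∀ t, t + 1 < T → Measurable[ℱ (t + 1)] (u (t + 1)))
    (hc : ∀ t, t + 1 < T → IsCentered (ℱ t) (u (t + 1)) P)
    (hB : ∀ t, t + 1 < T → ∫ ω, ‖u (t + 1) ω‖ ^ 2 ∂P ≤ B) {t : ℕ} (ht : t < T) :
    ∫ ω, ‖momentum β u t ω‖ ^ 2 ∂P ≤ momentumVariance β t * B := by
  induction t with
  | zero => simp [momentum, momentumVariance]
  | succ t ih =>
    have htT : t < T := by omega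
    have hpyth := ((hc t ht).smul (1 - β t)).integral_sq_norm_add
      ((measurable_momentum (β := β) hu htT).const_smul (β t))
      ((memLp_momentum (β := β) (fun t ht => (hc t ht).1) htT).const_smul (β t))
    simp only [Pi.smul_apply, norm_smul, mul_pow, integral_const_mul, Real.norm_eq_abs,
      sq_abs] at hpyth
    simp only [momentum]
    rw [hpyth, momentumVariance, add_mul, mul_assoc]
    exact add_le_add (mul_le_mul_of_nonneg_left (ih htT) (sq_nonneg _))
      (mul_le_mul_of_nonneg_left (hB t ht) (sq_nonneg _))

end Momentum

section UnitWeights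

variable {n : ℕ}

lemma sum_unitWeights_smul {V : Type*} [AddCommGroup V] [Module ℝ V] (S : Finset (Fin n))
    (y : Fin n → V) : ∑ i, unitWeights S i • y i = ∑ i ∈ S, y i := by
  simp [unitWeights, ite_smul, Finset.sum_ite_mem]

lemma sq_norm_unitWeights (S : Finset (Fin n)) (i : Fin n) :
    ‖unitWeights S i‖ ^ 2 = unitWeights S i := by
  rw [unitWeights]
  split_ifs <;> simp

end UnitWeights

namespace Execution

/-! ### The noise of one step -/

variable {X : Type*} {d n m : ℕ} {ℓ : E d → X → ℝ} {D : Fin n → Fin m → X}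
  {H : Finset (Fin n)} {f b : ℕ} {C : ℝ≥0∞} {sCor sInd : ℝ} {γ β : ℕ → ℝ} {θ₀ : E d} {T : ℕ}
  {Ω : Type*} {𝒜 : MeasurableSpace Ω} {mΩ : MeasurableSpace Ω} {P : Measure Ω}
  (ex : Execution ℓ D H f b C sCor sInd γ β θ₀ T P) {i : Fin n} {t : ℕ}

lemma measurable_θ (ht : t ≤ T) : Measurable[ex.ℱ t] (ex.θ t) := by
  induction t with
  | zero => rw [show ex.θ 0 = fun _ => θ₀ from funext ex.θ_zero]; exact measurable_const
  | succ t ih =>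
    have hle : ex.ℱ t ≤ ex.ℱ (t + 1) := ex.ℱ.mono (Nat.le_succ t)
    have hθ := (ih (by omega)).mono hle le_rfl
    have hagg := (ex.agg_measurable t (by omega)).mono hle le_rfl
    rw [show ex.θ (t + 1) = fun ω => ex.θ t ω - γ t • ex.agg t ω from
      funext (ex.θ_succ t (by omega))]
    exact hθ.sub (hagg.const_smul (γ t))

lemma measurable_θ_succ (ht : t < T) : Measurable[ex.ℱ t] (ex.θ (t + 1)) := by
  rw [show ex.θ (t + 1) = fun ω => ex.θ t ω - γ t • ex.agg t ω from funext (ex.θ_succ t ht)]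
  exact (ex.measurable_θ ht.le).sub ((ex.agg_measurable t ht).const_smul (γ t))

/-- The family of σ-algebras of the field `fresh`: the history up to step `t` and the sources of
step `t + 1`. -/
@[reducible]
def sourceAlgebra (t : ℕ) (s : Option (Source n)) : MeasurableSpace Ω :=
  match s with
  | none => ex.ℱ t
  | some (.inl i) => MeasurableSpace.comap (ex.batch (t + 1) i) inferInstance
  | some (.inr (.inl p)) => MeasurableSpace.comap (ex.corNoise (t + 1) p.1.1 p.1.2) inferInstance
  | some (.inr (.inr i)) => MeasurableSpace.comap (ex.indNoise (t + 1) i) inferInstance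

/-- The σ-algebra generated by the history up to step `t` and the sources of step `t + 1` other
than `s`. -/
@[reducible]
def otherSources (t : ℕ) (s : Option (Source n)) : MeasurableSpace Ω :=
  ⨆ s' ∈ ({s}ᶜ : Set (Option (Source n))), ex.sourceAlgebra t s'

lemma sourceAlgebra_le (ht : t + 1 < T) (s : Option (Source n)) :
    ex.sourceAlgebra t s ≤ mΩ := by
  rcases s with _ | i | p | i
  · exact ex.ℱ.le t
  · exact (measurable_iff_comap_le.1 (ex.batch_measurable t ht i)).trans (ex.ℱ.le _)
  · exact (measurable_iff_comap_le.1 (ex.corNoise_measurable t ht _ _)).trans (ex.ℱ.le _)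
  · exact (measurable_iff_comap_le.1 (ex.indNoise_measurable t ht i)).trans (ex.ℱ.le _)

lemma iIndep_sourceAlgebra (ht : t + 1 < T) : iIndep (ex.sourceAlgebra t) P := by
  refine iIndep_of_iIndep_of_le (ex.fresh t ht) fun s => ?_
  rcases s with _ | i | p | i <;> exact le_rfl

lemma indep_otherSources (ht : t + 1 < T) (s : Option (Source n)) :
    Indep (ex.sourceAlgebra t s) (ex.otherSources t s) P := by
  have h := indep_iSup_of_disjoint (ex.sourceAlgebra_le ht) (ex.iIndep_sourceAlgebra ht)
    (S := {s}) (T := {s}ᶜ) disjoint_compl_right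
  simpa only [Set.mem_singleton_iff, iSup_iSup_eq_left] using h

lemma sourceAlgebra_le_otherSources {s s' : Option (Source n)} (h : s' ≠ s) :
    ex.sourceAlgebra t s' ≤ ex.otherSources t s :=
  le_iSup₂ (f := fun s' (_ : s' ∈ ({s}ᶜ : Set (Option (Source n)))) => ex.sourceAlgebra t s') s' h

lemma history_le_otherSources (t : ℕ) (s : Source n) : ex.ℱ t ≤ ex.otherSources t (some s) :=
  ex.sourceAlgebra_le_otherSources (Option.some_ne_none s).symm

/-- Error of the mini-batch gradient of worker `i` at step `t`. -/
noncomputable def batchNoise (t : ℕ) (i : Fin n) (ω : Ω) : E d :=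
  batchError ℓ D C i (ex.θ t ω) (ex.batch t i ω)

/-- Privacy noise that worker `i` adds to its mini-batch gradient at step `t`. -/
noncomputable def injectedNoise (t : ℕ) (i : Fin n) (ω : Ω) : E d :=
  ∑ j ∈ univ.erase i, ex.corNoise t i j ω + ex.indNoise t i ω

lemma sum_apply_injectedNoise {M : Type*} [AddCommGroup M] [Module ℝ M] (ht : t + 1 < T)
    (φ : Fin n → E d →ₗ[ℝ] M) (ω : Ω) :
    ∑ i, φ i (ex.injectedNoise (t + 1) i ω) =
      ∑ p : {p : Fin n × Fin n // p.1 < p.2},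
        (φ p.1.1 - φ p.1.2) (ex.corNoise (t + 1) p.1.1 p.1.2 ω)
      + ∑ i, φ i (ex.indNoise (t + 1) i ω) := by
  simp only [injectedNoise, map_add, map_sum, Finset.sum_add_distrib]
  rw [sum_sum_erase_eq_sum_pairs fun i j => φ i (ex.corNoise (t + 1) i j ω)]
  congr 1
  refine Finset.sum_congr rfl fun p _ => ?_
  rw [ex.corNoise_antisymm t ht p.1.1 p.1.2, map_neg, LinearMap.sub_apply, sub_eq_add_neg]

lemma measurable_injectedNoise (ht : t + 1 < T) (i : Fin n) :
    Measurable[ex.ℱ (t + 1)] (ex.injectedNoise (t + 1) i) :=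
  (Finset.measurable_fun_sum _ fun j _ => ex.corNoise_measurable t ht i j).add
    (ex.indNoise_measurable t ht i)

lemma isCentered_corNoise [IsProbabilityMeasure P] (ht : t + 1 < T)
    (p : {p : Fin n × Fin n // p.1 < p.2}) :
    IsCentered (ex.otherSources t (some (.inr (.inl p))))
      (ex.corNoise (t + 1) p.1.1 p.1.2) P :=
  have h := ex.corNoise_law t ht _ _ p.2
  isCentered_of_indep (memLp_two_of_map_gaussianNoise h) (integral_of_map_gaussianNoise h)
    (ex.indep_otherSources ht (some (.inr (.inl p))))

lemma isCentered_indNoise [IsProbabilityMeasure P] (ht : t + 1 < T) (i : Fin n) :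
    IsCentered (ex.otherSources t (some (.inr (.inr i)))) (ex.indNoise (t + 1) i) P :=
  have h := ex.indNoise_law t ht i
  isCentered_of_indep (memLp_two_of_map_gaussianNoise h) (integral_of_map_gaussianNoise h)
    (ex.indep_otherSources ht (some (.inr (.inr i))))

/-- Average over the honest workers of the noise of step `t`. -/
noncomputable def meanNoise (t : ℕ) (ω : Ω) : E d :=
  (H.card : ℝ)⁻¹ • ∑ i ∈ H, (ex.batchNoise t i ω + ex.injectedNoise t i ω)

/-- Contribution of one source of step `t + 1` to the total noise of the honest workers. The
correlated noises of two honest workers cancel. -/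
noncomputable def noisePart (t : ℕ) : Source n → Ω → E d
  | .inl i => fun ω => unitWeights H i • ex.batchNoise (t + 1) i ω
  | .inr (.inl p) => fun ω =>
      (unitWeights H p.1.1 - unitWeights H p.1.2) • ex.corNoise (t + 1) p.1.1 p.1.2 ω
  | .inr (.inr i) => fun ω => unitWeights H i • ex.indNoise (t + 1) i ω

lemma noisePart_inl_of_notMem (hi : i ∉ H) : ex.noisePart t (.inl i) = fun _ => 0 := by
  funext ω
  simp only [noisePart, unitWeights, if_neg hi, zero_smul]

lemma meanNoise_eq_smul_sum_noisePart (ht : t + 1 < T) (ω : Ω) :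
    ex.meanNoise (t + 1) ω = (H.card : ℝ)⁻¹ • ∑ s, ex.noisePart t s ω := by
  have hinj := ex.sum_apply_injectedNoise ht
    (fun i => unitWeights H i • (LinearMap.id : E d →ₗ[ℝ] E d)) ω
  simp only [← sub_smul, LinearMap.smul_apply, LinearMap.id_apply] at hinj
  rw [meanNoise, Fintype.sum_sum_type, Fintype.sum_sum_type, Finset.sum_add_distrib,
    ← sum_unitWeights_smul H fun i => ex.batchNoise (t + 1) i ω,
    ← sum_unitWeights_smul H fun i => ex.injectedNoise (t + 1) i ω, hinj]
  rfl

lemma sum_integral_sq_norm_noisePart_corNoise (ht : t + 1 < T) :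
    ∑ p, ∫ ω, ‖ex.noisePart t (.inr (.inl p)) ω‖ ^ 2 ∂P =
      H.card * ((n - H.card) * (d * sCor ^ 2)) := by
  simp only [noisePart, norm_smul, mul_pow, integral_const_mul]
  rw [Finset.sum_congr rfl fun p _ => by
    rw [integral_sq_norm_of_map_gaussianNoise (ex.corNoise_law t ht _ _ p.2)],
    ← Finset.sum_mul, sum_pairs_sq_norm_sub (unitWeights H)]
  simp only [sq_norm_unitWeights, sum_unitWeights, Real.norm_natCast, Fintype.card_fin]
  ring

lemma sum_integral_sq_norm_noisePart_indNoise (ht : t + 1 < T) :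
    ∑ i, ∫ ω, ‖ex.noisePart t (.inr (.inr i)) ω‖ ^ 2 ∂P = H.card * (d * sInd ^ 2) := by
  simp only [noisePart, norm_smul, mul_pow, integral_const_mul, sq_norm_unitWeights]
  rw [Finset.sum_congr rfl fun i _ => by
    rw [integral_sq_norm_of_map_gaussianNoise (ex.indNoise_law t ht i)],
    ← Finset.sum_mul, sum_unitWeights]

variable (hC : BoundedGradients ℓ D H C)

include hC

lemma measurable_batchNoise (hi : i ∈ H) (ht : t + 1 < T) (hhist : ex.ℱ t ≤ 𝒜)
    (hsource : ex.sourceAlgebra t (some (.inl i)) ≤ 𝒜) :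
    Measurable[𝒜] (ex.batchNoise (t + 1) i) := by
  have herr : Measurable (Function.uncurry (batchError ℓ D C i)) :=
    measurable_from_prod_countable_left fun B => measurable_batchError hC hi B
  have hbatch : Measurable[𝒜] (ex.batch (t + 1) i) := measurable_iff_comap_le.2 hsource
  have hθ : Measurable[𝒜] (ex.θ (t + 1)) := (ex.measurable_θ_succ (by omega)).mono hhist le_rfl
  have hcomp : ex.batchNoise (t + 1) i = Function.uncurry (batchError ℓ D C i) ∘
      fun ω => (ex.θ (t + 1) ω, ex.batch (t + 1) i ω) := by
    funext ω
    rw [Function.comp_apply, Function.uncurry_apply_pair, batchNoise]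
  rw [hcomp]
  exact herr.comp (hθ.prodMk hbatch)

lemma measurable_batchNoise_succ (hi : i ∈ H) (ht : t + 1 < T) :
    Measurable[ex.ℱ (t + 1)] (ex.batchNoise (t + 1) i) :=
  ex.measurable_batchNoise hC hi ht (ex.ℱ.mono (Nat.le_succ t))
    (measurable_iff_comap_le.1 (ex.batch_measurable t ht i))

lemma measurable_noisePart (ht : t + 1 < T) (s : Source n) (hhist : ex.ℱ t ≤ 𝒜)
    (hsource : ex.sourceAlgebra t (some s) ≤ 𝒜) : Measurable[𝒜] (ex.noisePart t s) := by
  rcases s with i | p | i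
  · by_cases hi : i ∈ H
    · exact (ex.measurable_batchNoise hC hi ht hhist hsource).const_smul (unitWeights H i)
    · rw [ex.noisePart_inl_of_notMem hi]
      exact measurable_const
  · have hcor : Measurable[𝒜] (ex.corNoise (t + 1) p.1.1 p.1.2) :=
      measurable_iff_comap_le.2 hsource
    exact hcor.const_smul (unitWeights H p.1.1 - unitWeights H p.1.2)
  · have hind : Measurable[𝒜] (ex.indNoise (t + 1) i) := measurable_iff_comap_le.2 hsource
    exact hind.const_smul (unitWeights H i)

variable [IsProbabilityMeasure P] (hℓ : ∀ x, Differentiable ℝ fun θ => ℓ θ x) {σ : ℝ}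
  (hσ : BoundedVariance ℓ D H σ) (hb : 1 ≤ b) (hbm : b ≤ m)

include hℓ hσ hb hbm

lemma memLp_two_batchError_θ (hi : i ∈ H) (ht : t < T) {B : Finset (Fin m)} (hB : B.card = b) :
    MemLp (fun ω => batchError ℓ D C i (ex.θ (t + 1) ω) B) 2 P := by
  have hθ := (ex.measurable_θ_succ ht).mono (ex.ℱ.le t) le_rfl
  refine MemLp.of_bound ((measurable_batchError hC hi B).comp hθ).aestronglyMeasurable
    (√(m.choose b * batchVariance m b σ)) (Filter.Eventually.of_forall fun ω => ?_)
  exact Real.le_sqrt_of_sq_le (sq_norm_batchError_le hC hσ hi hℓ hb hbm _ hB)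

lemma isCentered_batchNoise_and_integral_sq_norm_eq (hi : i ∈ H) (ht : t + 1 < T) :
    IsCentered (ex.otherSources t (some (.inl i))) (ex.batchNoise (t + 1) i) P ∧
      ∫ ω, ‖ex.batchNoise (t + 1) i ω‖ ^ 2 ∂P =
        (m.choose b : ℝ)⁻¹ * ∑ B ∈ powersetCard b (univ : Finset (Fin m)),
          ∫ ω, ‖batchError ℓ D C i (ex.θ (t + 1) ω) B‖ ^ 2 ∂P := by
  have hlaw : P.map (ex.batch (t + 1) i) =
      uniformOn (powersetCard b (univ : Finset (Fin m)) : Set (Finset (Fin m))) := by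
    rw [ex.batch_law t ht i]
    congr 1
    ext B
    simp
  have hcard : ((powersetCard b (univ : Finset (Fin m))).card : ℝ) = m.choose b := by simp
  rw [← hcard]
  exact isCentered_uniform_mixture (φ := fun B ω => batchError ℓ D C i (ex.θ (t + 1) ω) B)
    ((ex.batch_measurable t ht i).mono (ex.ℱ.le _) le_rfl)
    (Finset.powersetCard_nonempty.2 (by simpa using hbm)) hlaw
    (ex.indep_otherSources ht (some (.inl i)))
    (fun B => ((measurable_batchError hC hi B).comp (ex.measurable_θ_succ (by omega))).mono
      (ex.history_le_otherSources t _) le_rfl)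
    (fun B hB => ex.memLp_two_batchError_θ hC hℓ hσ hb hbm hi (by omega)
      (Finset.mem_powersetCard.1 hB).2)
    (fun ω => sum_batchError_eq_zero hC hi hℓ hb hbm _)
    (ex.measurable_batchNoise hC hi ht (ex.ℱ.le t) (ex.sourceAlgebra_le ht _)).aestronglyMeasurable

lemma isCentered_batchNoise (hi : i ∈ H) (ht : t + 1 < T) :
    IsCentered (ex.otherSources t (some (.inl i))) (ex.batchNoise (t + 1) i) P :=
  (ex.isCentered_batchNoise_and_integral_sq_norm_eq hC hℓ hσ hb hbm hi ht).1

lemma isCentered_batchNoise_succ (hi : i ∈ H) (ht : t + 1 < T) :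
    IsCentered (ex.ℱ t) (ex.batchNoise (t + 1) i) P :=
  (ex.isCentered_batchNoise hC hℓ hσ hb hbm hi ht).mono (ex.history_le_otherSources t _)

lemma integral_sq_norm_batchNoise_le (hi : i ∈ H) (ht : t + 1 < T) :
    ∫ ω, ‖ex.batchNoise (t + 1) i ω‖ ^ 2 ∂P ≤ batchVariance m b σ := by
  have hint : ∀ B ∈ powersetCard b (univ : Finset (Fin m)),
      Integrable (fun ω => ‖batchError ℓ D C i (ex.θ (t + 1) ω) B‖ ^ 2) P := fun B hB =>
    integrable_sq_norm_of_memLp_two (ex.memLp_two_batchError_θ hC hℓ hσ hb hbm hi (by omega)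
      (Finset.mem_powersetCard.1 hB).2)
  rw [(ex.isCentered_batchNoise_and_integral_sq_norm_eq hC hℓ hσ hb hbm hi ht).2,
    ← integral_finsetSum _ hint, ← integral_const_mul]
  calc _ ≤ ∫ _, batchVariance m b σ ∂P :=
        integral_mono ((integrable_finsetSum _ hint).const_mul _) (integrable_const _) fun ω =>
          sum_sq_norm_batchError_le hC hσ hi hℓ hb hbm _
    _ = batchVariance m b σ := by simp

lemma isCentered_noisePart (ht : t + 1 < T) (s : Source n) :
    IsCentered (ex.otherSources t (some s)) (ex.noisePart t s) P := by
  rcases s with i | p | i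
  · by_cases hi : i ∈ H
    · exact (ex.isCentered_batchNoise hC hℓ hσ hb hbm hi ht).smul _
    · rw [ex.noisePart_inl_of_notMem hi]
      exact isCentered_zero
  · exact (ex.isCentered_corNoise ht p).smul _
  · exact (ex.isCentered_indNoise ht i).smul _

lemma isCentered_meanNoise (ht : t + 1 < T) : IsCentered (ex.ℱ t) (ex.meanNoise (t + 1)) P := by
  rw [show ex.meanNoise (t + 1) = fun ω => (H.card : ℝ)⁻¹ • ∑ s, ex.noisePart t s ω from
    funext (ex.meanNoise_eq_smul_sum_noisePart ht)]
  exact (isCentered_sum _ fun s _ => (ex.isCentered_noisePart hC hℓ hσ hb hbm ht s).mono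
    (ex.history_le_otherSources t s)).smul _

lemma integral_sq_norm_sum_noisePart (ht : t + 1 < T) :
    ∫ ω, ‖∑ s, ex.noisePart t s ω‖ ^ 2 ∂P = ∑ s, ∫ ω, ‖ex.noisePart t s ω‖ ^ 2 ∂P := by
  have hcent := ex.isCentered_noisePart hC hℓ hσ hb hbm ht
  refine integral_sq_norm_sum _ (fun s _ => (hcent s).1) fun s _ s' _ hss => ?_
  exact (hcent s').2 _ (ex.measurable_noisePart hC ht s (ex.history_le_otherSources t s')
    (ex.sourceAlgebra_le_otherSources (by simpa using hss))) (hcent s).1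

lemma sum_integral_sq_norm_noisePart_batchNoise_le (ht : t + 1 < T) :
    ∑ i, ∫ ω, ‖ex.noisePart t (.inl i) ω‖ ^ 2 ∂P ≤ H.card * batchVariance m b σ := by
  calc ∑ i, ∫ ω, ‖ex.noisePart t (.inl i) ω‖ ^ 2 ∂P
      = ∑ i ∈ H, ∫ ω, ‖ex.batchNoise (t + 1) i ω‖ ^ 2 ∂P := by
        simp only [noisePart, norm_smul, mul_pow, sq_norm_unitWeights, integral_const_mul]
        exact sum_unitWeights_smul H _
    _ ≤ H.card • batchVariance m b σ := Finset.sum_le_card_nsmul _ _ _ fun i hi =>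
        ex.integral_sq_norm_batchNoise_le hC hℓ hσ hb hbm hi ht
    _ = H.card * batchVariance m b σ := nsmul_eq_mul _ _

lemma integral_sq_norm_meanNoise_le (ht : t + 1 < T) :
    ∫ ω, ‖ex.meanNoise (t + 1) ω‖ ^ 2 ∂P ≤
      (batchVariance m b σ + d * ((n - H.card) * sCor ^ 2 + sInd ^ 2)) / H.card := by
  simp only [fun ω => ex.meanNoise_eq_smul_sum_noisePart ht ω, norm_smul, mul_pow,
    integral_const_mul, norm_inv, Real.norm_natCast]
  rw [ex.integral_sq_norm_sum_noisePart hC hℓ hσ hb hbm ht, Fintype.sum_sum_type,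
    Fintype.sum_sum_type, ex.sum_integral_sq_norm_noisePart_corNoise ht,
    ex.sum_integral_sq_norm_noisePart_indNoise ht]
  rcases Nat.eq_zero_or_pos H.card with hH | hH
  · simp [hH]
  · have hpos : (0 : ℝ) < H.card := by exact_mod_cast hH
    have hbatch := ex.sum_integral_sq_norm_noisePart_batchNoise_le hC hℓ hσ hb hbm ht
    have hcancel : (H.card : ℝ) ^ 2 *
        ((batchVariance m b σ + d * ((n - H.card) * sCor ^ 2 + sInd ^ 2)) / H.card) =
          H.card * batchVariance m b σ +
            (H.card * ((n - H.card) * (d * sCor ^ 2)) + H.card * (d * sInd ^ 2)) := by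
      field_simp
    rw [inv_pow, inv_mul_le_iff₀ (pow_pos hpos 2), hcancel]
    linarith

end Execution

/-! ### Sub-Gaussian sums -/

section SubGaussian

variable {Ω : Type*} {𝒜 ℬ mΩ : MeasurableSpace Ω} {P : Measure Ω}

lemma lintegral_exp_sum_eq_of_iIndep {S : Type*} [Fintype S] {𝒜 : S → MeasurableSpace Ω}
    (h𝒜 : iIndep 𝒜 P) (hle : ∀ s, 𝒜 s ≤ mΩ) {W : S → Ω → ℝ} (hW : ∀ s, Measurable[𝒜 s] (W s))
    {c : S → ℝ}
    (hc : ∀ s, ∫⁻ ω, ENNReal.ofReal (Real.exp (W s ω)) ∂P = ENNReal.ofReal (Real.exp (c s))) :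
    ∫⁻ ω, ENNReal.ofReal (Real.exp (∑ s, W s ω)) ∂P =
      ENNReal.ofReal (Real.exp (∑ s, c s)) := by
  have hexp : ∀ s, Measurable[𝒜 s] fun ω => ENNReal.ofReal (Real.exp (W s ω)) := fun s =>
    ENNReal.measurable_ofReal.comp (Real.measurable_exp.comp (hW s))
  have hind : iIndepFun (fun s ω => ENNReal.ofReal (Real.exp (W s ω))) P := by
    rw [iIndepFun_iff_iIndep]
    exact iIndep_of_iIndep_of_le h𝒜 fun s => measurable_iff_comap_le.1 (hexp s)
  simp only [Real.exp_sum, ENNReal.ofReal_prod_of_nonneg fun _ _ => (Real.exp_pos _).le]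
  rw [lintegral_prod_eq_prod_lintegral_of_indepFun _ _ hind fun s => (hexp s).mono (hle s) le_rfl]
  exact Finset.prod_congr rfl fun s _ => hc s

variable {ι V : Type*} [Fintype ι] [NormedAddCommGroup V] [InnerProductSpace ℝ V]
  {N N' : ι → Ω → V} {s s' : ℝ}

lemma JointlySubGaussian.mono (h : JointlySubGaussian N s P) (hs : s ≤ s') :
    JointlySubGaussian N s' P := fun a => by
  refine (h a).trans ?_
  gcongr

lemma JointlySubGaussian.const_smul (h : JointlySubGaussian N s P) (r : ℝ) :
    JointlySubGaussian (fun i ω => r • N i ω) (r ^ 2 * s) P := fun a => by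
  have hra := h fun i => r • a i
  have hproxy : s / 2 * ∑ i, ‖r • a i‖ ^ 2 = r ^ 2 * s / 2 * ∑ i, ‖a i‖ ^ 2 := by
    simp only [norm_smul, mul_pow, Real.norm_eq_abs, sq_abs, ← Finset.mul_sum]
    ring
  rw [hproxy] at hra
  simpa only [real_inner_smul_left, real_inner_smul_right] using hra

variable [MeasurableSpace V] [BorelSpace V] [SecondCountableTopology V]

lemma measurable_ofReal_exp_sum_inner (a : ι → V) (hN : ∀ i, Measurable (N i)) :
    Measurable fun ω => ENNReal.ofReal (Real.exp (∑ i, inner ℝ (a i) (N i ω))) :=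
  ENNReal.measurable_ofReal.comp (Real.measurable_exp.comp
    (Finset.measurable_fun_sum _ fun i _ => (hN i).const_inner))

lemma JointlySubGaussian.add (h : JointlySubGaussian N s P)
    (h' : JointlySubGaussian N' s' P) (hind : Indep 𝒜 ℬ P) (h𝒜 : 𝒜 ≤ mΩ) (hℬ : ℬ ≤ mΩ)
    (hN : ∀ i, Measurable[𝒜] (N i)) (hN' : ∀ i, Measurable[ℬ] (N' i)) :
    JointlySubGaussian (fun i ω => N i ω + N' i ω) (s + s') P := fun a => by
  simp only [inner_add_right, Finset.sum_add_distrib, Real.exp_add,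
    ENNReal.ofReal_mul (Real.exp_pos _).le, add_div, add_mul]
  rw [lintegral_mul_eq_lintegral_mul_lintegral_of_independent_measurableSpace h𝒜 hℬ hind
    (measurable_ofReal_exp_sum_inner a hN) (measurable_ofReal_exp_sum_inner a hN')]
  exact mul_le_mul' (h a) (h' a)

lemma jointlySubGaussian_momentum [IsProbabilityMeasure P] {β : ℕ → ℝ} {T : ℕ}
    {ℱ : Filtration ℕ mΩ} {𝒜 : ℕ → MeasurableSpace Ω} {u : ℕ → ι → Ω → V}
    (hu : ∀ t, t + 1 < T → ∀ i, Measurable[ℱ (t + 1)] (u (t + 1) i))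
    (hu𝒜 : ∀ t, t + 1 < T → ∀ i, Measurable[𝒜 t] (u (t + 1) i))
    (h𝒜 : ∀ t, t + 1 < T → 𝒜 t ≤ mΩ) (hind : ∀ t, t + 1 < T → Indep (ℱ t) (𝒜 t) P)
    (hsub : ∀ t, t + 1 < T → JointlySubGaussian (u (t + 1)) s P) {t : ℕ} (ht : t < T) :
    JointlySubGaussian (fun i => momentum β (fun t => u t i) t) (momentumVariance β t * s) P := by
  induction t with
  | zero => intro a; simp [momentum, momentumVariance]
  | succ t ih =>
    have htT : t < T := by omega
    rw [momentumVariance, add_mul, mul_assoc]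
    exact ((ih htT).const_smul (β t)).add ((hsub t ht).const_smul (1 - β t)) (hind t ht)
      (ℱ.le t) (h𝒜 t ht)
      (fun i => (measurable_momentum (fun t ht => hu t ht i) htT).const_smul (β t))
      (fun i => (hu𝒜 t ht i).const_smul (1 - β t))

end SubGaussian

section HonestVariance

variable {d n : ℕ}

lemma directionalVariance_unitWeights_le (S : Finset (Fin n)) (x : Fin n → E d) (u z : E d) :
    directionalVariance (unitWeights S) x u ≤
      (S.card : ℝ)⁻¹ * ∑ i ∈ S, inner ℝ u (x i - z) ^ 2 := by
  rcases S.eq_empty_or_nonempty with rfl | hS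
  · simp [directionalVariance, unitWeights]
  have hpos : (0 : ℝ) < S.card := by exact_mod_cast hS.card_pos
  have hsplit := sum_mul_inner_sub_sq (c := unitWeights S)
    (by rw [sum_unitWeights]; exact hpos.ne') x u z
  rw [sum_unitWeights] at hsplit
  rw [le_inv_mul_iff₀ hpos]
  calc S.card * directionalVariance (unitWeights S) x u
      ≤ S.card * (directionalVariance (unitWeights S) x u
          + inner ℝ u (weightedMean (unitWeights S) x - z) ^ 2) := by
        gcongr
        exact le_add_of_nonneg_right (sq_nonneg _)
    _ = ∑ i ∈ S, inner ℝ u (x i - z) ^ 2 := by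
        rw [← hsplit]
        exact sum_unitWeights_smul S _

end HonestVariance

namespace Execution

/-! ### Deviation of the honest momenta -/

variable {X : Type*} {d n m : ℕ} {ℓ : E d → X → ℝ} {D : Fin n → Fin m → X}
  {H : Finset (Fin n)} {f b : ℕ} {C : ℝ≥0∞} {sCor sInd : ℝ} {γ β : ℕ → ℝ} {θ₀ : E d} {T : ℕ}
  {Ω : Type*} {mΩ : MeasurableSpace Ω} {P : Measure Ω}
  (ex : Execution ℓ D H f b C sCor sInd γ β θ₀ T P) {i : Fin n} {t : ℕ}

/-- Momentum of the noise injected by worker `i`. -/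
noncomputable def injectedMomentum (t : ℕ) (i : Fin n) : Ω → E d :=
  momentum β (fun t => ex.injectedNoise t i) t

/-- Momentum of the mini-batch errors of worker `i`. -/
noncomputable def batchMomentum (t : ℕ) (i : Fin n) : Ω → E d :=
  momentum β (fun t => ex.batchNoise t i) t

/-- Momentum of the deviations of the gradient of worker `i` from the honest gradient. -/
noncomputable def heterogeneityMomentum (t : ℕ) (i : Fin n) : Ω → E d :=
  momentum β (fun t ω => ∇ (localLoss ℓ D i) (ex.θ t ω) - ∇ (honestLoss ℓ D H) (ex.θ t ω)) t

/-- Momentum of the honest gradients. -/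
noncomputable def gradientMomentum (t : ℕ) : Ω → E d :=
  momentum β (fun t ω => ∇ (honestLoss ℓ D H) (ex.θ t ω)) t

lemma msg_eq (ht : t < T) (hi : i ∈ H) (ω : Ω) :
    ex.msg t i ω = ex.gradientMomentum t ω +
      (ex.heterogeneityMomentum t i ω + ex.batchMomentum t i ω + ex.injectedMomentum t i ω) := by
  induction t with
  | zero =>
    rw [ex.msg_zero i hi]
    simp [gradientMomentum, heterogeneityMomentum, batchMomentum, injectedMomentum, momentum]
  | succ t ih =>
    rw [ex.msg_succ t ht i hi, ih (by omega)]
    simp only [gradientMomentum, heterogeneityMomentum, batchMomentum, injectedMomentum, momentum,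
      batchNoise, batchError, injectedNoise]
    module

lemma measurable_injectedMomentum (ht : t < T) (i : Fin n) :
    Measurable[ex.ℱ t] (ex.injectedMomentum t i) :=
  measurable_momentum (fun _ ht => ex.measurable_injectedNoise ht i) ht

lemma jointlySubGaussian_injectedNoise [IsProbabilityMeasure P] (ht : t + 1 < T) :
    JointlySubGaussian (ex.injectedNoise (t + 1)) (n * sCor ^ 2 + sInd ^ 2) P := fun a => by
  let 𝒜 : {p : Fin n × Fin n // p.1 < p.2} ⊕ Fin n → MeasurableSpace Ω :=
    ex.sourceAlgebra t ∘ some ∘ Sum.inr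
  have h𝒜 : iIndep 𝒜 P := (ex.iIndep_sourceAlgebra ht).precomp
    ((Option.some_injective _).comp Sum.inr_injective)
  have hmgf := lintegral_exp_sum_eq_of_iIndep h𝒜 (fun s => ex.sourceAlgebra_le ht _)
    (W := Sum.elim
      (fun p ω => inner ℝ (a p.1.1 - a p.1.2) (ex.corNoise (t + 1) p.1.1 p.1.2 ω))
      (fun i ω => inner ℝ (a i) (ex.indNoise (t + 1) i ω)))
    (c := Sum.elim (fun p => sCor ^ 2 / 2 * ‖a p.1.1 - a p.1.2‖ ^ 2)
      (fun i => sInd ^ 2 / 2 * ‖a i‖ ^ 2)) ?_ ?_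
  · have hsum := ex.sum_apply_injectedNoise ht (fun i => innerₛₗ ℝ (a i))
    simp only [← map_sub, innerₛₗ_apply_apply] at hsum
    simp only [Fintype.sum_sum_type, Sum.elim_inl, Sum.elim_inr, ← Finset.mul_sum,
      sum_pairs_sq_norm_sub a, Fintype.card_fin, ← hsum] at hmgf
    rw [hmgf]
    refine ENNReal.ofReal_le_ofReal (Real.exp_le_exp.2 ?_)
    nlinarith [mul_nonneg (sq_nonneg sCor) (sq_nonneg ‖∑ i, a i‖)]
  · rintro (p | i)
    · exact (measurable_iff_comap_le.2 le_rfl : Measurable[ex.sourceAlgebra t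
        (some (.inr (.inl p)))] (ex.corNoise (t + 1) p.1.1 p.1.2)).const_inner
    · exact (measurable_iff_comap_le.2 le_rfl : Measurable[ex.sourceAlgebra t
        (some (.inr (.inr i)))] (ex.indNoise (t + 1) i)).const_inner
  · rintro (p | i)
    · exact lintegral_exp_inner_of_map_gaussianNoise (ex.corNoise_law t ht _ _ p.2) _
    · exact lintegral_exp_inner_of_map_gaussianNoise (ex.indNoise_law t ht i) _

lemma measurable_injectedNoise_otherSources (ht : t + 1 < T) (i : Fin n) :
    Measurable[ex.otherSources t none] (ex.injectedNoise (t + 1) i) := by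
  have hsource (s : Source n) : ex.sourceAlgebra t (some s) ≤ ex.otherSources t none :=
    ex.sourceAlgebra_le_otherSources (Option.some_ne_none s)
  have hpair {j k : Fin n} (hjk : j < k) :
      Measurable[ex.otherSources t none] (ex.corNoise (t + 1) j k) :=
    measurable_iff_comap_le.2 (hsource (.inr (.inl ⟨(j, k), hjk⟩)))
  refine Measurable.add (Finset.measurable_fun_sum _ fun j hj => ?_)
    (measurable_iff_comap_le.2 (hsource (.inr (.inr i))))
  rcases lt_or_gt_of_ne (Finset.ne_of_mem_erase hj) with hji | hij
  · have hneg : ex.corNoise (t + 1) i j = -ex.corNoise (t + 1) j i :=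
      funext (ex.corNoise_antisymm t ht j i)
    rw [hneg]
    exact (hpair hji).neg
  · exact hpair hij

lemma jointlySubGaussian_injectedMomentum [IsProbabilityMeasure P] (ht : t < T) :
    JointlySubGaussian (ex.injectedMomentum t)
      (momentumVariance β t * (n * sCor ^ 2 + sInd ^ 2)) P :=
  jointlySubGaussian_momentum (u := ex.injectedNoise) (ℱ := ex.ℱ)
    (𝒜 := fun t => ex.otherSources t none)
    (fun _ ht i => ex.measurable_injectedNoise ht i)
    (fun _ ht i => ex.measurable_injectedNoise_otherSources ht i)
    (fun _ ht => iSup₂_le fun s _ => ex.sourceAlgebra_le ht s)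
    (fun _ ht => ex.indep_otherSources ht none)
    (fun _ ht => ex.jointlySubGaussian_injectedNoise ht) ht

lemma mean_sq_inner_heterogeneityMomentum_le (hβ : ∀ t, β t ∈ Set.Icc (0 : ℝ) 1) {G : ℝ}
    (hG : BoundedHeterogeneity ℓ D H G) (t : ℕ) (ω : Ω) {v : E d} (hv : ‖v‖ ≤ 1) :
    (H.card : ℝ)⁻¹ * ∑ i ∈ H, inner ℝ v (ex.heterogeneityMomentum t i ω) ^ 2 ≤ G ^ 2 := by
  induction t with
  | zero => simp [heterogeneityMomentum, momentum, sq_nonneg]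
  | succ t ih =>
    let δ (i : Fin n) : E d :=
      ∇ (localLoss ℓ D i) (ex.θ (t + 1) ω) - ∇ (honestLoss ℓ D H) (ex.θ (t + 1) ω)
    calc (H.card : ℝ)⁻¹ * ∑ i ∈ H, inner ℝ v (ex.heterogeneityMomentum (t + 1) i ω) ^ 2
        ≤ (H.card : ℝ)⁻¹ * ∑ i ∈ H, (β t * inner ℝ v (ex.heterogeneityMomentum t i ω) ^ 2
            + (1 - β t) * inner ℝ v (δ i) ^ 2) := by
          refine mul_le_mul_of_nonneg_left (Finset.sum_le_sum fun i _ => ?_) (by positivity)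
          rw [heterogeneityMomentum, momentum, inner_add_right, real_inner_smul_right,
            real_inner_smul_right]
          exact sq_convex_combination_le (hβ t) _ _
      _ = β t * ((H.card : ℝ)⁻¹ * ∑ i ∈ H, inner ℝ v (ex.heterogeneityMomentum t i ω) ^ 2)
          + (1 - β t) * ((H.card : ℝ)⁻¹ * ∑ i ∈ H, inner ℝ v (δ i) ^ 2) := by
          rw [Finset.sum_add_distrib, ← Finset.mul_sum, ← Finset.mul_sum]
          ring
      _ ≤ β t * G ^ 2 + (1 - β t) * G ^ 2 :=
          add_le_add (mul_le_mul_of_nonneg_left ih (hβ t).1)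
            (mul_le_mul_of_nonneg_left (hG _ v hv) (sub_nonneg.2 (hβ t).2))
      _ = G ^ 2 := by ring

lemma sq_inner_msg_sub_gradientMomentum_le (ht : t < T) (hi : i ∈ H) (ω : Ω) {v : E d}
    (hv : ‖v‖ ≤ 1) :
    inner ℝ v (ex.msg t i ω - ex.gradientMomentum t ω) ^ 2 ≤
      3 * inner ℝ v (ex.heterogeneityMomentum t i ω) ^ 2 + 3 * ‖ex.batchMomentum t i ω‖ ^ 2
        + 3 * inner ℝ v (ex.injectedMomentum t i ω) ^ 2 := by
  rw [ex.msg_eq ht hi, add_sub_cancel_left, inner_add_right, inner_add_right]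
  have hbatch : inner ℝ v (ex.batchMomentum t i ω) ^ 2 ≤ ‖ex.batchMomentum t i ω‖ ^ 2 := by
    rw [sq_le_sq, abs_norm]
    exact (abs_real_inner_le_norm _ _).trans (mul_le_of_le_one_left (norm_nonneg _) hv)
  have hthree (x y z : ℝ) : (x + y + z) ^ 2 ≤ 3 * x ^ 2 + 3 * y ^ 2 + 3 * z ^ 2 := by
    nlinarith [sq_nonneg (x - y), sq_nonneg (x - z), sq_nonneg (y - z)]
  refine (hthree _ _ _).trans ?_
  gcongr

lemma lambdaMax_msg_le (hβ : ∀ t, β t ∈ Set.Icc (0 : ℝ) 1) {G : ℝ}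
    (hG : BoundedHeterogeneity ℓ D H G) (ht : t < T) (ω : Ω) {B : ℝ}
    (hB : ∀ v : E d, ‖v‖ ≤ 1 → ∑ i, inner ℝ v (ex.injectedMomentum t i ω) ^ 2 ≤ B) :
    lambdaMax (weightedCov (unitWeights H) fun i => ex.msg t i ω) ≤
      3 * G ^ 2 + 3 * ((H.card : ℝ)⁻¹ * ∑ i ∈ H, ‖ex.batchMomentum t i ω‖ ^ 2)
        + 3 * ((H.card : ℝ)⁻¹ * B) := by
  have hB0 : 0 ≤ B := by simpa using hB 0 (by simp)
  refine lambdaMax_le_of_inner_toEuclideanLin_le (by positivity) fun v hv => ?_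
  have hhet := ex.mean_sq_inner_heterogeneityMomentum_le hβ hG t ω hv.le
  have hinj : ∑ i ∈ H, inner ℝ v (ex.injectedMomentum t i ω) ^ 2 ≤ B :=
    (Finset.sum_le_sum_of_subset_of_nonneg (Finset.subset_univ H)
      fun _ _ _ => sq_nonneg _).trans (hB v hv.le)
  rw [inner_toEuclideanLin_weightedCov]
  calc directionalVariance (unitWeights H) (fun i => ex.msg t i ω) v
      ≤ (H.card : ℝ)⁻¹ * ∑ i ∈ H, inner ℝ v (ex.msg t i ω - ex.gradientMomentum t ω) ^ 2 :=
        directionalVariance_unitWeights_le _ _ _ _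
    _ ≤ (H.card : ℝ)⁻¹ * ∑ i ∈ H, (3 * inner ℝ v (ex.heterogeneityMomentum t i ω) ^ 2
        + 3 * ‖ex.batchMomentum t i ω‖ ^ 2
        + 3 * inner ℝ v (ex.injectedMomentum t i ω) ^ 2) :=
        mul_le_mul_of_nonneg_left (Finset.sum_le_sum fun i hi =>
          ex.sq_inner_msg_sub_gradientMomentum_le ht hi ω hv.le) (by positivity)
    _ = 3 * ((H.card : ℝ)⁻¹ * ∑ i ∈ H, inner ℝ v (ex.heterogeneityMomentum t i ω) ^ 2)
        + 3 * ((H.card : ℝ)⁻¹ * ∑ i ∈ H, ‖ex.batchMomentum t i ω‖ ^ 2)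
        + 3 * ((H.card : ℝ)⁻¹ * ∑ i ∈ H, inner ℝ v (ex.injectedMomentum t i ω) ^ 2) := by
        simp only [Finset.sum_add_distrib, ← Finset.mul_sum]
        ring
    _ ≤ _ := by gcongr

variable (hC : BoundedGradients ℓ D H C) [IsProbabilityMeasure P]
  (hℓ : ∀ x, Differentiable ℝ fun θ => ℓ θ x) {σ : ℝ} (hσ : BoundedVariance ℓ D H σ)
  (hb : 1 ≤ b) (hbm : b ≤ m)

include hC hℓ hσ hb hbm

lemma memLp_batchMomentum (hi : i ∈ H) (ht : t < T) : MemLp (ex.batchMomentum t i) 2 P :=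
  memLp_momentum (u := fun t => ex.batchNoise t i)
    (fun _ ht => (ex.isCentered_batchNoise_succ hC hℓ hσ hb hbm hi ht).1) ht

lemma integral_sq_norm_batchMomentum_le (hi : i ∈ H) (ht : t < T) :
    ∫ ω, ‖ex.batchMomentum t i ω‖ ^ 2 ∂P ≤ momentumVariance β t * batchVariance m b σ :=
  integral_sq_norm_momentum_le (u := fun t => ex.batchNoise t i) (ℱ := ex.ℱ)
    (fun _ ht => ex.measurable_batchNoise_succ hC hi ht)
    (fun _ ht => ex.isCentered_batchNoise_succ hC hℓ hσ hb hbm hi ht)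
    (fun _ ht => ex.integral_sq_norm_batchNoise_le hC hℓ hσ hb hbm hi ht) ht

lemma integrable_and_integral_mean_sq_norm_batchMomentum_le (ht : t < T) :
    Integrable (fun ω => (H.card : ℝ)⁻¹ * ∑ i ∈ H, ‖ex.batchMomentum t i ω‖ ^ 2) P ∧
      ∫ ω, (H.card : ℝ)⁻¹ * ∑ i ∈ H, ‖ex.batchMomentum t i ω‖ ^ 2 ∂P ≤
        momentumVariance β t * batchVariance m b σ := by
  have hint : ∀ i ∈ H, Integrable (fun ω => ‖ex.batchMomentum t i ω‖ ^ 2) P := fun i hi =>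
    integrable_sq_norm_of_memLp_two (ex.memLp_batchMomentum hC hℓ hσ hb hbm hi ht)
  refine ⟨(integrable_finsetSum _ hint).const_mul _, ?_⟩
  rw [integral_const_mul, integral_finsetSum _ hint]
  rcases Nat.eq_zero_or_pos H.card with hH | hH
  · rw [hH, Nat.cast_zero, inv_zero, zero_mul]
    exact mul_nonneg (momentumVariance_nonneg β t) (batchVariance_nonneg hbm σ)
  · rw [inv_mul_le_iff₀ (by exact_mod_cast hH), ← nsmul_eq_mul]
    exact Finset.sum_le_card_nsmul _ _ _ fun i hi =>
      ex.integral_sq_norm_batchMomentum_le hC hℓ hσ hb hbm hi ht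

lemma exists_lambdaMax_msg_bound (hH : 0 < H.card) (hnH : n ≤ 2 * H.card)
    (hβ : ∀ t, β t ∈ Set.Icc (0 : ℝ) 1) {G : ℝ} (hG : BoundedHeterogeneity ℓ D H G)
    (ht : t < T) {s : ℝ} (hs0 : 0 < s)
    (hs : momentumVariance β t * (n * sCor ^ 2 + sInd ^ 2) ≤ s) :
    ∃ Ψ : Ω → ℝ, Integrable Ψ P ∧
      ∫ ω, Ψ ω ∂P ≤ 3 * G ^ 2 + 3 * (momentumVariance β t * batchVariance m b σ)
        + 72 * s * (1 + d / H.card) ∧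
      ∀ ω, lambdaMax (weightedCov (unitWeights H) fun i => ex.msg t i ω) ≤ Ψ ω := by
  obtain ⟨Φ, hΦint, hΦmean, hΦ⟩ :=
    ((ex.jointlySubGaussian_injectedMomentum ht).mono hs).exists_uniform_bound
      (fun i => (ex.measurable_injectedMomentum ht i).mono (ex.ℱ.le t) le_rfl) hs0
  obtain ⟨hbatchInt, hbatch⟩ :=
    ex.integrable_and_integral_mean_sq_norm_batchMomentum_le hC hℓ hσ hb hbm ht
  have hinj : (H.card : ℝ)⁻¹ * ∫ ω, Φ ω ∂P ≤ 24 * s * (1 + d / H.card) := by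
    have hpos : (0 : ℝ) < H.card := by exact_mod_cast hH
    have hnH' : (n : ℝ) ≤ 2 * H.card := by exact_mod_cast hnH
    rw [Fintype.card_fin, finrank_euclideanSpace_fin] at hΦmean
    calc (H.card : ℝ)⁻¹ * ∫ ω, Φ ω ∂P
        ≤ (H.card : ℝ)⁻¹ * (12 * s * (2 * H.card + 2 * d)) := by
          gcongr
          refine hΦmean.trans ?_
          gcongr
          exact le_mul_of_one_le_left (Nat.cast_nonneg d) one_le_two
      _ = 24 * s * (1 + d / H.card) := by
          field_simp [hpos.ne']
          ring
  have hbatchInt' := hbatchInt.const_mul 3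
  have hinjInt := (hΦint.const_mul (H.card : ℝ)⁻¹).const_mul 3
  have hsumInt := (integrable_const (μ := P) (3 * G ^ 2)).add hbatchInt'
  refine ⟨_, hsumInt.add hinjInt, ?_, fun ω => ex.lambdaMax_msg_le hβ hG ht ω (hΦ ω)⟩
  rw [integral_add' hsumInt hinjInt, integral_add' (integrable_const _) hbatchInt',
    integral_const, probReal_univ, one_smul, integral_const_mul 3, integral_const_mul 3,
    integral_const_mul (H.card : ℝ)⁻¹ Φ]
  linarith

end Execution

section TotalVariance

variable {n m f b : ℕ}

lemma mean_noise_le_totalVariance (hfn : f ≤ n) (hbm : b ≤ m) {κ : ℝ} (hκ : 0 ≤ κ) (d : ℕ)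
    (σ sCor sInd : ℝ) :
    (batchVariance m b σ + d * (f * sCor ^ 2 + sInd ^ 2)) / ((n : ℝ) - f) ≤
      totalVariance d n m f b κ σ sCor sInd := by
  have hbatch := batchVariance_nonneg hbm σ
  have hsub : (0 : ℝ) ≤ n - f := sub_nonneg.2 (by exact_mod_cast hfn)
  exact le_add_of_nonneg_right (by positivity)

lemma deviation_le_totalVariance (hfn : f ≤ n) (hbm : b ≤ m) (d : ℕ) (κ σ sCor sInd : ℝ) :
    4 * κ * (batchVariance m b σ
      + 108 * (n * sCor ^ 2 + sInd ^ 2) * (1 + d / ((n : ℝ) - f))) ≤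
      totalVariance d n m f b κ σ sCor sInd := by
  have hbatch := batchVariance_nonneg hbm σ
  have hsub : (0 : ℝ) ≤ n - f := sub_nonneg.2 (by exact_mod_cast hfn)
  exact le_add_of_nonneg_left (by positivity)

lemma totalVariance_nonneg (hfn : f ≤ n) (hbm : b ≤ m) {κ : ℝ} (hκ : 0 ≤ κ) (d : ℕ)
    (σ sCor sInd : ℝ) : 0 ≤ totalVariance d n m f b κ σ sCor sInd := by
  have hbatch := batchVariance_nonneg hbm σ
  have hsub : (0 : ℝ) ≤ n - f := sub_nonneg.2 (by exact_mod_cast hfn)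
  exact le_trans (by positivity) (mean_noise_le_totalVariance hfn hbm hκ d σ sCor sInd)

end TotalVariance

/-- The standing assumptions on the losses, the parameters and the set of honest workers. -/
structure IsAdmissible {X : Type*} {d n m : ℕ} (ℓ : E d → X → ℝ) (D : Fin n → Fin m → X)
    (H : Finset (Fin n)) (f b : ℕ) (C : ℝ≥0∞) (L G σ : ℝ) : Prop where
  two_mul_lt : 2 * f < n
  one_le_batch : 1 ≤ b
  batch_le : b ≤ m
  card_honest : H.card = n - f
  differentiable : ∀ x, Differentiable ℝ fun θ => ℓ θ x
  pos : 0 < L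
  heterogeneity : BoundedHeterogeneity ℓ D H G
  variance : BoundedVariance ℓ D H σ
  gradients : BoundedGradients ℓ D H C
  smooth : IsSmooth L (honestLoss ℓ D H)

namespace IsAdmissible

variable {X : Type*} {d n m : ℕ} {ℓ : E d → X → ℝ} {D : Fin n → Fin m → X}
  {H : Finset (Fin n)} {f b : ℕ} {C : ℝ≥0∞} {L G σ : ℝ} (hA : IsAdmissible ℓ D H f b C L G σ)

include hA

lemma le_workers : f ≤ n := by
  have := hA.two_mul_lt
  omega

lemma card_honest_pos : 0 < H.card := by
  have := hA.two_mul_lt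
  rw [hA.card_honest]
  omega

lemma cast_card_honest : (H.card : ℝ) = n - f := by
  rw [hA.card_honest, Nat.cast_sub hA.le_workers]

lemma differentiable_loss : Differentiable ℝ (honestLoss ℓ D H) :=
  differentiable_honestLoss hA.differentiable

end IsAdmissible

section SquareIntegrability

variable {d : ℕ} {L : ℝ} {F : E d → ℝ} {Ω : Type*} {mΩ : MeasurableSpace Ω} {P : Measure Ω}
  [IsProbabilityMeasure P] {U : Ω → E d}

lemma IsSmooth.memLp_gradient_comp (hF : IsSmooth L F) (hU : MemLp U 2 P) :
    MemLp (fun ω => ∇ F (U ω)) 2 P := by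
  have hconst : MemLp (fun _ : Ω => ‖∇ F 0‖) 2 P := memLp_const _
  have hbound : MemLp (fun ω => ‖∇ F 0‖ + L * ‖U ω‖) 2 P := hconst.add (hU.norm.const_mul L)
  refine hbound.mono' ((measurable_gradient _).comp_aemeasurable
    hU.1.aemeasurable).aestronglyMeasurable (Filter.Eventually.of_forall fun ω => ?_)
  have hlip := hF 0 (U ω)
  rw [sub_zero] at hlip
  exact (norm_le_norm_add_norm_sub' _ _).trans (add_le_add_right hlip _)

lemma IsSmooth.integrable_sub_ciInf_comp (hF : Differentiable ℝ F) (hs : IsSmooth L F)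
    (hbdd : BddBelow (Set.range F)) (hU : MemLp U 2 P) :
    Integrable (fun ω => F (U ω) - ⨅ η, F η) P := by
  have hupper : Integrable (fun ω => F 0 - (⨅ η, F η) + inner ℝ (∇ F 0) (U ω)
      + L / 2 * ‖U ω‖ ^ 2) P :=
    ((integrable_const _).add (integrable_inner_of_memLp_two (memLp_const _) hU)).add
      ((integrable_sq_norm_of_memLp_two hU).const_mul _)
  refine hupper.mono' ((hF.continuous.comp_aestronglyMeasurable hU.1).sub
    aestronglyMeasurable_const) (Filter.Eventually.of_forall fun ω => ?_)
  rw [Real.norm_of_nonneg (sub_nonneg.2 (ciInf_le hbdd _))]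
  have hdescent := hs.descent hF 0 (U ω)
  rw [sub_zero] at hdescent
  linarith

end SquareIntegrability

namespace Execution

/-! ### The mean of the honest messages and the error of the aggregation -/

variable {X : Type*} {d n m : ℕ} {ℓ : E d → X → ℝ} {D : Fin n → Fin m → X}
  {H : Finset (Fin n)} {f b : ℕ} {C : ℝ≥0∞} {sCor sInd : ℝ} {γ β : ℕ → ℝ} {θ₀ : E d} {T : ℕ}
  {Ω : Type*} {mΩ : MeasurableSpace Ω} {P : Measure Ω} {L G σ κ : ℝ}
  (ex : Execution ℓ D H f b C sCor sInd γ β θ₀ T P) {t : ℕ}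

/-- Mean of the honest messages. -/
noncomputable def meanMsg (t : ℕ) (ω : Ω) : E d :=
  weightedMean (unitWeights H) fun i => ex.msg t i ω

/-- Error of the aggregate as an approximation of the mean of the honest messages. -/
noncomputable def aggErr (t : ℕ) (ω : Ω) : E d := ex.agg t ω - ex.meanMsg t ω

/-- Deviation of the mean of the honest messages from the honest gradient. -/
noncomputable def gradErr (t : ℕ) (ω : Ω) : E d :=
  ex.meanMsg t ω - ∇ (honestLoss ℓ D H) (ex.θ t ω)

lemma meanMsg_eq (t : ℕ) (ω : Ω) :
    ex.meanMsg t ω = (H.card : ℝ)⁻¹ • ∑ i ∈ H, ex.msg t i ω := by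
  rw [meanMsg, weightedMean, sum_unitWeights, sum_unitWeights_smul]

lemma meanMsg_zero (ω : Ω) : ex.meanMsg 0 ω = 0 := by
  rw [meanMsg_eq, Finset.sum_eq_zero fun i hi => ex.msg_zero i hi ω, smul_zero]

lemma agg_eq (t : ℕ) (ω : Ω) : ex.agg t ω = ex.meanMsg t ω + ex.aggErr t ω :=
  (add_sub_cancel _ _).symm

variable (hA : IsAdmissible ℓ D H f b C L G σ)

include hA

lemma meanMsg_succ (ht : t + 1 < T) (ω : Ω) :
    ex.meanMsg (t + 1) ω = β t • ex.meanMsg t ω + (1 - β t) •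
      (∇ (honestLoss ℓ D H) (ex.θ (t + 1) ω) + ex.meanNoise (t + 1) ω) := by
  have hcard : (H.card : ℝ) ≠ 0 := by exact_mod_cast hA.card_honest_pos.ne'
  have hgrad := sum_gradient_sub (D := D) hA.card_honest_pos.ne' hA.differentiable
    (ex.θ (t + 1) ω)
  rw [Finset.sum_sub_distrib, sub_eq_zero, Finset.sum_const, ← Nat.cast_smul_eq_nsmul ℝ] at hgrad
  have hmsg : ∀ i ∈ H, ex.msg (t + 1) i ω = β t • ex.msg t i ω + (1 - β t) •
      (∇ (localLoss ℓ D i) (ex.θ (t + 1) ω)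
        + (ex.batchNoise (t + 1) i ω + ex.injectedNoise (t + 1) i ω)) := fun i hi => by
    rw [ex.msg_succ t ht i hi, batchNoise, batchError, injectedNoise]
    module
  rw [meanMsg_eq, Finset.sum_congr rfl hmsg, Finset.sum_add_distrib, ← Finset.smul_sum,
    ← Finset.smul_sum, Finset.sum_add_distrib, hgrad, meanMsg_eq, meanNoise, smul_add,
    smul_comm _ (β t), smul_comm _ (1 - β t), smul_add (H.card : ℝ)⁻¹, inv_smul_smul₀ hcard]

lemma gradErr_succ (ht : t + 1 < T) (ω : Ω) :
    ex.gradErr (t + 1) ω = β t • (ex.meanMsg t ω - ∇ (honestLoss ℓ D H) (ex.θ (t + 1) ω))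
      + (1 - β t) • ex.meanNoise (t + 1) ω := by
  rw [gradErr, ex.meanMsg_succ hA ht]
  module

lemma measurable_meanNoise (ht : t + 1 < T) :
    Measurable[ex.ℱ (t + 1)] (ex.meanNoise (t + 1)) := by
  have hsum : Measurable[ex.ℱ (t + 1)] fun ω =>
      ∑ i ∈ H, (ex.batchNoise (t + 1) i ω + ex.injectedNoise (t + 1) i ω) :=
    Finset.measurable_fun_sum _ fun i hi =>
      (ex.measurable_batchNoise_succ hA.gradients hi ht).add (ex.measurable_injectedNoise ht i)
  exact hsum.const_smul (H.card : ℝ)⁻¹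

lemma measurable_meanMsg (ht : t < T) : Measurable[ex.ℱ t] (ex.meanMsg t) := by
  induction t with
  | zero =>
    rw [show ex.meanMsg 0 = fun _ => 0 from funext ex.meanMsg_zero]
    exact measurable_const
  | succ t ih =>
    rw [show ex.meanMsg (t + 1) = _ from funext (ex.meanMsg_succ hA ht)]
    have hpast := (ih (by omega)).mono (ex.ℱ.mono (Nat.le_succ t)) le_rfl
    exact (hpast.const_smul (β t)).add ((((measurable_gradient _).comp
      (ex.measurable_θ ht.le)).add (ex.measurable_meanNoise hA ht)).const_smul (1 - β t))

lemma measurable_aggErr (ht : t < T) : Measurable[ex.ℱ t] (ex.aggErr t) :=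
  (ex.agg_measurable t ht).sub (ex.measurable_meanMsg hA ht)

variable (hκ : IsRobustnessCoefficient d n f κ)

include hκ

lemma sq_norm_aggErr_le (ht : t < T) (ω : Ω) :
    ‖ex.aggErr t ω‖ ^ 2 ≤
      κ * lambdaMax (weightedCov (unitWeights H) fun i => ex.msg t i ω) :=
  hκ.2 _ _ (ex.agg_spec t ht ω) H hA.card_honest

variable [IsProbabilityMeasure P] (hβ : ∀ t, β t ∈ Set.Icc (0 : ℝ) 1)

include hβ

lemma memLp_aggErr_and_integral_sq_norm_le (ht : t < T) {s : ℝ} (hs0 : 0 < s)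
    (hs : momentumVariance β t * (n * sCor ^ 2 + sInd ^ 2) ≤ s) :
    MemLp (ex.aggErr t) 2 P ∧ ∫ ω, ‖ex.aggErr t ω‖ ^ 2 ∂P ≤
      κ * (3 * G ^ 2 + 3 * (momentumVariance β t * batchVariance m b σ)
        + 72 * s * (1 + d / ((n : ℝ) - f))) := by
  have hmajority : n ≤ 2 * H.card := by
    have := hA.two_mul_lt
    rw [hA.card_honest]
    omega
  obtain ⟨Ψ, hΨint, hΨmean, hΨ⟩ := ex.exists_lambdaMax_msg_bound hA.gradients hA.differentiable
    hA.variance hA.one_le_batch hA.batch_le hA.card_honest_pos hmajority hβ hA.heterogeneity ht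
    hs0 hs
  rw [hA.cast_card_honest] at hΨmean
  have hle (ω : Ω) : ‖ex.aggErr t ω‖ ^ 2 ≤ κ * Ψ ω :=
    (ex.sq_norm_aggErr_le hA hκ ht ω).trans (mul_le_mul_of_nonneg_left (hΨ ω) hκ.1)
  have hmeas : AEStronglyMeasurable (ex.aggErr t) P :=
    ((ex.measurable_aggErr hA ht).mono (ex.ℱ.le t) le_rfl).aestronglyMeasurable
  have hint : Integrable (fun ω => ‖ex.aggErr t ω‖ ^ 2) P :=
    (hΨint.const_mul κ).mono' (hmeas.norm.pow 2) (Filter.Eventually.of_forall fun ω => by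
      rw [Real.norm_of_nonneg (sq_nonneg _)]
      exact hle ω)
  refine ⟨(memLp_two_iff_integrable_sq_norm hmeas).2 hint, ?_⟩
  calc ∫ ω, ‖ex.aggErr t ω‖ ^ 2 ∂P
      ≤ ∫ ω, κ * Ψ ω ∂P := integral_mono hint (hΨint.const_mul κ) hle
    _ = κ * ∫ ω, Ψ ω ∂P := integral_const_mul _ _
    _ ≤ _ := mul_le_mul_of_nonneg_left hΨmean hκ.1

lemma memLp_aggErr (ht : t < T) : MemLp (ex.aggErr t) 2 P :=
  (ex.memLp_aggErr_and_integral_sq_norm_le hA hκ hβ ht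
    (s := |momentumVariance β t * (n * sCor ^ 2 + sInd ^ 2)| + 1) (by positivity)
    ((le_abs_self _).trans (by linarith))).1

lemma integral_sq_norm_aggErr_le (ht : t < T) :
    ∫ ω, ‖ex.aggErr t ω‖ ^ 2 ∂P ≤ 3 * κ * G ^ 2
      + 3 / 4 * momentumVariance β t * totalVariance d n m f b κ σ sCor sInd := by
  set ν := momentumVariance β t
  set Λ : ℝ := n * sCor ^ 2 + sInd ^ 2
  set a : ℝ := 1 + d / ((n : ℝ) - f)
  have hν : 0 ≤ ν := momentumVariance_nonneg β t
  have hΛ : 0 ≤ Λ := by positivity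
  have ha : 0 ≤ a := by
    have hsub : (0 : ℝ) ≤ n - f := sub_nonneg.2 (by exact_mod_cast hA.le_workers)
    positivity
  -- The uniform bound needs a positive variance proxy, while `ν * Λ` may vanish.
  have hlim : ∫ ω, ‖ex.aggErr t ω‖ ^ 2 ∂P ≤
      κ * (3 * G ^ 2 + 3 * (ν * batchVariance m b σ) + 72 * (ν * Λ) * a) := by
    have hcont : Continuous fun s =>
        κ * (3 * G ^ 2 + 3 * (ν * batchVariance m b σ) + 72 * s * a) := by fun_prop
    refine ge_of_tendsto (hcont.continuousWithinAt (s := Set.Ioi (ν * Λ))).tendsto ?_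
    filter_upwards [self_mem_nhdsWithin] with s hs
    exact (ex.memLp_aggErr_and_integral_sq_norm_le hA hκ hβ ht
      ((mul_nonneg hν hΛ).trans_lt hs) (le_of_lt hs)).2
  have hdev := mul_le_mul_of_nonneg_left
    (deviation_le_totalVariance hA.le_workers hA.batch_le d κ σ sCor sInd) hν
  have hnoise : 0 ≤ κ * (ν * Λ * a) := mul_nonneg hκ.1 (by positivity)
  linarith

lemma memLp_θ_and_meanMsg (ht : t < T) : MemLp (ex.θ t) 2 P ∧ MemLp (ex.meanMsg t) 2 P := by
  induction t with
  | zero =>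
    rw [show ex.θ 0 = fun _ => θ₀ from funext ex.θ_zero,
      show ex.meanMsg 0 = fun _ => 0 from funext ex.meanMsg_zero]
    exact ⟨memLp_const _, memLp_const _⟩
  | succ t ih =>
    have htT : t < T := by omega
    obtain ⟨hθ, hmean⟩ := ih htT
    have hθ' : MemLp (ex.θ (t + 1)) 2 P := by
      rw [show ex.θ (t + 1) = _ from funext (ex.θ_succ t htT),
        show ex.agg t = _ from funext (ex.agg_eq t)]
      exact hθ.sub ((hmean.add (ex.memLp_aggErr hA hκ hβ htT)).const_smul (γ t))
    have hnoise := (ex.isCentered_meanNoise hA.gradients hA.differentiable hA.variance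
      hA.one_le_batch hA.batch_le ht).1
    refine ⟨hθ', ?_⟩
    rw [show ex.meanMsg (t + 1) = _ from funext (ex.meanMsg_succ hA ht)]
    exact (hmean.const_smul (β t)).add
      (((hA.smooth.memLp_gradient_comp hθ').add hnoise).const_smul (1 - β t))

lemma memLp_agg (ht : t < T) : MemLp (ex.agg t) 2 P := by
  rw [show ex.agg t = _ from funext (ex.agg_eq t)]
  exact (ex.memLp_θ_and_meanMsg hA hκ hβ ht).2.add (ex.memLp_aggErr hA hκ hβ ht)

lemma memLp_θ (ht : t ≤ T) : MemLp (ex.θ t) 2 P := by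
  cases t with
  | zero =>
    rw [show ex.θ 0 = fun _ => θ₀ from funext ex.θ_zero]
    exact memLp_const _
  | succ t =>
    rw [show ex.θ (t + 1) = _ from funext (ex.θ_succ t (by omega))]
    exact (ex.memLp_θ_and_meanMsg hA hκ hβ (by omega)).1.sub
      ((ex.memLp_agg hA hκ hβ (by omega)).const_smul (γ t))

lemma memLp_gradErr (ht : t < T) : MemLp (ex.gradErr t) 2 P := by
  obtain ⟨hθ, hmean⟩ := ex.memLp_θ_and_meanMsg hA hκ hβ ht
  exact hmean.sub (hA.smooth.memLp_gradient_comp hθ)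

lemma integrable_excess (hbdd : BddBelow (Set.range (honestLoss ℓ D H))) (ht : t ≤ T) :
    Integrable (fun ω => honestLoss ℓ D H (ex.θ t ω) - ⨅ η, honestLoss ℓ D H η) P :=
  hA.smooth.integrable_sub_ciInf_comp hA.differentiable_loss hbdd (ex.memLp_θ hA hκ hβ ht)

end Execution

/-! ### One step of momentum descent -/

section Step

variable {d : ℕ} {L : ℝ} {F : E d → ℝ} {γ : ℝ}

/-- Descent for the step `R = M + ξ`, where `M` estimates the gradient and `ξ` is the error of the
aggregation. -/
lemma IsSmooth.descent_step (hF : Differentiable ℝ F) (h : IsSmooth L F) (hγ : 0 ≤ γ)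
    (θ M ξ : E d) :
    F (θ - γ • (M + ξ)) ≤ F θ - γ / 2 * ‖∇ F θ‖ ^ 2 - γ / 2 * (1 - L * γ) * ‖M + ξ‖ ^ 2
      + γ * ‖M - ∇ F θ‖ ^ 2 + γ * ‖ξ‖ ^ 2 := by
  have hdescent := h.descent hF θ (θ - γ • (M + ξ))
  rw [sub_sub_cancel_left, inner_neg_right, real_inner_smul_right, norm_neg, norm_smul,
    Real.norm_of_nonneg hγ] at hdescent
  have hpolar := norm_sub_sq_real (∇ F θ) (M + ξ)
  have herror : ‖∇ F θ - (M + ξ)‖ ^ 2 ≤ 2 * ‖M - ∇ F θ‖ ^ 2 + 2 * ‖ξ‖ ^ 2 := by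
    rw [← norm_neg, show -(∇ F θ - (M + ξ)) = (M - ∇ F θ) + ξ by abel, ← mul_add]
    exact (pow_le_pow_left₀ (norm_nonneg _) (norm_add_le _ _) 2).trans (add_sq_le ..)
  rw [hpolar, inner_add_right] at herror
  rw [inner_add_right] at hdescent
  linarith [mul_le_mul_of_nonneg_left herror hγ]

lemma IsSmooth.sq_norm_momentum_drift_le (h : IsSmooth L F) (hγ : 0 ≤ γ) (hL : 0 ≤ L)
    (hγL : 24 * L * γ ≤ 1) (θ M R : E d) :
    ‖(1 - 24 * L * γ) • (M - ∇ F (θ - γ • R))‖ ^ 2 ≤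
      (1 - 24 * L * γ) * ‖M - ∇ F θ‖ ^ 2 + L * γ / 24 * ‖R‖ ^ 2 := by
  set w := 1 - 24 * L * γ
  have hw : w ∈ Set.Icc (0 : ℝ) 1 := ⟨sub_nonneg.2 hγL, sub_le_self _ (by positivity)⟩
  have hlip : ‖∇ F (θ - γ • R) - ∇ F θ‖ ≤ (1 - w) * (‖R‖ / 24) := by
    have hstep := h θ (θ - γ • R)
    rw [sub_sub_cancel_left, norm_neg, norm_smul, Real.norm_of_nonneg hγ] at hstep
    exact hstep.trans_eq (by ring)
  have hdrift : w * ‖M - ∇ F (θ - γ • R)‖ ≤ w * ‖M - ∇ F θ‖ + (1 - w) * (‖R‖ / 24) := by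
    have htriangle := norm_sub_le (M - ∇ F θ) (∇ F (θ - γ • R) - ∇ F θ)
    rw [sub_sub_sub_cancel_right] at htriangle
    calc w * ‖M - ∇ F (θ - γ • R)‖
        ≤ w * (‖M - ∇ F θ‖ + (1 - w) * (‖R‖ / 24)) :=
          mul_le_mul_of_nonneg_left (htriangle.trans (add_le_add_right hlip _)) hw.1
      _ ≤ w * ‖M - ∇ F θ‖ + (1 - w) * (‖R‖ / 24) := by
          rw [mul_add]
          exact add_le_add_right (mul_le_of_le_one_left
            (mul_nonneg (sub_nonneg.2 hw.2) (by positivity)) hw.2) _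
  rw [norm_smul, Real.norm_of_nonneg hw.1]
  calc (w * ‖M - ∇ F (θ - γ • R)‖) ^ 2
      ≤ (w * ‖M - ∇ F θ‖ + (1 - w) * (‖R‖ / 24)) ^ 2 :=
        pow_le_pow_left₀ (mul_nonneg hw.1 (norm_nonneg _)) hdrift 2
    _ ≤ w * ‖M - ∇ F θ‖ ^ 2 + (1 - w) * (‖R‖ / 24) ^ 2 := sq_convex_combination_le hw _ _
    _ = w * ‖M - ∇ F θ‖ ^ 2 + L * γ / 24 * ‖R‖ ^ 2 := by ring

end Step

/-- Step sizes `γ` and momentum coefficients `β`, coupled so that the error of the momentum decays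
at a rate proportional to the step size. -/
structure IsStepSchedule (L : ℝ) (γ β : ℕ → ℝ) : Prop where
  nonneg : ∀ t, 0 ≤ γ t
  mul_le_one : ∀ t, 24 * L * γ t ≤ 1
  momentum_eq : ∀ t, β t = 1 - 24 * L * γ t

lemma IsStepSchedule.momentum_mem_Icc {L : ℝ} {γ β : ℕ → ℝ} (h : IsStepSchedule L γ β)
    (hL : 0 ≤ L) (t : ℕ) : β t ∈ Set.Icc (0 : ℝ) 1 := by
  rw [h.momentum_eq]
  exact ⟨sub_nonneg.2 (h.mul_le_one t),
    sub_le_self _ (mul_nonneg (mul_nonneg (by norm_num) hL) (h.nonneg t))⟩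

namespace Execution

/-! ### Evolution of the expected loss and of the gradient error -/

variable {X : Type*} {d n m : ℕ} {ℓ : E d → X → ℝ} {D : Fin n → Fin m → X}
  {H : Finset (Fin n)} {f b : ℕ} {C : ℝ≥0∞} {sCor sInd : ℝ} {γ β : ℕ → ℝ} {θ₀ : E d} {T : ℕ}
  {Ω : Type*} {mΩ : MeasurableSpace Ω} {P : Measure Ω} {L G σ κ : ℝ}
  (ex : Execution ℓ D H f b C sCor sInd γ β θ₀ T P)

/-- Expected excess loss. -/
noncomputable def excess (t : ℕ) : ℝ :=
  ∫ ω, (honestLoss ℓ D H (ex.θ t ω) - ⨅ η, honestLoss ℓ D H η) ∂P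

/-- Expected squared norm of the honest gradient. -/
noncomputable def gradSq (t : ℕ) : ℝ := ∫ ω, ‖∇ (honestLoss ℓ D H) (ex.θ t ω)‖ ^ 2 ∂P

/-- Expected squared norm of the aggregate. -/
noncomputable def aggSq (t : ℕ) : ℝ := ∫ ω, ‖ex.agg t ω‖ ^ 2 ∂P

/-- Expected squared norm of the gradient error. -/
noncomputable def gradErrSq (t : ℕ) : ℝ := ∫ ω, ‖ex.gradErr t ω‖ ^ 2 ∂P

/-- Lyapunov function: expected excess loss plus a multiple of the gradient error, the latter
counted as long as the workers send messages. -/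
noncomputable def lyapunov (L : ℝ) (t : ℕ) : ℝ :=
  ex.excess t + if t < T then ex.gradErrSq t / (8 * L) else 0

lemma excess_nonneg (hbdd : BddBelow (Set.range (honestLoss ℓ D H))) (t : ℕ) :
    0 ≤ ex.excess t :=
  integral_nonneg fun _ => sub_nonneg.2 (ciInf_le hbdd _)

lemma aggSq_nonneg (t : ℕ) : 0 ≤ ex.aggSq t := integral_nonneg fun _ => sq_nonneg _

lemma gradErrSq_nonneg (t : ℕ) : 0 ≤ ex.gradErrSq t := integral_nonneg fun _ => sq_nonneg _

lemma excess_le_lyapunov (hL : 0 ≤ L) (t : ℕ) : ex.excess t ≤ ex.lyapunov L t := by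
  have hgradErr := ex.gradErrSq_nonneg t
  refine le_add_of_nonneg_right ?_
  split_ifs <;> positivity

variable [IsProbabilityMeasure P]

lemma excess_zero : ex.excess 0 = honestLoss ℓ D H θ₀ - ⨅ η, honestLoss ℓ D H η := by
  simp only [excess, ex.θ_zero, integral_const, probReal_univ, one_smul]

variable (hA : IsAdmissible ℓ D H f b C L G σ)

include hA

lemma gradErrSq_zero_le (hbdd : BddBelow (Set.range (honestLoss ℓ D H))) :
    ex.gradErrSq 0 ≤ 2 * L * ex.excess 0 := by
  rw [excess_zero]
  simp only [gradErrSq, gradErr, meanMsg_zero, ex.θ_zero, zero_sub, norm_neg, integral_const,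
    probReal_univ, one_smul]
  exact hA.smooth.sq_norm_gradient_le hA.pos hA.differentiable_loss hbdd θ₀

lemma lyapunov_zero_le (hbdd : BddBelow (Set.range (honestLoss ℓ D H))) :
    ex.lyapunov L 0 ≤ 5 / 4 * (honestLoss ℓ D H θ₀ - ⨅ η, honestLoss ℓ D H η) := by
  have hL := hA.pos
  have hexcess := ex.excess_nonneg hbdd 0
  have hgradErr : ex.gradErrSq 0 / (8 * L) ≤ ex.excess 0 / 4 := by
    rw [div_le_iff₀ (by positivity)]
    linarith [ex.gradErrSq_zero_le hA hbdd]
  rw [← ex.excess_zero, lyapunov]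
  split_ifs <;> linarith

lemma integral_sq_norm_smul_meanNoise_le (hκ : 0 ≤ κ) {t : ℕ} (ht : t + 1 < T) (a : ℝ) :
    ∫ ω, ‖a • ex.meanNoise (t + 1) ω‖ ^ 2 ∂P ≤
      a ^ 2 * totalVariance d n m f b κ σ sCor sInd := by
  have hnoise := ex.integral_sq_norm_meanNoise_le hA.gradients hA.differentiable hA.variance
    hA.one_le_batch hA.batch_le ht
  rw [hA.cast_card_honest, sub_sub_cancel] at hnoise
  simp only [norm_smul, mul_pow, integral_const_mul, Real.norm_eq_abs, sq_abs]
  exact mul_le_mul_of_nonneg_left (hnoise.trans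
    (mean_noise_le_totalVariance hA.le_workers hA.batch_le hκ d σ sCor sInd)) (sq_nonneg a)

variable (hκ : IsRobustnessCoefficient d n f κ)

include hκ

lemma excess_succ_le (hβ : ∀ t, β t ∈ Set.Icc (0 : ℝ) 1)
    (hbdd : BddBelow (Set.range (honestLoss ℓ D H))) {t : ℕ} (hγ : 0 ≤ γ t) (ht : t < T) :
    ex.excess (t + 1) ≤ ex.excess t - γ t / 2 * ex.gradSq t
      - γ t / 2 * (1 - L * γ t) * ex.aggSq t + γ t * ex.gradErrSq t
      + γ t * (3 * κ * G ^ 2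
        + 3 / 4 * momentumVariance β t * totalVariance d n m f b κ σ sCor sInd) := by
  have hint' := ex.integrable_excess hA hκ hβ hbdd (show t + 1 ≤ T from ht)
  have hint := ex.integrable_excess hA hκ hβ hbdd ht.le
  have hgrad := (integrable_sq_norm_of_memLp_two
    (hA.smooth.memLp_gradient_comp (ex.memLp_θ hA hκ hβ ht.le))).const_mul (γ t / 2)
  have hagg := (integrable_sq_norm_of_memLp_two (ex.memLp_agg hA hκ hβ ht)).const_mul
    (γ t / 2 * (1 - L * γ t))
  have hgradErr := (integrable_sq_norm_of_memLp_two (ex.memLp_gradErr hA hκ hβ ht)).const_mul (γ t)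
  have haggErr := (integrable_sq_norm_of_memLp_two (ex.memLp_aggErr hA hκ hβ ht)).const_mul (γ t)
  have hstep := integral_mono hint' ((((hint.sub hgrad).sub hagg).add hgradErr).add haggErr)
    fun ω => by
      have hdescent := hA.smooth.descent_step hA.differentiable_loss hγ (ex.θ t ω)
        (ex.meanMsg t ω) (ex.aggErr t ω)
      rw [← ex.agg_eq, ← ex.θ_succ t ht, ← gradErr] at hdescent
      simp only [Pi.add_apply, Pi.sub_apply]
      linarith
  rw [integral_add' (((hint.sub hgrad).sub hagg).add hgradErr) haggErr,
    integral_add' ((hint.sub hgrad).sub hagg) hgradErr, integral_sub' (hint.sub hgrad) hagg,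
    integral_sub' hint hgrad] at hstep
  simp only [integral_const_mul] at hstep
  have haggErr_le := mul_le_mul_of_nonneg_left (ex.integral_sq_norm_aggErr_le hA hκ hβ ht) hγ
  simp only [excess, gradSq, aggSq, gradErrSq]
  linarith

variable (hsched : IsStepSchedule L γ β)

include hsched

lemma integral_sq_norm_momentum_drift_le {t : ℕ} (ht : t < T) :
    ∫ ω, ‖β t • (ex.meanMsg t ω - ∇ (honestLoss ℓ D H) (ex.θ (t + 1) ω))‖ ^ 2 ∂P ≤
      (1 - 24 * L * γ t) * ex.gradErrSq t + L * γ t / 24 * ex.aggSq t := by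
  have hβ := hsched.momentum_mem_Icc hA.pos.le
  have hgradErr := (integrable_sq_norm_of_memLp_two (ex.memLp_gradErr hA hκ hβ ht)).const_mul
    (1 - 24 * L * γ t)
  have hagg := (integrable_sq_norm_of_memLp_two (ex.memLp_agg hA hκ hβ ht)).const_mul
    (L * γ t / 24)
  rw [gradErrSq, aggSq, ← integral_const_mul, ← integral_const_mul,
    ← integral_add hgradErr hagg]
  refine integral_mono_of_nonneg (Filter.Eventually.of_forall fun _ => sq_nonneg _)
    (hgradErr.add hagg) (Filter.Eventually.of_forall fun ω => ?_)
  have hdrift := hA.smooth.sq_norm_momentum_drift_le (hsched.nonneg t) hA.pos.le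
    (hsched.mul_le_one t) (ex.θ t ω) (ex.meanMsg t ω) (ex.agg t ω)
  rw [← ex.θ_succ t ht] at hdrift
  simpa only [hsched.momentum_eq t, gradErr] using hdrift

lemma gradErrSq_succ_le {t : ℕ} (ht : t + 1 < T) :
    ex.gradErrSq (t + 1) ≤ (1 - 24 * L * γ t) * ex.gradErrSq t + L * γ t / 24 * ex.aggSq t
      + (24 * L * γ t) ^ 2 * totalVariance d n m f b κ σ sCor sInd := by
  have hβ := hsched.momentum_mem_Icc hA.pos.le
  have htT : t < T := by omega
  have hnoise := (ex.isCentered_meanNoise hA.gradients hA.differentiable hA.variance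
    hA.one_le_batch hA.batch_le ht).smul (1 - β t)
  have hmeas : Measurable[ex.ℱ t] fun ω =>
      β t • (ex.meanMsg t ω - ∇ (honestLoss ℓ D H) (ex.θ (t + 1) ω)) :=
    ((ex.measurable_meanMsg hA htT).sub
      ((measurable_gradient _).comp (ex.measurable_θ_succ htT))).const_smul (β t)
  have hmemLp : MemLp (fun ω =>
      β t • (ex.meanMsg t ω - ∇ (honestLoss ℓ D H) (ex.θ (t + 1) ω))) 2 P :=
    ((ex.memLp_θ_and_meanMsg hA hκ hβ htT).2.sub (hA.smooth.memLp_gradient_comp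
      (ex.memLp_θ hA hκ hβ ht.le))).const_smul (β t)
  simp only [gradErrSq, ex.gradErr_succ hA ht]
  rw [hnoise.integral_sq_norm_add hmeas hmemLp]
  refine add_le_add (ex.integral_sq_norm_momentum_drift_le hA hκ hsched htT) ?_
  have hnoise_le := ex.integral_sq_norm_smul_meanNoise_le hA hκ.1 ht (1 - β t)
  rwa [hsched.momentum_eq, sub_sub_cancel] at hnoise_le ⊢

lemma lyapunov_succ_le (hbdd : BddBelow (Set.range (honestLoss ℓ D H))) {t : ℕ} (ht : t < T) :
    ex.lyapunov L (t + 1) ≤ ex.lyapunov L t - γ t / 2 * ex.gradSq t - 2 * γ t * ex.gradErrSq t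
      + 3 * γ t * κ * G ^ 2
      + (3 / 4 * γ t * momentumVariance β t + 72 * L * γ t ^ 2)
        * totalVariance d n m f b κ σ sCor sInd := by
  have hL := hA.pos
  have hγL := hsched.mul_le_one t
  have hV := totalVariance_nonneg hA.le_workers hA.batch_le hκ.1 d σ sCor sInd
  have hexcess := ex.excess_succ_le hA hκ (hsched.momentum_mem_Icc hL.le) hbdd
    (hsched.nonneg t) ht
  have hagg : 0 ≤ γ t * ex.aggSq t := mul_nonneg (hsched.nonneg t) (ex.aggSq_nonneg t)
  have hslack : 0 ≤ γ t * ex.aggSq t * (1 / 2 - L * γ t / 2 - 1 / 192) :=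
    mul_nonneg hagg (by linarith)
  set V := totalVariance d n m f b κ σ sCor sInd
  simp only [lyapunov]
  rw [if_pos ht]
  split_ifs with hlt
  · have hgradErr : ex.gradErrSq (t + 1) / (8 * L) ≤ ex.gradErrSq t / (8 * L)
        - 3 * γ t * ex.gradErrSq t + γ t / 192 * ex.aggSq t + 72 * L * γ t ^ 2 * V := by
      rw [div_le_iff₀ (by positivity)]
      refine (ex.gradErrSq_succ_le hA hκ hsched hlt).trans (le_of_eq ?_)
      field_simp
      ring
    linarith
  · have hgradErr : 3 * γ t * ex.gradErrSq t ≤ ex.gradErrSq t / (8 * L) := by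
      rw [le_div_iff₀ (by positivity)]
      linarith [mul_le_mul_of_nonneg_right hγL (ex.gradErrSq_nonneg t)]
    have hnoise : 0 ≤ 72 * L * γ t ^ 2 * V := by positivity
    linarith

end Execution

/-! ### Step sizes and recursions -/

section Recursions

variable {β : ℕ → ℝ}

lemma momentumVariance_le_of_const {η : ℝ} (hη : η ∈ Set.Icc (0 : ℝ) 1) (hβ : ∀ t, β t = 1 - η)
    (t : ℕ) : momentumVariance β t ≤ η := by
  induction t with
  | zero => exact hη.1
  | succ t ih =>
    have hgain : 0 ≤ η ^ 2 * (1 - η) := mul_nonneg (sq_nonneg η) (sub_nonneg.2 hη.2)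
    rw [momentumVariance, hβ]
    calc (1 - η) ^ 2 * momentumVariance β t + (1 - (1 - η)) ^ 2
        ≤ (1 - η) ^ 2 * η + (1 - (1 - η)) ^ 2 := by gcongr
      _ = η - η ^ 2 * (1 - η) := by ring
      _ ≤ η := sub_le_self _ hgain

variable {K : ℝ}

lemma div_sub_sq_div_le_div_succ (hK : 2 ≤ K) {x : ℝ} (hx : 0 < x) :
    2 * (K / x) - (K / x) ^ 2 ≤ 2 * (K / (x + 1)) := by
  have hgap : 0 ≤ K * (K * (x + 1) - 2 * x) / (x ^ 2 * (x + 1)) := by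
    have hnum : 0 ≤ K * (x + 1) - 2 * x := by
      linarith [mul_le_mul_of_nonneg_right hK (show 0 ≤ x + 1 by linarith)]
    positivity
  have hdiff : 2 * (K / (x + 1)) - (2 * (K / x) - (K / x) ^ 2) =
      K * (K * (x + 1) - 2 * x) / (x ^ 2 * (x + 1)) := by
    field_simp
    ring
  linarith

lemma momentumVariance_le_of_harmonic (hK : 2 ≤ K) (hβ : ∀ t : ℕ, β t = 1 - K / (t + K)) (t : ℕ) :
    momentumVariance β t ≤ 2 * (K / (t + K)) := by
  induction t with
  | zero => rw [momentumVariance]; positivity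
  | succ t ih =>
    have ht : (0 : ℝ) < t + K := by positivity
    have hsucc := div_sub_sq_div_le_div_succ hK ht
    have hη : K / (t + K) ≤ 1 := (div_le_one ht).2 (le_add_of_nonneg_left t.cast_nonneg)
    rw [momentumVariance, hβ, show ((t + 1 : ℕ) : ℝ) + K = t + K + 1 by push_cast; ring]
    set η := K / (t + K)
    have hgain : 0 ≤ η ^ 2 * (1 - η) := mul_nonneg (sq_nonneg η) (sub_nonneg.2 hη)
    calc (1 - η) ^ 2 * momentumVariance β t + (1 - (1 - η)) ^ 2
        ≤ (1 - η) ^ 2 * (2 * η) + (1 - (1 - η)) ^ 2 := by gcongr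
      _ = 2 * η - η ^ 2 - 2 * (η ^ 2 * (1 - η)) := by ring
      _ ≤ 2 * (K / (t + K + 1)) := by linarith

lemma one_div_sub_one_div_sq_le {k : ℝ} (hk : 0 < k) : 1 / k - 1 / k ^ 2 ≤ 1 / (k + 1) := by
  have hdiff : 1 / (k + 1) - (1 / k - 1 / k ^ 2) = 1 / (k ^ 2 * (k + 1)) := by
    field_simp
    ring
  have hgap : 0 ≤ 1 / (k ^ 2 * (k + 1)) := by positivity
  linarith

lemma one_sub_ten_div_mul_one_div_sq_le {k : ℝ} (hk : 0 < k) :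
    (1 - 10 / k) * (1 / k ^ 2) ≤ 1 / (k + 1) ^ 2 := by
  have hdiff : 1 / (k + 1) ^ 2 - (1 - 10 / k) * (1 / k ^ 2) =
      (8 * k ^ 2 + 19 * k + 10) / (k ^ 3 * (k + 1) ^ 2) := by
    field_simp
    ring
  have hgap : 0 ≤ (8 * k ^ 2 + 19 * k + 10) / (k ^ 3 * (k + 1) ^ 2) := by positivity
  linarith

lemma le_of_harmonic_recursion {V : ℕ → ℝ} {A B D : ℝ} {T : ℕ} (hK : 10 ≤ K) (hB : 0 ≤ B)
    (hD : 0 ≤ D) (h0 : V 0 ≤ A + B / K + D / K ^ 2)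
    (h : ∀ t < T, V (t + 1) ≤ (1 - 10 / (t + K)) * V t + 10 / (t + K) * A
      + 9 * B / (t + K) ^ 2) {t : ℕ} (ht : t ≤ T) :
    V t ≤ A + B / (t + K) + D / (t + K) ^ 2 := by
  induction t with
  | zero => simpa only [Nat.cast_zero, zero_add] using h0
  | succ t ih =>
    have hstep := h t ht
    have hprev := ih (by omega)
    have hk : 10 ≤ (t : ℝ) + K := hK.trans (le_add_of_nonneg_left t.cast_nonneg)
    rw [show ((t + 1 : ℕ) : ℝ) + K = t + K + 1 by push_cast; ring]
    generalize (t : ℝ) + K = k at *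
    have hk0 : 0 < k := by linarith
    calc V (t + 1)
        ≤ (1 - 10 / k) * V t + 10 / k * A + 9 * B / k ^ 2 := hstep
      _ ≤ (1 - 10 / k) * (A + B / k + D / k ^ 2) + 10 / k * A + 9 * B / k ^ 2 := by
          have hweight : 0 ≤ 1 - 10 / k := sub_nonneg.2 ((div_le_one hk0).2 hk)
          gcongr
      _ = A + B * (1 / k - 1 / k ^ 2) + D * ((1 - 10 / k) * (1 / k ^ 2)) := by ring
      _ ≤ A + B * (1 / (k + 1)) + D * (1 / (k + 1) ^ 2) := by
          have hB' := one_div_sub_one_div_sq_le hk0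
          have hD' := one_sub_ten_div_mul_one_div_sq_le hk0
          gcongr
      _ = A + B / (k + 1) + D / (k + 1) ^ 2 := by ring

end Recursions

section ConstantStep

variable {L L₀ s : ℝ} {T : ℕ}

lemma constantStep_nonneg (hL : 0 ≤ L) (L₀ : ℝ) (hs : 0 ≤ s) (T : ℕ) :
    0 ≤ constantStep L L₀ s T := by
  rw [constantStep]
  split_ifs <;> positivity

lemma constantStep_le (L L₀ s : ℝ) (T : ℕ) : constantStep L L₀ s T ≤ 1 / (24 * L) := by
  rw [constantStep]
  split_ifs
  · exact le_rfl
  · exact min_le_left _ _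

lemma constantStep_le_of_ne_zero (L L₀ : ℝ) (hs : s ≠ 0) (T : ℕ) :
    constantStep L L₀ s T ≤ √(270 * L₀) / (2 * s * √(5760 * L * T)) := by
  rw [constantStep, if_neg hs]
  exact min_le_right _ _

lemma eq_zero_of_constantStep_eq_zero (hL : 0 < L) (hT : 1 ≤ T) (hL₀ : 0 ≤ L₀)
    (h : constantStep L L₀ s T = 0) : L₀ = 0 := by
  have hT0 : (0 : ℝ) < T := by exact_mod_cast hT
  have hcap : 1 / (24 * L) ≠ 0 := by positivity
  rw [constantStep] at h
  split_ifs at h with hs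
  · exact absurd h hcap
  have hden : 2 * s * √(5760 * L * T) ≠ 0 := by positivity
  rcases min_choice (1 / (24 * L)) (√(270 * L₀) / (2 * s * √(5760 * L * T))) with hmin | hmin <;>
    rw [hmin] at h
  · exact absurd h hcap
  · rw [div_eq_zero_iff, or_iff_left hden, Real.sqrt_eq_zero (by positivity)] at h
    linarith

lemma one_div_constantStep_le (hL : 0 ≤ L) (L₀ : ℝ) (hs : 0 < s) (T : ℕ) :
    1 / constantStep L L₀ s T ≤ 24 * L + 2 * s * √(5760 * L * T) / √(270 * L₀) := by
  rw [constantStep, if_neg hs.ne']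
  rcases min_choice (1 / (24 * L)) (√(270 * L₀) / (2 * s * √(5760 * L * T))) with hmin | hmin <;>
    rw [hmin, one_div_div]
  · rw [div_one]
    exact le_add_of_nonneg_right (by positivity)
  · exact le_add_of_nonneg_left (by positivity)

lemma sqrt_mul_div_sqrt_eq (hL : 0 ≤ L) (hL₀ : 0 ≤ L₀) (hT : 1 ≤ T) (s : ℝ) :
    √(5760 * 270 * L * L₀) * s / √T = √(270 * L₀) * √(5760 * L * T) * s / T := by
  have hT0 : (0 : ℝ) < T := by exact_mod_cast hT
  have hsqrt : √(270 * L₀) * √(5760 * L * T) = √(5760 * 270 * L * L₀) * √T := by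
    rw [← Real.sqrt_mul (by positivity), ← Real.sqrt_mul (by positivity)]
    congr 1
    ring
  rw [hsqrt, div_eq_div_iff (by positivity) hT0.ne']
  linear_combination (-√(5760 * 270 * L * L₀) * s) * Real.mul_self_sqrt hT0.le

lemma initial_term_le (hL : 0 < L) (hL₀ : 0 < L₀) (T : ℕ) (hs : 0 < s) :
    5 / 2 * L₀ / (constantStep L L₀ s T * T) ≤
      60 * L * L₀ / T + 5 / 270 * (√(270 * L₀) * √(5760 * L * T) * s / T) := by
  set p := √(270 * L₀)
  have hp : 0 < p := Real.sqrt_pos.2 (by positivity)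
  have hp2 : L₀ = p ^ 2 / 270 := by
    rw [Real.sq_sqrt (by positivity), mul_div_cancel_left₀ _ (by norm_num)]
  calc 5 / 2 * L₀ / (constantStep L L₀ s T * T)
      = 5 / 2 * L₀ / T * (1 / constantStep L L₀ s T) := by ring
    _ ≤ 5 / 2 * L₀ / T * (24 * L + 2 * s * √(5760 * L * T) / p) :=
      mul_le_mul_of_nonneg_left (one_div_constantStep_le hL.le L₀ hs T) (by positivity)
    _ = 60 * L * L₀ / T + 5 * L₀ / p * (√(5760 * L * T) * s / T) := by ring
    _ = 60 * L * L₀ / T + 5 / 270 * (p * √(5760 * L * T) * s / T) := by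
      have hquot : 5 * L₀ / p = 5 / 270 * p := by
        nth_rewrite 1 [hp2]
        field_simp
      rw [hquot]
      ring

lemma variance_term_le (hL : 0 < L) (L₀ : ℝ) (hT : 1 ≤ T) (hs : 0 < s) :
    180 * L * constantStep L L₀ s T * s ^ 2 ≤
      90 / 5760 * (√(270 * L₀) * √(5760 * L * T) * s / T) := by
  have hT0 : (0 : ℝ) < T := by exact_mod_cast hT
  have hstep := constantStep_le_of_ne_zero L L₀ hs.ne' T
  set q := √(5760 * L * T)
  have hq : 0 < q := Real.sqrt_pos.2 (mul_pos (by positivity) hT0)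
  have hq2 : q ^ 2 = 5760 * L * T := Real.sq_sqrt (by positivity)
  calc 180 * L * constantStep L L₀ s T * s ^ 2
      ≤ 180 * L * (√(270 * L₀) / (2 * s * q)) * s ^ 2 := by gcongr
    _ = 90 / 5760 * (5760 * L * T) * √(270 * L₀) * s / (q * T) := by
      field_simp
      ring
    _ = 90 / 5760 * (√(270 * L₀) * q * s / T) := by
      rw [← hq2]
      field_simp

lemma constantStep_bound (hL : 0 < L) (hT : 1 ≤ T) (hL₀ : 0 ≤ L₀) (hs : 0 ≤ s)
    (hpos : 0 < constantStep L L₀ s T) :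
    5 / 2 * L₀ / (constantStep L L₀ s T * T) + 180 * L * constantStep L L₀ s T * s ^ 2 ≤
      √(5760 * 270 * L * L₀) * s / √T + 270 * L * L₀ / T := by
  have hslack : 60 * L * L₀ / T ≤ 270 * L * L₀ / T := by gcongr; norm_num
  rcases hs.eq_or_lt with rfl | hs
  · rw [constantStep, if_pos rfl]
    calc 5 / 2 * L₀ / (1 / (24 * L) * T) + 180 * L * (1 / (24 * L)) * 0 ^ 2
        = 60 * L * L₀ / T := by
          field_simp
          ring
      _ ≤ √(5760 * 270 * L * L₀) * 0 / √T + 270 * L * L₀ / T := by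
          rwa [mul_zero, zero_div, zero_add]
  have hL₀pos : 0 < L₀ := hL₀.lt_of_ne' fun hzero => hpos.not_ge <| by
    simpa only [hzero, mul_zero, Real.sqrt_zero, zero_div] using
      constantStep_le_of_ne_zero L L₀ hs.ne' T
  have hinitial := initial_term_le hL hL₀pos T hs
  have hvariance := variance_term_le hL L₀ hT hs
  have hmain : 0 ≤ √(270 * L₀) * √(5760 * L * T) * s / T := by positivity
  rw [sqrt_mul_div_sqrt_eq hL.le hL₀ hT]
  linarith

end ConstantStep

/-! ### Convergence -/

section Schedules

variable {L : ℝ} {γ β : ℕ → ℝ}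

lemma harmonicStep_eq {μ : ℝ} (hL : L ≠ 0) (hμ : μ ≠ 0) (t : ℝ) :
    24 * L * (10 / (μ * (t + 240 * (L / μ)))) = 240 * (L / μ) / (t + 240 * (L / μ)) := by
  field_simp
  ring

lemma isStepSchedule_harmonic {μ : ℝ} (hL : 0 < L) (hμ : 0 < μ)
    (hγ : ∀ t, γ t = 10 / (μ * (t + 240 * (L / μ)))) (hβ : ∀ t, β t = 1 - 24 * L * γ t) :
    IsStepSchedule L γ β where
  nonneg t := by
    rw [hγ]
    positivity
  mul_le_one t := by
    have hden : 0 < (t : ℝ) + 240 * (L / μ) := by positivity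
    rw [hγ, harmonicStep_eq hL.ne' hμ.ne', div_le_one hden]
    exact le_add_of_nonneg_left t.cast_nonneg
  momentum_eq := hβ

lemma isStepSchedule_constantStep {L₀ s : ℝ} {T : ℕ} (hL : 0 < L) (hs : 0 ≤ s)
    (hγ : ∀ t, γ t = constantStep L L₀ s T) (hβ : ∀ t, β t = 1 - 24 * L * γ t) :
    IsStepSchedule L γ β where
  nonneg t := (hγ t).symm ▸ constantStep_nonneg hL.le L₀ hs T
  mul_le_one t := by
    rw [hγ, mul_comm, ← le_div_iff₀ (by positivity)]
    exact constantStep_le L L₀ s T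
  momentum_eq := hβ

lemma step_coefficient_le {g ν a V : ℝ} (hg : 0 ≤ g) (hV : 0 ≤ V) (hν : ν ≤ a * (24 * L * g)) :
    (3 / 4 * g * ν + 72 * L * g ^ 2) * V ≤ (18 * a + 72) * L * g ^ 2 * V := by
  refine mul_le_mul_of_nonneg_right ?_ hV
  linarith [mul_le_mul_of_nonneg_left hν hg]

end Schedules

namespace Execution

variable {X : Type*} {d n m : ℕ} {ℓ : E d → X → ℝ} {D : Fin n → Fin m → X}
  {H : Finset (Fin n)} {f b : ℕ} {C : ℝ≥0∞} {sCor sInd : ℝ} {γ β : ℕ → ℝ} {θ₀ : E d} {T : ℕ}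
  {Ω : Type*} {mΩ : MeasurableSpace Ω} {P : Measure Ω} {L G σ κ : ℝ}
  (ex : Execution ℓ D H f b C sCor sInd γ β θ₀ T P)

include ex in
lemma nontrivial (hT : 1 ≤ T) (ω : Ω) : Nontrivial (E d) := by
  obtain ⟨c, v, -, -, hv, -⟩ := ex.agg_spec 0 (by omega) ω
  exact ⟨v 0, 0, fun hzero => by simpa only [hzero, norm_zero, zero_ne_one] using (hv 0).1⟩

variable [IsProbabilityMeasure P] (hA : IsAdmissible ℓ D H f b C L G σ)
  (hκ : IsRobustnessCoefficient d n f κ)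

include hA hκ

section Convex

variable {μ : ℝ} (hμ : 0 < μ) (hF : IsStronglyConvex μ (honestLoss ℓ D H))

include hμ hF

lemma two_mul_excess_le_gradSq (hβ : ∀ t, β t ∈ Set.Icc (0 : ℝ) 1) {t : ℕ} (ht : t ≤ T) :
    2 * μ * ex.excess t ≤ ex.gradSq t := by
  rw [excess, gradSq, ← integral_const_mul]
  exact integral_mono ((ex.integrable_excess hA hκ hβ (hF.bddBelow hμ) ht).const_mul _)
    (integrable_sq_norm_of_memLp_two
      (hA.smooth.memLp_gradient_comp (ex.memLp_θ hA hκ hβ ht)))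
    fun _ => hF.le_sq_norm_gradient hμ _

lemma lyapunov_contraction (hμL : μ ≤ L) (hsched : IsStepSchedule L γ β) {t : ℕ} (ht : t < T)
    (hν : momentumVariance β t ≤ 2 * (24 * L * γ t)) :
    ex.lyapunov L (t + 1) ≤ (1 - γ t * μ) * ex.lyapunov L t + 3 * γ t * κ * G ^ 2
      + 108 * L * γ t ^ 2 * totalVariance d n m f b κ σ sCor sInd := by
  have hL := hA.pos
  have hstep := ex.lyapunov_succ_le hA hκ hsched (hF.bddBelow hμ) ht
  have hvariance := step_coefficient_le (hsched.nonneg t)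
    (totalVariance_nonneg hA.le_workers hA.batch_le hκ.1 d σ sCor sInd) hν
  have hexcess := mul_le_mul_of_nonneg_left (ex.two_mul_excess_le_gradSq hA hκ hμ hF
    (hsched.momentum_mem_Icc hL.le) ht.le) (hsched.nonneg t)
  have hgradErr : μ * (ex.gradErrSq t / (8 * L)) ≤ 2 * ex.gradErrSq t := by
    have hnonneg := ex.gradErrSq_nonneg t
    rw [← mul_div_assoc, div_le_iff₀ (by positivity)]
    linarith [mul_le_mul_of_nonneg_right hμL hnonneg, mul_nonneg hL.le hnonneg]
  have hgradErr' := mul_le_mul_of_nonneg_left hgradErr (hsched.nonneg t)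
  simp only [lyapunov] at hstep ⊢
  rw [if_pos ht] at hstep ⊢
  linarith

variable (hT : 1 ≤ T) (hγ : ∀ t, γ t = 10 / (μ * (t + 240 * (L / μ))))
  (hβ : ∀ t, β t = 1 - 24 * L * γ t)

include hT hγ hβ

lemma lyapunov_le_of_isStronglyConvex :
    ex.lyapunov L T ≤ 3 * κ * G ^ 2 / μ
      + 1200 * L * totalVariance d n m f b κ σ sCor sInd / μ ^ 2 / (T + 240 * (L / μ))
      + 5 / 4 * (honestLoss ℓ D H θ₀ - ⨅ η, honestLoss ℓ D H η) * (240 * (L / μ)) ^ 2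
        / (T + 240 * (L / μ)) ^ 2 := by
  have hL := hA.pos
  have hμL : μ ≤ L := by
    obtain ⟨ω⟩ := P.nonempty_of_neZero
    have := ex.nontrivial hT ω
    exact hF.le_of_isSmooth hA.differentiable_loss hA.smooth
  have hsched := isStepSchedule_harmonic hL hμ hγ hβ
  have hV := totalVariance_nonneg hA.le_workers hA.batch_le hκ.1 d σ sCor sInd
  have hstart := ex.lyapunov_zero_le hA (hF.bddBelow hμ)
  have hgap : 0 ≤ honestLoss ℓ D H θ₀ - ⨅ η, honestLoss ℓ D H η :=
    sub_nonneg.2 (ciInf_le (hF.bddBelow hμ) _)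
  set K := 240 * (L / μ)
  have hK : 240 ≤ K := le_mul_of_one_le_right (by norm_num) ((one_le_div hμ).2 hμL)
  have hη (t : ℕ) : 24 * L * γ t = K / (t + K) := by
    rw [hγ, harmonicStep_eq hL.ne' hμ.ne']
  have hν := momentumVariance_le_of_harmonic (β := β) (K := K) (by linarith)
    fun t => by rw [hβ, hη]
  set V := totalVariance d n m f b κ σ sCor sInd
  refine le_of_harmonic_recursion (by linarith) (by positivity) (by positivity) ?_
    (fun t ht => ?_) le_rfl
  · rw [mul_div_cancel_right₀ _ (by positivity)]
    have hheterogeneity : 0 ≤ 3 * κ * G ^ 2 / μ :=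
      div_nonneg (mul_nonneg (mul_nonneg (by norm_num) hκ.1) (sq_nonneg G)) hμ.le
    have hnoise : 0 ≤ 1200 * L * V / μ ^ 2 / K := by positivity
    linarith
  · have : 0 < (t : ℝ) + K := by positivity
    refine (ex.lyapunov_contraction hA hκ hμ hF hμL hsched ht ((hη t).symm ▸ hν t)).trans_eq ?_
    rw [hγ]
    field_simp
    ring

theorem excess_le_of_isStronglyConvex :
    Integrable (fun ω => honestLoss ℓ D H (ex.θ T ω) - ⨅ η, honestLoss ℓ D H η) P ∧
      ∫ ω, (honestLoss ℓ D H (ex.θ T ω) - ⨅ η, honestLoss ℓ D H η) ∂P ≤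
        4 * 240 / μ * κ * G ^ 2
          + 2 * 240 ^ 2 * L * totalVariance d n m f b κ σ sCor sInd / (μ ^ 2 * T)
          + 2 * 240 ^ 2 * L ^ 2 * (honestLoss ℓ D H θ₀ - ⨅ η, honestLoss ℓ D H η)
              / (μ ^ 2 * T ^ 2) := by
  have hL := hA.pos
  have hbdd := hF.bddBelow hμ
  have hsched := isStepSchedule_harmonic hL hμ hγ hβ
  refine ⟨ex.integrable_excess hA hκ (hsched.momentum_mem_Icc hL.le) hbdd le_rfl,
    (ex.excess_le_lyapunov hL.le T).trans
      ((ex.lyapunov_le_of_isStronglyConvex hA hκ hμ hF hT hγ hβ).trans ?_)⟩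
  have hV := totalVariance_nonneg hA.le_workers hA.batch_le hκ.1 d σ sCor sInd
  have hκG : 0 ≤ κ * G ^ 2 := mul_nonneg hκ.1 (sq_nonneg G)
  have hgap : 0 ≤ honestLoss ℓ D H θ₀ - ⨅ η, honestLoss ℓ D H η := sub_nonneg.2 (ciInf_le hbdd _)
  have : (0 : ℝ) < T := by exact_mod_cast hT
  have hTK : (T : ℝ) ≤ T + 240 * (L / μ) := le_add_of_nonneg_right (by positivity)
  refine add_le_add (add_le_add ?_ ?_) ?_
  · rw [show 4 * 240 / μ * κ * G ^ 2 = 960 * (κ * G ^ 2) / μ by ring]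
    exact div_le_div_of_nonneg_right (by linarith) hμ.le
  · rw [div_div]
    gcongr
    norm_num
  · rw [show 5 / 4 * (honestLoss ℓ D H θ₀ - ⨅ η, honestLoss ℓ D H η) * (240 * (L / μ)) ^ 2 =
      72000 * L ^ 2 * (honestLoss ℓ D H θ₀ - ⨅ η, honestLoss ℓ D H η) / μ ^ 2 by ring, div_div]
    gcongr
    norm_num

end Convex

section NonConvex

variable (hbdd : BddBelow (Set.range (honestLoss ℓ D H)))

include hbdd

lemma gradSq_le_two_mul_excess (hβ : ∀ t, β t ∈ Set.Icc (0 : ℝ) 1) {t : ℕ} (ht : t ≤ T) :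
    ex.gradSq t ≤ 2 * L * ex.excess t := by
  rw [excess, gradSq, ← integral_const_mul]
  exact integral_mono
    (integrable_sq_norm_of_memLp_two (hA.smooth.memLp_gradient_comp (ex.memLp_θ hA hκ hβ ht)))
    ((ex.integrable_excess hA hκ hβ hbdd ht).const_mul _)
    fun _ => hA.smooth.sq_norm_gradient_le hA.pos hA.differentiable_loss hbdd _

section ConstantStep

variable {g : ℝ} (hγ : ∀ t, γ t = g) (hsched : IsStepSchedule L γ β)

include hγ hsched

lemma lyapunov_add_sum_gradSq_le {t : ℕ} (ht : t ≤ T) :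
    ex.lyapunov L t + g / 2 * ∑ s ∈ range t, ex.gradSq s ≤
      5 / 4 * (honestLoss ℓ D H θ₀ - ⨅ η, honestLoss ℓ D H η)
        + t * (3 * g * (κ * G ^ 2)
          + 90 * L * g ^ 2 * totalVariance d n m f b κ σ sCor sInd) := by
  induction t with
  | zero => simpa using ex.lyapunov_zero_le hA hbdd
  | succ t ih =>
    have hg : 0 ≤ g := hγ 0 ▸ hsched.nonneg 0
    have hη : 24 * L * g ∈ Set.Icc (0 : ℝ) 1 :=
      ⟨mul_nonneg (mul_nonneg (by norm_num) hA.pos.le) hg, hγ 0 ▸ hsched.mul_le_one 0⟩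
    have hν := momentumVariance_le_of_const (β := β) hη (fun s => by rw [hsched.momentum_eq, hγ]) t
    have hvariance := step_coefficient_le hg
      (totalVariance_nonneg hA.le_workers hA.batch_le hκ.1 d σ sCor sInd)
      (hν.trans_eq (one_mul _).symm)
    have hstep := ex.lyapunov_succ_le hA hκ hsched hbdd (show t < T from ht)
    have hgradErr := mul_nonneg hg (ex.gradErrSq_nonneg t)
    have hprev := ih (by omega)
    rw [hγ] at hstep
    rw [Finset.sum_range_succ]
    push_cast
    linarith

lemma mean_gradSq_le (hT : 1 ≤ T) (hg : 0 < g) :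
    (T : ℝ)⁻¹ * ∑ t ∈ range T, ex.gradSq t ≤
      5 / 2 * (honestLoss ℓ D H θ₀ - ⨅ η, honestLoss ℓ D H η) / (g * T) + 6 * (κ * G ^ 2)
        + 180 * L * g * totalVariance d n m f b κ σ sCor sInd := by
  have : (0 : ℝ) < T := by exact_mod_cast hT
  have hsum := ex.lyapunov_add_sum_gradSq_le hA hκ hbdd hγ hsched le_rfl
  have hlyapunov := (ex.excess_nonneg hbdd T).trans (ex.excess_le_lyapunov hA.pos.le T)
  set V := totalVariance d n m f b κ σ sCor sInd
  set L₀ := honestLoss ℓ D H θ₀ - ⨅ η, honestLoss ℓ D H η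
  calc (T : ℝ)⁻¹ * ∑ t ∈ range T, ex.gradSq t
      ≤ (T : ℝ)⁻¹ * (2 / g *
          (5 / 4 * L₀ + T * (3 * g * (κ * G ^ 2) + 90 * L * g ^ 2 * V))) := by
        refine mul_le_mul_of_nonneg_left ?_ (by positivity)
        rw [div_mul_eq_mul_div, le_div_iff₀ hg]
        linarith
    _ = 5 / 2 * L₀ / (g * T) + 6 * (κ * G ^ 2) + 180 * L * g * V := by
        field_simp
        ring

lemma gradSq_nonpos_of_step_eq_zero (hg : g = 0)
    (hL₀ : honestLoss ℓ D H θ₀ - ⨅ η, honestLoss ℓ D H η = 0) {t : ℕ} (ht : t ≤ T) :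
    ex.gradSq t ≤ 0 := by
  have hlyapunov := ex.lyapunov_add_sum_gradSq_le hA hκ hbdd hγ hsched ht
  rw [hg, hL₀] at hlyapunov
  have hexcess : ex.excess t ≤ 0 := by linarith [ex.excess_le_lyapunov hA.pos.le t]
  exact (ex.gradSq_le_two_mul_excess hA hκ hbdd (hsched.momentum_mem_Icc hA.pos.le) ht).trans
    (mul_nonpos_of_nonneg_of_nonpos (mul_nonneg zero_le_two hA.pos.le) hexcess)

end ConstantStep

variable {L₀ σbar : ℝ} (hL₀ : L₀ = honestLoss ℓ D H θ₀ - ⨅ η, honestLoss ℓ D H η)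
  (hσbar : σbar = √(totalVariance d n m f b κ σ sCor sInd)) (hT : 1 ≤ T)
  (hγ : ∀ t, γ t = constantStep L L₀ σbar T) (hβ : ∀ t, β t = 1 - 24 * L * γ t)

include hL₀ hσbar hT hγ hβ

lemma mean_gradSq_le_of_bddBelow :
    (T : ℝ)⁻¹ * ∑ t ∈ range T, ex.gradSq t ≤
      480 * κ * G ^ 2 + √(5760 * 270 * L * L₀) * σbar / √T + 270 * L * L₀ / T := by
  have hL := hA.pos
  have hσbar0 : 0 ≤ σbar := hσbar ▸ Real.sqrt_nonneg _
  have hL₀0 : 0 ≤ L₀ := hL₀ ▸ sub_nonneg.2 (ciInf_le hbdd _)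
  have hκG : 0 ≤ κ * G ^ 2 := mul_nonneg hκ.1 (sq_nonneg G)
  have hsched := isStepSchedule_constantStep hL hσbar0 hγ hβ
  rcases (constantStep_nonneg hL.le L₀ hσbar0 T).eq_or_lt with hzero | hpos
  · have hL₀z : L₀ = 0 := eq_zero_of_constantStep_eq_zero hL hT hL₀0 hzero.symm
    have hmean : (T : ℝ)⁻¹ * ∑ t ∈ range T, ex.gradSq t ≤ 0 :=
      mul_nonpos_of_nonneg_of_nonpos (by positivity) (Finset.sum_nonpos fun t ht =>
        ex.gradSq_nonpos_of_step_eq_zero hA hκ hbdd hγ hsched hzero.symm (hL₀ ▸ hL₀z)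
          (Finset.mem_range.1 ht).le)
    rw [hL₀z, mul_zero, mul_zero, Real.sqrt_zero, zero_mul, zero_div, zero_div]
    linarith
  · have hmean := ex.mean_gradSq_le hA hκ hbdd hγ hsched hT hpos
    have hbound := constantStep_bound hL hT hL₀0 hσbar0 hpos
    rw [hσbar, Real.sq_sqrt (totalVariance_nonneg hA.le_workers hA.batch_le hκ.1 d σ sCor sInd),
      ← hσbar] at hbound
    rw [← hL₀] at hmean
    linarith

theorem gradient_le_of_bddBelow {τ : Ω → ℕ} (hτ : Measurable τ)
    (hlaw : P.map τ = uniformOn {t : ℕ | t < T})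
    (hind : IndepFun τ (fun ω (t : Fin T) => ex.θ t ω) P) :
    Integrable (fun ω => ‖∇ (honestLoss ℓ D H) (ex.θ (τ ω) ω)‖ ^ 2) P ∧
      ∫ ω, ‖∇ (honestLoss ℓ D H) (ex.θ (τ ω) ω)‖ ^ 2 ∂P ≤
        480 * κ * G ^ 2 + √(5760 * 270 * L * L₀) * σbar / √T + 270 * L * L₀ / T := by
  have hmomentum := (isStepSchedule_constantStep hA.pos (hσbar ▸ Real.sqrt_nonneg _) hγ
    hβ).momentum_mem_Icc hA.pos.le
  have hrange : {t : ℕ | t < T} = (range T : Set ℕ) := by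
    ext
    simp
  rw [hrange] at hlaw
  have heval {t : ℕ} (ht : t ∈ range T) :
      Measurable fun x : Fin T → E d => x ⟨t, Finset.mem_range.1 ht⟩ := measurable_pi_apply _
  obtain ⟨hint, hmean⟩ := integrable_and_integral_uniform_mixture hτ
    (Finset.nonempty_range_iff.2 (by omega)) hlaw
    (ψ := fun t ω => ‖∇ (honestLoss ℓ D H) (ex.θ t ω)‖ ^ 2)
    (fun t ht => integrable_sq_norm_of_memLp_two (hA.smooth.memLp_gradient_comp
      (ex.memLp_θ hA hκ hmomentum (Finset.mem_range.1 ht).le)))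
    fun t ht => hind.comp measurable_id
      (((measurable_gradient (honestLoss ℓ D H)).comp (heval ht)).norm.pow_const 2)
  rw [Finset.card_range] at hmean
  exact ⟨hint, hmean.trans_le (ex.mean_gradSq_le_of_bddBelow hA hκ hbdd hL₀ hσbar hT hγ hβ)⟩

end NonConvex

end Execution

end CafCor

open CafCor in
theorem mainTheorem1 {X : Type*} {d n m : ℕ} (f b T : ℕ)
    (hf : 2 * f < n) (hb : 1 ≤ b) (hbm : b ≤ m) (hT : 1 ≤ T)
    (H : Finset (Fin n)) (hH : H.card = n - f)
    (ℓ : E d → X → ℝ) (hℓ : ∀ x, Differentiable ℝ (fun θ => ℓ θ x))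
    (D : Fin n → Fin m → X)
    (L G σ sCor sInd : ℝ) (C : ℝ≥0∞) (hL : 0 < L)
    (hG : BoundedHeterogeneity ℓ D H G) (hσ : BoundedVariance ℓ D H σ)
    (hC : BoundedGradients ℓ D H C)
    (hsmooth : IsSmooth L (honestLoss ℓ D H)) (θ₀ : E d)
    {Ω : Type*} [MeasurableSpace Ω] (P : Measure Ω) [IsProbabilityMeasure P] :
    IsRobustnessCoefficient d n f
      (2 * f / ((n : ℝ) - 2 * f) * (1 + 6 * ((n : ℝ) - f) / ((n : ℝ) - 2 * f))) ∧
    ∀ κ : ℝ, IsRobustnessCoefficient d n f κ →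
      -- strongly convex case
      (∀ μ : ℝ, 0 < μ → IsStronglyConvex μ (honestLoss ℓ D H) →
        ∀ γ β : ℕ → ℝ, (∀ t, γ t = 10 / (μ * (t + 240 * (L / μ)))) →
          (∀ t, β t = 1 - 24 * L * γ t) →
        ∀ ex : Execution ℓ D H f b C sCor sInd γ β θ₀ T P,
          Integrable (fun ω => honestLoss ℓ D H (ex.θ T ω) - ⨅ η, honestLoss ℓ D H η) P ∧
          ∫ ω, (honestLoss ℓ D H (ex.θ T ω) - ⨅ η, honestLoss ℓ D H η) ∂P ≤
            4 * 240 / μ * κ * G ^ 2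
              + 2 * 240 ^ 2 * L * totalVariance d n m f b κ σ sCor sInd / (μ ^ 2 * T)
              + 2 * 240 ^ 2 * L ^ 2 * (honestLoss ℓ D H θ₀ - ⨅ η, honestLoss ℓ D H η)
                  / (μ ^ 2 * T ^ 2)) ∧
      -- non-convex case
      (BddBelow (Set.range (honestLoss ℓ D H)) →
        ∀ L₀ σbar : ℝ, L₀ = honestLoss ℓ D H θ₀ - ⨅ η, honestLoss ℓ D H η →
          σbar = √(totalVariance d n m f b κ σ sCor sInd) →
        ∀ γ β : ℕ → ℝ, (∀ t, γ t = constantStep L L₀ σbar T) →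
          (∀ t, β t = 1 - 24 * L * γ t) →
        ∀ ex : Execution ℓ D H f b C sCor sInd γ β θ₀ T P,
        -- the output index is uniform on `{0, …, T - 1}` and independent of the iterates
        ∀ τ : Ω → ℕ, Measurable τ →
          P.map τ = uniformOn {t : ℕ | t < T} →
          IndepFun τ (fun ω (t : Fin T) => ex.θ t ω) P →
          Integrable (fun ω => ‖∇ (honestLoss ℓ D H) (ex.θ (τ ω) ω)‖ ^ 2) P ∧
          ∫ ω, ‖∇ (honestLoss ℓ D H) (ex.θ (τ ω) ω)‖ ^ 2 ∂P ≤
            480 * κ * G ^ 2 + √(5760 * 270 * L * L₀) * σbar / √T + 270 * L * L₀ / T) := by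
  have hA : IsAdmissible ℓ D H f b C L G σ :=
    ⟨hf, hb, hbm, hH, hℓ, hL, hG, hσ, hC, hsmooth⟩
  exact ⟨isRobustnessCoefficient_caf d hf, fun κ hκ =>
    ⟨fun μ hμ hF γ β hγ hβ ex => ex.excess_le_of_isStronglyConvex hA hκ hμ hF hT hγ hβ,
      fun hbdd L₀ σbar hL₀ hσbar γ β hγ hβ ex τ hτ hlaw hind =>
        ex.gradient_le_of_bddBelow hA hκ hbdd hL₀ hσbar hT hγ hβ hτ hlaw hind⟩⟩
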